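/- Let $(S,E)$ be a finite simple graph, let $V$ be the rational vector space with basis $S$, and let $\mathcal F_3(V)$ be the free $3$-step nilpotent Lie algebra over $\mathbb Q$ on $V$. Let $\mathcal Q=\mathcal F_3(V)/\mathcal I$, where $\mathcal I$ is the ideal generated by the brackets $[\alpha,\beta]$ with $\alpha,\beta\in S$ and $\alpha\beta\notin E$, and let $V_3\subset\mathcal Q$ be the subspace spanned by all $[\alpha,[\beta,\gamma]]$ with $\alpha,\beta,\gamma\in S$ and $\beta\gamma\in E$. Let $X\in V_3$ be nonzero and let $\mathcal M=\mathcal Q/\langle X\rangle$, where $\langle X\rangle$ is the ideal generated by $X$. (1) The Lie algebra $\mathcal M$ admits no Lie algebra automorphism that is hyperbolic (that is, all of whose complex eigenvalues have modulus different from $1$) and whose characteristic polynomial has integer coefficients and constant term $\pm1$. (2) Let $M$ be the simply connected nilpotent Lie group with Lie algebra $\mathcal M\otimes\mathbb R$, and let $\Gamma\subset M$ be a lattice (a discrete subgroup with $\Gamma\backslash M$ compact) corresponding to $\mathcal M$, that is, such that the $\mathbb Q$-span of $\log\Gamma$ in $\mathcal M\otimes\mathbb R$ is $\mathcal M$. Then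 the nilmanifold $\Gamma\backslash M$ admits no Anosov automorphism; that is, there is no automorphism $\tau$ of the Lie group $M$ with $\tau(\Gamma)=\Gamma$ whose differential is hyperbolic. -/

import Mathlib

open scoped TensorProduct Topology

noncomputable section

namespace GraphNil

/-! ### Lie algebras of nilpotency class at most three -/

/-- A Lie ring in which all four-fold brackets vanish (nilpotency class at most `3`). -/
class IsThreeStep (L : Type*) [LieRing L] : Prop where
  lie4 : ∀ x y z w : L, ⁅x, ⁅y, ⁅z, w⁆⁆⁆ = 0

section FreeThreeStep

variable (S : Type*)

/-- The free `3`-step nilpotent rational Lie algebra on the rational vector space with basis `S`: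
the free Lie algebra on `S` modulo the fourth term `[L, [L, [L, L]]]` of its lower central series
(`lowerCentralSeries` is indexed from `0`, with `lowerCentralSeries 0 = ⊤`). -/
def FreeThreeStep : Type _ :=
  FreeLieAlgebra ℚ S ⧸
    LieModule.lowerCentralSeries ℚ (FreeLieAlgebra ℚ S) (FreeLieAlgebra ℚ S) 3

instance : LieRing (FreeThreeStep S) :=
  inferInstanceAs (LieRing (FreeLieAlgebra ℚ S ⧸
    LieModule.lowerCentralSeries ℚ (FreeLieAlgebra ℚ S) (FreeLieAlgebra ℚ S) 3))

instance : LieAlgebra ℚ (FreeThreeStep S) :=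
  inferInstanceAs (LieAlgebra ℚ (FreeLieAlgebra ℚ S ⧸
    LieModule.lowerCentralSeries ℚ (FreeLieAlgebra ℚ S) (FreeLieAlgebra ℚ S) 3))

variable {S}

/-- The generator of the free `3`-step nilpotent Lie algebra attached to a vertex. -/
def FreeThreeStep.of (s : S) : FreeThreeStep S :=
  LieSubmodule.Quotient.mk' (LieModule.lowerCentralSeries ℚ (FreeLieAlgebra ℚ S)
    (FreeLieAlgebra ℚ S) 3) (FreeLieAlgebra.of ℚ s)

end FreeThreeStep

section Graph

variable {S : Type*} (G : SimpleGraph S)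

/-- The ideal of the free `3`-step nilpotent Lie algebra generated by the brackets `[α, β]` of
pairs of vertices `α, β` that are not joined by an edge. -/
def nonEdgeIdeal : LieIdeal ℚ (FreeThreeStep S) :=
  LieSubmodule.lieSpan ℚ (FreeThreeStep S)
    {z | ∃ α β : S, ¬ G.Adj α β ∧ z = ⁅FreeThreeStep.of α, FreeThreeStep.of β⁆}

/-- The Lie algebra `𝒬` of the graph. -/
def GraphLie : Type _ := FreeThreeStep S ⧸ nonEdgeIdeal G

instance : LieRing (GraphLie G) :=
  inferInstanceAs (LieRing (FreeThreeStep S ⧸ nonEdgeIdeal G))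

instance : LieAlgebra ℚ (GraphLie G) :=
  inferInstanceAs (LieAlgebra ℚ (FreeThreeStep S ⧸ nonEdgeIdeal G))

/-- The element of `𝒬` given by a vertex. -/
def GraphLie.vertex (s : S) : GraphLie G :=
  LieSubmodule.Quotient.mk' (nonEdgeIdeal G) (FreeThreeStep.of s)

/-- The degree-`3` part `V₃` of `𝒬`, spanned by the `[α, [β, γ]]` with `βγ` an edge. -/
def degreeThree : Submodule ℚ (GraphLie G) :=
  Submodule.span ℚ {z | ∃ α β γ : S, G.Adj β γ ∧
    z = ⁅GraphLie.vertex G α, ⁅GraphLie.vertex G β, GraphLie.vertex G γ⁆⁆}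

/-- The Lie algebra `ℳ = 𝒬 / ⟨X⟩`, where `⟨X⟩` is the ideal generated by `X`. -/
def QuotLie (X : GraphLie G) : Type _ :=
  GraphLie G ⧸ (LieSubmodule.lieSpan ℚ (GraphLie G) {X} : LieIdeal ℚ (GraphLie G))

instance (X : GraphLie G) : LieRing (QuotLie G X) :=
  inferInstanceAs (LieRing (GraphLie G ⧸ (LieSubmodule.lieSpan ℚ (GraphLie G) {X} : LieIdeal ℚ (GraphLie G))))

instance (X : GraphLie G) : LieAlgebra ℚ (QuotLie G X) :=
  inferInstanceAs (LieAlgebra ℚ (GraphLie G ⧸ (LieSubmodule.lieSpan ℚ (GraphLie G) {X} : LieIdeal ℚ (GraphLie G))))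

end Graph

/-! ### Finite dimensionality and nilpotency of these Lie algebras -/

section Instances

theorem freeLie_subalgebra_eq_top {S : Type*} (K : LieSubalgebra ℚ (FreeLieAlgebra ℚ S))
    (hK : ∀ s, FreeLieAlgebra.of ℚ s ∈ K) (x : FreeLieAlgebra ℚ S) : x ∈ K := by
  let f : FreeLieAlgebra ℚ S →ₗ⁅ℚ⁆ K :=
    FreeLieAlgebra.lift ℚ (fun s => (⟨FreeLieAlgebra.of ℚ s, hK s⟩ : K))
  have h : K.incl.comp f = LieHom.id := by
    apply FreeLieAlgebra.hom_ext
    intro s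
    simp [f, FreeLieAlgebra.lift_of_apply]
  have h2 : K.incl (f x) = x := by
    have := congrArg (fun g : FreeLieAlgebra ℚ S →ₗ⁅ℚ⁆ FreeLieAlgebra ℚ S => g x) h
    simpa using this
  rw [← h2]
  exact (f x).2

instance isThreeStep_free (S : Type*) : IsThreeStep (FreeThreeStep S) where
  lie4 := by
    intro x y z w
    induction x using Submodule.Quotient.induction_on with | _ x => ?_
    induction y using Submodule.Quotient.induction_on with | _ y => ?_
    induction z using Submodule.Quotient.induction_on with | _ z => ?_
    induction w using Submodule.Quotient.induction_on with | _ w => ?_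
    change (LieSubmodule.Quotient.mk ⁅x, ⁅y, ⁅z, w⁆⁆⁆ : FreeThreeStep S) = 0
    rw [LieSubmodule.Quotient.mk_eq_zero']
    rw [LieModule.lowerCentralSeries_succ, LieModule.lowerCentralSeries_succ,
      LieModule.lowerCentralSeries_succ, LieModule.lowerCentralSeries_zero]
    exact LieSubmodule.lie_mem_lie (LieSubmodule.mem_top x) (LieSubmodule.lie_mem_lie
      (LieSubmodule.mem_top y) (LieSubmodule.lie_mem_lie (LieSubmodule.mem_top z)
        (LieSubmodule.mem_top w)))

theorem isThreeStep_quotient (L : Type*) [LieRing L] [LieAlgebra ℚ L] [IsThreeStep L]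
    (I : LieIdeal ℚ L) : IsThreeStep (L ⧸ I) where
  lie4 := by
    intro x y z w
    induction x using Submodule.Quotient.induction_on with | _ x => ?_
    induction y using Submodule.Quotient.induction_on with | _ y => ?_
    induction z using Submodule.Quotient.induction_on with | _ z => ?_
    induction w using Submodule.Quotient.induction_on with | _ w => ?_
    change (LieSubmodule.Quotient.mk ⁅x, ⁅y, ⁅z, w⁆⁆⁆ : L ⧸ I) = 0
    rw [IsThreeStep.lie4]
    exact (LieSubmodule.Quotient.mk_eq_zero').2 I.zero_mem

instance isThreeStep_real (L : Type*) [LieRing L] [LieAlgebra ℚ L] [IsThreeStep L] :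
    IsThreeStep (ℝ ⊗[ℚ] L) where
  lie4 := by
    intro x y z w
    induction x using TensorProduct.induction_on with
    | zero => simp
    | add a b ha hb => rw [add_lie, ha, hb, add_zero]
    | tmul a x =>
    induction y using TensorProduct.induction_on with
    | zero => simp
    | add a b ha hb => rw [add_lie, lie_add, ha, hb, add_zero]
    | tmul b y =>
    induction z using TensorProduct.induction_on with
    | zero => simp
    | add a b ha hb => rw [add_lie, lie_add, lie_add, ha, hb, add_zero]
    | tmul c z =>
    induction w using TensorProduct.induction_on with
    | zero => simp
    | add a b ha hb => rw [lie_add, lie_add, lie_add, ha, hb, add_zero]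
    | tmul d w =>
    simp [LieAlgebra.ExtendScalars.bracket_tmul, IsThreeStep.lie4]

instance finite_free (S : Type*) [Finite S] : Module.Finite ℚ (FreeThreeStep S) := by
  let g : S → FreeThreeStep S := FreeThreeStep.of
  let A : Set (FreeThreeStep S) := Set.range g ∪ Set.range (fun p : S × S => ⁅g p.1, g p.2⁆) ∪
    Set.range (fun p : S × S × S => ⁅g p.1, ⁅g p.2.1, g p.2.2⁆⁆)
  have hA : A.Finite :=
    ((Set.finite_range _).union (Set.finite_range _)).union (Set.finite_range _)
  let P : Submodule ℚ (FreeThreeStep S) := Submodule.span ℚ A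
  have hgP : ∀ s, g s ∈ P := fun s => Submodule.subset_span (Or.inl (Or.inl ⟨s, rfl⟩))
  have h1 : ∀ s, ∀ y ∈ P, ⁅g s, y⁆ ∈ P := by
    intro s y hy
    induction hy using Submodule.span_induction with
    | zero => simp
    | add a b _ _ ha hb => rw [lie_add]; exact P.add_mem ha hb
    | smul c a _ ha => rw [lie_smul]; exact P.smul_mem c ha
    | mem y hy =>
      rcases hy with (⟨t, rfl⟩ | ⟨⟨t, u⟩, rfl⟩) | ⟨⟨t, u, v⟩, rfl⟩
      · exact Submodule.subset_span (Or.inl (Or.inr ⟨(s, t), rfl⟩))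
      · exact Submodule.subset_span (Or.inr ⟨(s, t, u), rfl⟩)
      · simp only [IsThreeStep.lie4]; exact P.zero_mem
  let q : FreeLieAlgebra ℚ S → FreeThreeStep S := fun x => LieSubmodule.Quotient.mk x
  let K : LieSubalgebra ℚ (FreeLieAlgebra ℚ S) :=
    { carrier := {x | ∀ y ∈ P, ⁅q x, y⁆ ∈ P}
      zero_mem' := fun y _ => by
        have : q 0 = 0 := rfl
        rw [this, zero_lie]; exact P.zero_mem
      add_mem' := fun {a b} ha hb y hy => by
        have : q (a + b) = q a + q b := rfl
        rw [this, add_lie]; exact P.add_mem (ha y hy) (hb y hy)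
      smul_mem' := fun c a ha y hy => by
        have : q (c • a) = c • q a := rfl
        rw [this, smul_lie]; exact P.smul_mem c (ha y hy)
      lie_mem' := fun {a b} ha hb y hy => by
        have : q ⁅a, b⁆ = ⁅q a, q b⁆ := rfl
        rw [this, lie_lie]; exact P.sub_mem (ha _ (hb y hy)) (hb _ (ha y hy)) }
  have hK := freeLie_subalgebra_eq_top K (fun s => h1 s)
  let K' : LieSubalgebra ℚ (FreeLieAlgebra ℚ S) :=
    { carrier := {x | q x ∈ P}
      zero_mem' := P.zero_mem
      add_mem' := fun {a b} ha hb => P.add_mem (x := q a) (y := q b) ha hb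
      smul_mem' := fun c a ha => P.smul_mem (x := q a) c ha
      lie_mem' := fun {a b} ha hb => hK a (q b) hb }
  have hK' := freeLie_subalgebra_eq_top K' hgP
  have hP : P = ⊤ := by
    rw [eq_top_iff]
    intro x _
    induction x using Submodule.Quotient.induction_on with | _ x => ?_
    exact hK' x
  exact ⟨hP ▸ Submodule.fg_span hA⟩

theorem finite_quotient (L : Type*) [LieRing L] [LieAlgebra ℚ L] [Module.Finite ℚ L]
    (I : LieIdeal ℚ L) : Module.Finite ℚ (L ⧸ I) :=
  Module.Finite.of_surjective (LieSubmodule.Quotient.mk' I : L →ₗ[ℚ] L ⧸ I)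
    (LieSubmodule.Quotient.surjective_mk' I)

instance isThreeStep_graph {S : Type*} (G : SimpleGraph S) : IsThreeStep (GraphLie G) :=
  isThreeStep_quotient (FreeThreeStep S) (nonEdgeIdeal G)

instance isThreeStep_quot {S : Type*} (G : SimpleGraph S) (X : GraphLie G) :
    IsThreeStep (QuotLie G X) :=
  isThreeStep_quotient (GraphLie G) (LieSubmodule.lieSpan ℚ (GraphLie G) {X})

instance finite_graph {S : Type*} [Finite S] (G : SimpleGraph S) :
    Module.Finite ℚ (GraphLie G) :=
  finite_quotient (FreeThreeStep S) (nonEdgeIdeal G)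

instance finite_quot {S : Type*} [Finite S] (G : SimpleGraph S) (X : GraphLie G) :
    Module.Finite ℚ (QuotLie G X) :=
  finite_quotient (GraphLie G) (LieSubmodule.lieSpan ℚ (GraphLie G) {X})

end Instances

/-! ### Hyperbolicity and integrality -/

/-- An endomorphism of a finite-dimensional vector space over a subfield `K` of `ℂ` is hyperbolic
if none of its complex eigenvalues has modulus `1`. -/
def IsHyperbolic {K V : Type*} [Field K] [Algebra K ℂ] [AddCommGroup V] [Module K V]
    [Module.Finite K V] (f : V →ₗ[K] V) : Prop :=
  ∀ z : ℂ, Polynomial.aeval z f.charpoly = 0 → ‖z‖ ≠ 1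

/-- The characteristic polynomial has integer coefficients and constant term a unit of `ℤ`. -/
def HasIntegralUnitCharpoly {V : Type*} [AddCommGroup V] [Module ℚ V] [Module.Finite ℚ V]
    (f : V →ₗ[ℚ] V) : Prop :=
  ∃ p : Polynomial ℤ, f.charpoly = p.map (Int.castRingHom ℚ) ∧ IsUnit (p.coeff 0)

/-! ### The simply connected nilpotent Lie group of a real Lie algebra of class at most three -/

/-- The simply connected nilpotent Lie group with Lie algebra `L` (real, finite-dimensional, of
class at most `3`), in exponential coordinates: the exponential map `exp : L → N` is a
homeomorphism with inverse `log`, and the multiplication is given by the Baker-Campbell-Hausdorff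
formula, in which only brackets of length at most three survive. -/
@[ext]
structure NilGroup (L : Type*) where
  exp ::
  log : L

namespace NilGroup

variable {L : Type*} [LieRing L] [LieAlgebra ℝ L]

/-- The Baker-Campbell-Hausdorff product
`x + y + (1/2) [x, y] + (1/12) ([x, [x, y]] + [y, [y, x]])`. -/
def bch (x y : L) : L :=
  x + y + (1 / 2 : ℝ) • ⁅x, y⁆ + (1 / 12 : ℝ) • (⁅x, ⁅x, y⁆⁆ + ⁅y, ⁅y, x⁆⁆)

theorem bch_assoc [IsThreeStep L] (x y z : L) : bch (bch x y) z = bch x (bch y z) := by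
  have h4 : ∀ x y z w : L, ⁅x, ⁅y, ⁅z, w⁆⁆⁆ = 0 := IsThreeStep.lie4
  have h5 : ∀ a b c d : L, ⁅⁅a, b⁆, ⁅c, d⁆⁆ = 0 := by
    intro a b c d
    rw [lie_lie, h4, h4, sub_zero]
  have h6 : ∀ a b c d : L, ⁅⁅a, ⁅b, c⁆⁆, d⁆ = 0 := by
    intro a b c d
    rw [← lie_skew, h4, neg_zero]
  have e1 : ⁅z, ⁅x, y⁆⁆ = ⁅y, ⁅x, z⁆⁆ - ⁅x, ⁅y, z⁆⁆ := by
    rw [leibniz_lie z x y, ← lie_skew z x, ← lie_skew z y, ← lie_skew _ y, lie_neg, lie_neg,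
      neg_neg]
    abel
  have a1 : ∀ a b c : L, ⁅⁅a, b⁆, c⁆ = -⁅c, ⁅a, b⁆⁆ := fun a b c => (lie_skew _ _).symm
  have s1 : ⁅y, x⁆ = -⁅x, y⁆ := (lie_skew _ _).symm
  have s2 : ⁅z, x⁆ = -⁅x, z⁆ := (lie_skew _ _).symm
  have s3 : ⁅z, y⁆ = -⁅y, z⁆ := (lie_skew _ _).symm
  simp only [bch, lie_add, add_lie, lie_smul, smul_lie, h4, h5, h6, smul_zero, add_zero, smul_add]
  simp only [a1, lie_neg, h4, neg_zero, smul_zero, add_zero]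
  simp only [s1, s2, s3, lie_neg, e1]
  module

instance [IsThreeStep L] : Group (NilGroup L) where
  mul a b := exp (bch a.log b.log)
  one := exp 0
  inv a := exp (-a.log)
  mul_assoc a b c := NilGroup.ext (bch_assoc a.log b.log c.log)
  one_mul a := NilGroup.ext (by change bch 0 a.log = a.log; simp [bch])
  mul_one a := NilGroup.ext (by change bch a.log 0 = a.log; simp [bch])
  inv_mul_cancel a := NilGroup.ext (by change bch (-a.log) a.log = 0; simp [bch])

/-- The topology transported along `log` from the canonical topology of the finite-dimensional
real vector space `L`. -/
instance : TopologicalSpace (NilGroup L) :=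
  TopologicalSpace.induced log (moduleTopology ℝ L)

variable [IsThreeStep L]

/-- A lattice: a discrete subgroup `Γ` such that `Γ \ N` is compact. -/
def IsLattice (Γ : Subgroup (NilGroup L)) : Prop :=
  DiscreteTopology Γ ∧ CompactSpace (Quotient (QuotientGroup.rightRel Γ))

/-- `D` is the differential at the identity of the map `τ : N → N`: the derivative at `t = 0` of
`t ↦ τ (exp (t v))` is `D v` for each `v` in the Lie algebra (in the chart `log`). -/
def IsDifferential (τ : NilGroup L → NilGroup L) (D : L →ₗ[ℝ] L) : Prop :=
  letI : TopologicalSpace L := moduleTopology ℝ L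
  ∀ v : L, HasDerivAt (fun t : ℝ => (τ (exp (t • v))).log) (D v) 0

/-- The nilmanifold `Γ \ N` admits an Anosov automorphism: there is an automorphism `τ` of the Lie
group `N` with `τ(Γ) = Γ` whose differential is hyperbolic. (Automorphisms of a Lie group are the
bicontinuous automorphisms of the group.) -/
def AdmitsAnosovAutomorphism [Module.Finite ℝ L] (Γ : Subgroup (NilGroup L)) : Prop :=
  ∃ τ : NilGroup L ≃ₜ* NilGroup L, Γ.map (τ : NilGroup L →* NilGroup L) = Γ ∧
    ∃ D : L →ₗ[ℝ] L, IsDifferential τ D ∧ IsHyperbolic D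

/-- A subgroup `Γ` of the simply connected Lie group with Lie algebra `ℝ ⊗ M` corresponds to the
rational Lie algebra `M` if the rational span of `log Γ` is the rational form `1 ⊗ M`. -/
def CorrespondsTo {M : Type*} [LieRing M] [LieAlgebra ℚ M] [IsThreeStep M]
    (Γ : Subgroup (NilGroup (ℝ ⊗[ℚ] M))) : Prop :=
  Submodule.span ℚ (log '' (Γ : Set (NilGroup (ℝ ⊗[ℚ] M)))) =
    LinearMap.range (TensorProduct.mk ℚ ℝ M 1)

end NilGroup

end GraphNil

end

/-! A surjective Lie endomorphism `θ` of `ℳ` induces a matrix `A` on the abelianization `ℚ^S`. The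
dual of `V₃` is modelled by `forms`: trilinear forms in the vertices, skew in the last two slots,
satisfying Jacobi and vanishing off the edges. Evaluation at `X` is a functional `ε` on forms, and
its kernel consists of the forms that descend to `ℳ`. Pull-back along `A` preserves this kernel, so
`ε` is an eigenfunctional; its eigenvalue `lam` is rational because `X` is.

`A` respects the non-edge relations. Comparing dimensions of centralizers shows that some power of
`A` is supported on the domination preorder (`Respects.exists_pow_dom`), and passing to a power
preserves hyperbolicity and units. Over the algebraic closure such a matrix is conjugate, compatibly
with the relations, to a triangular `A'` whose diagonal entries are permuted by Galois through
edge-preserving permutations of the vertices (`exists_triangular_form`). Forms are filtered by a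
height that separates multisets of three vertices, and `A'` acts on each layer by the product of
three diagonal entries. Hence (`exists_path_eigenvalue`) `lam` is the product over some path `i - j
- k`, while the product over any path with another vertex multiset, or over any triangle, remains an
eigenvalue on `ker ε`, hence on `ℳ`.

Now `lam` is a rational unit, so `±1`. Hyperbolicity excludes that `i, k` are adjacent and forces
the Galois permutations to preserve `{i, j, k}`, hence to fix the centre `j`. So the eigenvalue `A'
j j` on the abelianization is itself a rational unit, of modulus one: a contradiction.

For nilmanifolds, an automorphism preserving `Γ` is linear in exponential coordinates and defined
over `ℚ`. The lattice is finitely generated, so its image in `ℝ^S` is a finitely generated group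
mapped onto itself by `A`, and the eigenvalues of `A` are units. The core argument uses integrality
only on the abelianization, so `false_of_isHyperbolic` serves both parts. -/

noncomputable section

set_option linter.unusedSectionVars false

namespace GraphNil

/-! ### The domination preorder on vertices -/

section Domination

variable {S : Type*} (G : SimpleGraph S)

/-- The vertex `j` dominates `i`: each neighbour of `i` is equal or adjacent to `j`. -/
def Dom (i j : S) : Prop := ∀ x, G.Adj i x → x = j ∨ G.Adj j x

variable {G}

theorem Dom.refl (i : S) : Dom G i i := fun _ h => Or.inr h

theorem Dom.trans {i j k : S} (h₁ : Dom G i j) (h₂ : Dom G j k) : Dom G i k := by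
  intro x hx
  -- When the neighbour of `i` is `j` itself, `i` is in turn a neighbour of `j`. Then `h₂` makes `i`
  -- adjacent to `k` (unless they are equal), and `h₁` at `k` concludes.
  rcases h₁ x hx with rfl | h
  · by_cases hik : i = k
    · exact Or.inr (hik ▸ hx)
    · rcases h₂ i hx.symm with h | h
      · exact absurd h hik
      · rcases h₁ k h.symm with h' | h'
        · exact Or.inl h'.symm
        · exact Or.inr h'.symm
  · exact h₂ x h

/-- Adjacency is inherited by dominating vertices. -/
theorem Dom.adj {i j k l : S} (h : G.Adj i j) (hi : Dom G i k) (hj : Dom G j l) :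
    k = l ∨ G.Adj k l := by
  by_cases hkl : k = l
  · exact Or.inl hkl
  right
  rcases hi j h with rfl | h'
  · rcases hj i h.symm with rfl | h''
    · exact h.symm
    · rcases hi l h''.symm with h3 | h3
      · exact absurd h3.symm hkl
      · exact h3
  · rcases hj k h'.symm with h'' | h''
    · exact absurd h'' hkl
    · exact h''.symm

variable [Fintype S]

-- Open neighbourhoods are compared when `i` and `j` are not adjacent, closed ones when they are.
open Classical in
theorem Dom.degree_le {i j : S} (h : Dom G i j) : G.degree i ≤ G.degree j := by
  by_cases hij : G.Adj i j
  · rw [← Nat.add_le_add_iff_right (n := 1)]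
    have hi : i ∉ G.neighborFinset i := by simp
    have hj : j ∉ G.neighborFinset j := by simp
    rw [← G.card_neighborFinset_eq_degree, ← G.card_neighborFinset_eq_degree,
      ← Finset.card_insert_of_notMem hi, ← Finset.card_insert_of_notMem hj]
    apply Finset.card_le_card
    intro x hx
    rcases Finset.mem_insert.1 hx with rfl | hx
    · simp [hij.symm]
    · simpa using h x (by simpa using hx)
  · rw [← G.card_neighborFinset_eq_degree, ← G.card_neighborFinset_eq_degree]
    apply Finset.card_le_card
    intro x hx
    have hx : G.Adj i x := by simpa using hx
    rcases h x hx with rfl | h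
    · exact absurd hx hij
    · simpa using h

-- The inclusion of open or closed neighbourhoods is an equality when the sizes agree. Thus strict
-- domination strictly raises the degree.
open Classical in
theorem Dom.symm_of_degree_eq {i j : S} (h : Dom G i j) (hd : G.degree i = G.degree j) :
    Dom G j i := by
  by_cases hij : G.Adj i j
  · have hi : i ∉ G.neighborFinset i := by simp
    have hj : j ∉ G.neighborFinset j := by simp
    have hs : insert i (G.neighborFinset i) = insert j (G.neighborFinset j) := by
      apply Finset.eq_of_subset_of_card_le
      · intro x hx
        rcases Finset.mem_insert.1 hx with rfl | hx
        · simp [hij.symm]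
        · simpa using h x (by simpa using hx)
      · rw [Finset.card_insert_of_notMem hi, Finset.card_insert_of_notMem hj]
        simp [hd]
    intro x hx
    have : x ∈ insert j (G.neighborFinset j) := by simp [hx]
    rw [← hs] at this
    simpa using this
  · have hs : G.neighborFinset i = G.neighborFinset j := by
      apply Finset.eq_of_subset_of_card_le
      · intro x hx
        have hx : G.Adj i x := by simpa using hx
        rcases h x hx with rfl | h
        · exact absurd hx hij
        · simpa using h
      · simp [hd]
    intro x hx
    have : x ∈ G.neighborFinset j := by simpa using hx
    rw [← hs] at this
    exact Or.inr (by simpa using this)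

end Domination

/-! ### Linear maps respecting the non-edge relations -/

section Respects

variable {S : Type*} [Fintype S] (G : SimpleGraph S) {K : Type*} [Field K]

/-- The linear map with matrix `g` sends the span of the `α ∧ γ`, with `α, γ` non-adjacent,
into itself. -/
def Respects (g : Matrix S S K) : Prop :=
  ∀ α γ β δ, ¬ G.Adj α γ → G.Adj β δ → g β α * g δ γ = g δ α * g β γ

variable {G}

/-- Each column `γ` is supported on vertices dominated by `γ`. By `Dom.adj`, an edge `βδ` dominated
endpoint by endpoint by distinct `α, γ` would make these adjacent, so both products vanish. -/
theorem respects_of_dom {g : Matrix S S K} (h : ∀ β γ, g β γ ≠ 0 → Dom G β γ) :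
    Respects G g := by
  have key : ∀ α γ β δ, ¬ G.Adj α γ → α ≠ γ → G.Adj β δ → g β α * g δ γ = 0 := by
    intro α γ β δ h1 hne h2
    by_contra h0
    rcases Dom.adj h2 (h _ _ (left_ne_zero_of_mul h0)) (h _ _ (right_ne_zero_of_mul h0)) with h | h
    · exact hne h
    · exact h1 h
  intro α γ β δ h1 h2
  by_cases hne : α = γ
  · subst hne; ring
  · rw [key α γ β δ h1 hne h2, key α γ δ β h1 hne h2.symm]

theorem Respects.map {L : Type*} [Field L] (f : K →+* L) {g : Matrix S S K} (h : Respects G g) :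
    Respects G (g.map f) := by
  intro α γ β δ h1 h2
  simp only [Matrix.map_apply, ← map_mul, h α γ β δ h1 h2]

variable (G) in
/-- The centralizer of a vector in the quotient by the non-edge relations. -/
def centralizer (v : S → K) : Submodule K (S → K) where
  carrier := {w | ∀ β δ, G.Adj β δ → v β * w δ = v δ * w β}
  zero_mem' := by intro β δ _; simp
  add_mem' := by
    intro a b ha hb β δ h
    simp only [Pi.add_apply, mul_add, ha β δ h, hb β δ h]
  smul_mem' := by
    intro c a ha β δ h
    simp only [Pi.smul_apply, smul_eq_mul]
    rw [mul_left_comm, ha β δ h, mul_left_comm]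

theorem Respects.mulVec_mem [CharZero K] {g : Matrix S S K} (hg : Respects G g) {v w : S → K}
    (h : w ∈ centralizer G v) : g.mulVec w ∈ centralizer G (g.mulVec v) := by
  intro β δ hβδ
  rw [← sub_eq_zero]
  have e : ∀ β δ, g.mulVec v β * g.mulVec w δ
      = ∑ α, ∑ γ, v α * w γ * (g β α * g δ γ) := by
    intro β δ
    simp only [Matrix.mulVec, dotProduct, Finset.sum_mul_sum]
    refine Finset.sum_congr rfl fun α _ => Finset.sum_congr rfl fun γ _ => by ring
  have e1 : g.mulVec v β * g.mulVec w δ - g.mulVec v δ * g.mulVec w β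
      = ∑ α, ∑ γ, v α * w γ * (g β α * g δ γ - g δ α * g β γ) := by
    rw [e, e, ← Finset.sum_sub_distrib]
    refine Finset.sum_congr rfl fun α _ => ?_
    rw [← Finset.sum_sub_distrib]
    refine Finset.sum_congr rfl fun γ _ => by ring
  have e2 : g.mulVec v β * g.mulVec w δ - g.mulVec v δ * g.mulVec w β
      = ∑ α, ∑ γ, v γ * w α * (g β γ * g δ α - g δ γ * g β α) := by
    rw [e1, Finset.sum_comm]
  -- Doubling symmetrizes the sum in `α, γ`: each term becomes `v α * w γ - v γ * w α` times a minor
  -- of `g`. The first factor vanishes on edges, the second on non-edges.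
  have e3 : (2 : K) * (g.mulVec v β * g.mulVec w δ - g.mulVec v δ * g.mulVec w β) = 0 := by
    rw [two_mul]
    nth_rewrite 1 [e1]
    rw [e2, ← Finset.sum_add_distrib]
    refine Finset.sum_eq_zero fun α _ => ?_
    rw [← Finset.sum_add_distrib]
    refine Finset.sum_eq_zero fun γ _ => ?_
    by_cases hαγ : G.Adj α γ
    · have := h α γ hαγ
      linear_combination (g β α * g δ γ - g δ α * g β γ) * this
    · have := hg α γ β δ hαγ hβδ
      linear_combination (v α * w γ - v γ * w α) * this
  simpa using e3

/-- Restriction of the centralizer of `v` to the vertices not adjacent to `α`. -/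
def centralizerRestrict (v : S → K) (α : S) :
    centralizer G v →ₗ[K] ({γ // ¬ G.Adj α γ} → K) :=
  (LinearMap.funLeft K K Subtype.val).comp (centralizer G v).subtype

/-- The relation `v α * w γ = v γ * w α` recovers `w` at a neighbour `γ` of `α` from `w α`, and `α`
counts among its own non-neighbours. -/
theorem centralizerRestrict_injective {v : S → K} {α : S} (hα : v α ≠ 0) :
    Function.Injective (centralizerRestrict (G := G) v α) := by
  rw [← LinearMap.ker_eq_bot, LinearMap.ker_eq_bot']
  rintro ⟨w, hw⟩ h
  have h0 : ∀ γ, ¬ G.Adj α γ → w γ = 0 := fun γ hγ => congrFun h ⟨γ, hγ⟩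
  ext γ
  change w γ = 0
  by_cases hγ : G.Adj α γ
  · have := hw α γ hγ
    rw [h0 α (by simp), mul_zero] at this
    exact (mul_eq_zero.1 this).resolve_left hα
  · exact h0 γ hγ

open Classical in
theorem finrank_nonneighbors (α : S) :
    Module.finrank K ({γ // ¬ G.Adj α γ} → K) = Fintype.card S - G.degree α := by
  rw [Module.finrank_fintype_fun_eq_card, Fintype.card_subtype_compl,
    ← G.card_neighborFinset_eq_degree, Fintype.card_subtype]
  congr 2
  ext; simp

open Classical in
theorem finrank_centralizer_le {v : S → K} {α : S} (hα : v α ≠ 0) :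
    Module.finrank K (centralizer G v) ≤ Fintype.card S - G.degree α := by
  rw [← finrank_nonneighbors (K := K)]
  exact LinearMap.finrank_le_finrank_of_injective (centralizerRestrict_injective hα)

-- When the bound is attained, values on the non-neighbours of `α` can be prescribed freely. If `β`
-- had a neighbour `δ` outside the closed neighbourhood of `α`, prescribing `1` at `δ` and `0`
-- elsewhere would violate the relation on the edge `βδ`.
open Classical in
theorem dom_of_finrank_centralizer {v : S → K} {α : S} (hα : v α ≠ 0)
    (h : Fintype.card S - G.degree α ≤ Module.finrank K (centralizer G v)) {β : S}
    (hβ : v β ≠ 0) : Dom G β α := by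
  have hs : Function.Surjective (centralizerRestrict (G := G) v α) := by
    rw [← LinearMap.injective_iff_surjective_of_finrank_eq_finrank]
    · exact centralizerRestrict_injective hα
    · rw [finrank_nonneighbors]
      exact le_antisymm (finrank_centralizer_le hα) h
  intro δ hδ
  by_contra hc
  push Not at hc
  obtain ⟨⟨w, hw⟩, hw'⟩ := hs (Pi.single ⟨δ, hc.2⟩ 1)
  have h0 : ∀ γ (hγ : ¬ G.Adj α γ), w γ = Pi.single (M := fun _ => K) (⟨δ, hc.2⟩ : {γ // ¬ G.Adj α γ}) 1 ⟨γ, hγ⟩ :=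
    fun γ hγ => congrFun hw' ⟨γ, hγ⟩
  have h1 : w δ = 1 := by rw [h0 δ hc.2, Pi.single_eq_same]
  have h2 : ∀ γ, ¬ G.Adj α γ → γ ≠ δ → w γ = 0 := by
    intro γ hγ hne
    rw [h0 γ hγ, Pi.single_eq_of_ne (by simpa using hne)]
  have hα0 : w α = 0 := h2 α (by simp) (Ne.symm hc.1)
  have h3 : w β = 0 := by
    by_cases hb : G.Adj α β
    · have := hw α β hb
      rw [hα0, mul_zero] at this
      exact (mul_eq_zero.1 this).resolve_left hα
    · exact h2 β hb hδ.ne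
  have := hw β δ hδ
  rw [h1, h3, mul_zero, mul_one] at this
  exact hβ this

-- Prescribed values extend to the neighbours of `α` by a multiple of `v`, scaled to match at `α`.
-- Domination places the neighbours of the support of `v` at `α` or among its neighbours, where `w`
-- is that same multiple.
open Classical in
theorem le_finrank_centralizer {v : S → K} {α : S} (hα : v α ≠ 0)
    (h : ∀ β, v β ≠ 0 → Dom G β α) :
    Fintype.card S - G.degree α ≤ Module.finrank K (centralizer G v) := by
  rw [← finrank_nonneighbors (K := K)]
  apply LinearMap.finrank_le_finrank_of_surjective (f := centralizerRestrict (G := G) v α)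
  intro t
  let c : K := t ⟨α, by simp⟩ / v α
  let w : S → K := fun γ => if hγ : G.Adj α γ then c * v γ else t ⟨γ, hγ⟩
  have hwα : w α = c * v α := by simp [w, c, hα]
  refine ⟨⟨w, ?_⟩, ?_⟩
  · have key : ∀ β δ, G.Adj β δ → v β ≠ 0 → w δ = c * v δ := by
      intro β δ hβδ hβ
      rcases h β hβ δ hβδ with rfl | h'
      · exact hwα
      · simp [w, h']
    intro β δ hβδ
    by_cases h1 : v β = 0
    · by_cases h2 : v δ = 0
      · simp [h1, h2]
      · rw [key δ β hβδ.symm h2, h1]; simp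
    · by_cases h2 : v δ = 0
      · rw [key β δ hβδ h1, h2]; simp
      · rw [key β δ hβδ h1, key δ β hβδ.symm h2]; ring
  · ext ⟨γ, hγ⟩
    change w γ = _
    simp [w, hγ]

end Respects

/-! ### Powers of a compatible matrix and domination -/

theorem exists_iterate_idempotent {S : Type*} [Finite S] (f : S → S) :
    ∃ m, 0 < m ∧ f^[m + m] = f^[m] := by
  obtain ⟨a, b, hne, hab⟩ := Finite.exists_ne_map_eq_of_infinite (fun n : ℕ => f^[n])
  wlog h : a < b generalizing a b
  · exact this b a hne.symm hab.symm (lt_of_le_of_ne (not_lt.1 h) hne.symm)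
  obtain ⟨p, rfl⟩ := Nat.exists_eq_add_of_lt h
  have hab : f^[a] = f^[a + p + 1] := hab
  have h1 : ∀ n, a ≤ n → f^[n + (p + 1)] = f^[n] := by
    intro n hn
    obtain ⟨k, rfl⟩ := Nat.exists_eq_add_of_le hn
    rw [show a + k + (p + 1) = k + (a + p + 1) by ring, Function.iterate_add, ← hab,
      ← Function.iterate_add, Nat.add_comm]
  have h2 : ∀ k n, a ≤ n → f^[n + k * (p + 1)] = f^[n] := by
    intro k
    induction k with
    | zero => intro n _; simp
    | succ k ih =>
      intro n hn
      rw [show n + (k + 1) * (p + 1) = (n + k * (p + 1)) + (p + 1) by ring,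
        h1 _ (by omega), ih n hn]
  -- A positive multiple of the period `p + 1` that is at least the preperiod `a`.
  refine ⟨(a + 1) * (p + 1), by positivity, h2 (a + 1) _ ?_⟩
  nlinarith

section

variable {S : Type*} [Fintype S] [DecidableEq S] (G : SimpleGraph S) (K : Type*) [Field K]

/-- The coordinate subspace spanned by the vertices dominated by `α`. -/
def dominated (α : S) : Submodule K (S → K) where
  carrier := {v | ∀ β, v β ≠ 0 → Dom G β α}
  zero_mem' := by intro β h; simp at h
  add_mem' := by
    intro a b ha hb β h
    by_cases h1 : a β = 0
    · exact hb β (by simpa [h1] using h)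
    · exact ha β h1
  smul_mem' := by
    intro c a ha β h
    exact ha β (right_ne_zero_of_mul h)

/-- The coordinate subspace spanned by the vertices of degree less than `d`. -/
def lowDegree (d : ℕ) : Submodule K (S → K) where
  carrier := {v | ∀ β, v β ≠ 0 → (G.neighborSet β).ncard < d}
  zero_mem' := by intro β h; simp at h
  add_mem' := by
    intro a b ha hb β h
    by_cases h1 : a β = 0
    · exact hb β (by simpa [h1] using h)
    · exact ha β h1
  smul_mem' := by
    intro c a ha β h
    exact ha β (right_ne_zero_of_mul h)

variable {G K}

omit [DecidableEq S] in
open Classical in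
theorem ncard_neighborSet (α : S) : (G.neighborSet α).ncard = G.degree α := by
  rw [Set.ncard_eq_toFinset_card', ← G.card_neighborFinset_eq_degree]; rfl

omit [DecidableEq S] in
theorem mulVec_mem_of_col {g : Matrix S S K} {N N' : Submodule K (S → K)}
    {s : Set S} (hN : ∀ v ∈ N, ∀ β, v β ≠ 0 → β ∈ s) (h : ∀ γ ∈ s, g.col γ ∈ N') {v : S → K}
    (hv : v ∈ N) : g.mulVec v ∈ N' := by
  have : g.mulVec v = ∑ γ, v γ • g.col γ := by
    ext β; simp [Matrix.mulVec, dotProduct, mul_comm]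
  rw [this]
  refine N'.sum_mem fun γ _ => ?_
  by_cases h0 : v γ = 0
  · simp [h0]
  · exact N'.smul_mem _ (h γ (hN v hv γ h0))

theorem map_eq_of_injective {V : Type*} [AddCommGroup V] [Module K V] [Module.Finite K V]
    {f : V →ₗ[K] V} (hf : Function.Injective f) {N : Submodule K V} (h : ∀ v ∈ N, f v ∈ N) :
    N.map f = N := by
  apply Submodule.eq_of_le_of_finrank_eq
  · rintro _ ⟨v, hv, rfl⟩; exact h v hv
  · exact (LinearEquiv.finrank_eq (Submodule.equivMapOfInjective f hf N)).symm

/-- An injective `g` cannot lower the dimension of a centralizer, which at the basis vector of `α`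
is `|S| - deg α`. So the column of `α` involves only vertices of degree at most `deg α`. One of them
has equal degree, since `g` already maps the span of the vertices of lower degree onto itself. That
vertex is `f α`; the dimension bound is then attained, and this yields domination by `f α`. -/
theorem Respects.exists_vertexMap [CharZero K] {g : Matrix S S K} (hg : Respects G g)
    (hi : Function.Injective g.mulVec) :
    ∃ f : S → S, ∀ α, (G.neighborSet (f α)).ncard = (G.neighborSet α).ncard ∧
      ∀ γ, Dom G γ α → ∀ β, g β γ ≠ 0 → Dom G β (f α) := by
  classical
  have hz : ∀ v, Module.finrank K (centralizer G v) ≤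
      Module.finrank K (centralizer G (g.mulVec v)) := by
    intro v
    let F : centralizer G v →ₗ[K] centralizer G (g.mulVec v) :=
      g.mulVecLin.restrict (fun w hw => hg.mulVec_mem hw)
    apply LinearMap.finrank_le_finrank_of_injective (f := F)
    intro a b hab
    exact Subtype.ext (hi (congrArg Subtype.val hab))
  have hdeg : ∀ α : S, G.degree α < Fintype.card S := fun α => G.degree_lt_card_verts α
  have hsingle : ∀ α : S, ∀ β, (Pi.single α 1 : S → K) β ≠ 0 → β = α := by
    intro α β h
    by_contra hne
    exact h (Pi.single_eq_of_ne hne _)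
  have hle : ∀ α β, g β α ≠ 0 → G.degree β ≤ G.degree α := by
    intro α β h
    have h1 := le_finrank_centralizer (G := G) (v := (Pi.single α 1 : S → K)) (α := α) (by simp)
      (fun β hβ => by rw [hsingle α β hβ]; exact Dom.refl α)
    have h2 := hz (Pi.single α 1)
    have h3 := finrank_centralizer_le (G := G) (v := g.mulVec (Pi.single α 1)) (α := β)
      (by simpa using h)
    have := hdeg α
    have := hdeg β
    omega
  have hex : ∀ α, ∃ β, g β α ≠ 0 ∧ G.degree β = G.degree α := by
    intro α
    by_contra hc
    push Not at hc
    have hmap := map_eq_of_injective (f := g.mulVecLin) hi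
      (N := lowDegree G K (G.degree α)) (fun v hv => by
        refine mulVec_mem_of_col (N := lowDegree G K (G.degree α)) (s := {β | (G.neighborSet β).ncard < G.degree α})
          (fun v hv β hβ => hv β hβ) ?_ hv
        intro γ hγ β hβ
        rw [ncard_neighborSet]
        rw [Set.mem_ofPred_eq, ncard_neighborSet] at hγ
        exact lt_of_le_of_lt (hle γ β hβ) hγ)
    have hmem : g.mulVec (Pi.single α 1) ∈ lowDegree G K (G.degree α) := by
      intro β hβ
      rw [ncard_neighborSet]
      have hβ : g β α ≠ 0 := by simpa using hβ
      exact lt_of_le_of_ne (hle α β hβ) (hc β hβ)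
    rw [← hmap] at hmem
    obtain ⟨v, hv, hv'⟩ := hmem
    have : v = Pi.single α 1 := hi hv'
    subst this
    have := hv α (by simp)
    rw [ncard_neighborSet] at this
    omega
  choose f hf hfd using hex
  refine ⟨f, fun α => ⟨by rw [ncard_neighborSet, ncard_neighborSet, hfd], ?_⟩⟩
  have key : ∀ v : S → K, v α ≠ 0 → (∀ β, v β ≠ 0 → Dom G β α) → g.mulVec v (f α) ≠ 0 →
      ∀ β, g.mulVec v β ≠ 0 → Dom G β (f α) := by
    intro v hv hd h0 β hβ
    refine dom_of_finrank_centralizer h0 ?_ hβ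
    rw [hfd]
    exact (le_finrank_centralizer hv hd).trans (hz v)
  have hα : ∀ β, g β α ≠ 0 → Dom G β (f α) := by
    intro β hβ
    refine key (Pi.single α 1) (by simp) (fun β hβ => ?_) (by simpa using hf α) β (by simpa using hβ)
    rw [hsingle α β hβ]; exact Dom.refl α
  intro γ hγ β hβ
  by_cases hγα : γ = α
  · exact hα β (hγα ▸ hβ)
  by_cases hβα : g β α = 0
  -- The column of `α` misses `β`, so a multiple of the basis vector of `γ` is added to that of `α`.
  -- One of the signs `±1` keeps the coordinate at `f α` nonzero.
  · have hc : ∃ c : K, c ≠ 0 ∧ g (f α) α + c * g (f α) γ ≠ 0 := by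
      by_cases h1 : g (f α) α + 1 * g (f α) γ = 0
      · refine ⟨-1, by simp, fun h2 => hf α ?_⟩
        have : 2 * g (f α) α = 0 := by linear_combination h1 + h2
        simpa using this
      · exact ⟨1, one_ne_zero, h1⟩
    obtain ⟨c, hc0, hc⟩ := hc
    have e : ∀ β, g.mulVec (Pi.single α 1 + c • Pi.single γ 1) β = g β α + c * g β γ := by
      intro β
      rw [Matrix.mulVec_add, Matrix.mulVec_smul]
      simp
    refine key (Pi.single α 1 + c • Pi.single γ 1) ?_ ?_ (by rw [e]; exact hc) β ?_
    · simp [Pi.single_eq_of_ne (Ne.symm hγα)]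
    · intro δ hδ
      by_cases h1 : δ = α
      · rw [h1]; exact Dom.refl α
      · by_cases h2 : δ = γ
        · rw [h2]; exact hγ
        · simp [Pi.single_eq_of_ne h1, Pi.single_eq_of_ne h2] at hδ
    · rw [e, hβα, zero_add]
      exact mul_ne_zero hc0 hβ
  · exact hα β hβα

/-- Some power of an invertible map respecting the non-edge relations is triangular with respect
to domination. -/
theorem Respects.exists_pow_dom [CharZero K] {g : Matrix S S K} (hg : Respects G g)
    (hi : Function.Injective g.mulVec) :
    ∃ m, 0 < m ∧ ∀ β γ, (g ^ m) β γ ≠ 0 → Dom G β γ := by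
  classical
  obtain ⟨f, hf⟩ := hg.exists_vertexMap hi
  have hit : ∀ k α v, v ∈ dominated G K α → (g ^ k).mulVec v ∈ dominated G K (f^[k] α) := by
    intro k
    induction k with
    | zero => intro α v hv; simpa using hv
    | succ k ih =>
      intro α v hv
      rw [pow_succ, ← Matrix.mulVec_mulVec, Function.iterate_succ_apply]
      apply ih
      exact mulVec_mem_of_col (N := dominated G K α) (N' := dominated G K (f α)) (s := {β | Dom G β α}) (fun v hv β hβ => hv β hβ)
        (fun γ hγ β hβ => (hf α).2 γ hγ β hβ) hv
  have hdeg : ∀ k α, (G.neighborSet (f^[k] α)).ncard = (G.neighborSet α).ncard := by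
    intro k
    induction k with
    | zero => intro α; rfl
    | succ k ih => intro α; rw [Function.iterate_succ_apply, ih, (hf α).1]
  obtain ⟨m, hm, hmm⟩ := exists_iterate_idempotent f
  refine ⟨m, hm, ?_⟩
  have hinj : Function.Injective (g ^ m).mulVecLin := by
    have : ∀ k, Function.Injective (g ^ k).mulVec := by
      intro k
      induction k with
      | zero => intro a b h; simpa using h
      | succ k ih =>
        intro a b h
        rw [pow_succ, ← Matrix.mulVec_mulVec, ← Matrix.mulVec_mulVec] at h
        exact hi (ih h)
    exact this m
  intro β γ hβγ
  -- Since `f^[m]` fixes `δ`, the power `g ^ m` maps the vectors dominated by `δ` bijectively onto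
  -- themselves. The image of the basis vector of `γ` lies there, hence so does the vector itself,
  -- and equal degrees make `γ` and `δ` dominate each other.
  let δ := f^[m] γ
  have hδ : f^[m] δ = δ := by
    change f^[m] (f^[m] γ) = f^[m] γ
    rw [← Function.iterate_add_apply, hmm]
  have hsg : (Pi.single γ 1 : S → K) ∈ dominated G K γ := by
    intro β h
    by_cases hne : β = γ
    · rw [hne]; exact Dom.refl γ
    · exact absurd (Pi.single_eq_of_ne hne _) h
  have h1 : (g ^ m).mulVec (Pi.single γ 1) ∈ dominated G K δ := hit m γ _ hsg
  have hmap := map_eq_of_injective hinj (N := dominated G K δ) (fun v hv => by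
    have := hit m δ v hv
    rwa [hδ] at this)
  have h2 : (Pi.single γ 1 : S → K) ∈ dominated G K δ := by
    rw [← hmap] at h1
    obtain ⟨v, hv, hv'⟩ := h1
    rwa [← hinj hv']
  have h3 : Dom G γ δ := h2 γ (by simp)
  have h4 : Dom G δ γ := by
    apply h3.symm_of_degree_eq
    rw [← ncard_neighborSet, ← ncard_neighborSet]
    exact (hdeg m γ).symm
  exact (h1 β (by simpa using hβγ)).trans h4

end

/-! ### Trilinear forms dual to the degree-three part -/

section Forms

variable {S : Type*} [Fintype S] {K : Type*} [Field K]

/-- The trilinear form on `S → K` with coefficients `φ`. -/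
def tri (φ : S → S → S → K) (u v w : S → K) : K :=
  ∑ p : S × S × S, u p.1 * v p.2.1 * w p.2.2 * φ p.1 p.2.1 p.2.2

/-- The pull-back of trilinear forms along a matrix. -/
def act (g : Matrix S S K) : (S → S → S → K) →ₗ[K] (S → S → S → K) where
  toFun φ i j k := tri φ (g.col i) (g.col j) (g.col k)
  map_add' φ ψ := by
    ext i j k
    simp [tri, mul_add, Finset.sum_add_distrib]
  map_smul' c φ := by
    ext i j k
    simp only [tri, Pi.smul_apply, smul_eq_mul, RingHom.id_apply, Finset.mul_sum]
    exact Finset.sum_congr rfl fun p _ => by ring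

theorem act_apply (g : Matrix S S K) (φ : S → S → S → K) (i j k : S) :
    act g φ i j k = ∑ p : S × S × S, g p.1 i * g p.2.1 j * g p.2.2 k * φ p.1 p.2.1 p.2.2 := rfl

theorem tri_act (g : Matrix S S K) (φ : S → S → S → K) (u v w : S → K) :
    tri (act g φ) u v w = tri φ (g.mulVec u) (g.mulVec v) (g.mulVec w) := by
  have h : ∀ x y z : S → K, (∑ i, x i) * (∑ j, y j) * (∑ k, z k)
      = ∑ q : S × S × S, x q.1 * y q.2.1 * z q.2.2 := by
    intro x y z
    rw [mul_assoc, Finset.sum_mul_sum, Finset.sum_mul_sum, Fintype.sum_prod_type]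
    refine Finset.sum_congr rfl fun i _ => ?_
    rw [← Finset.mul_sum, Fintype.sum_prod_type, Finset.mul_sum]
    refine Finset.sum_congr rfl fun j _ => ?_
    rw [Finset.mul_sum]
    exact Finset.sum_congr rfl fun k _ => by ring
  simp only [tri, act_apply, Matrix.mulVec, dotProduct, h]
  simp only [Finset.mul_sum, Finset.sum_mul]
  rw [Finset.sum_comm]
  exact Finset.sum_congr rfl fun p _ => Finset.sum_congr rfl fun q _ => by ring

theorem act_mul (g h : Matrix S S K) (φ : S → S → S → K) :
    act (g * h) φ = act h (act g φ) := by
  ext i j k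
  exact (tri_act g φ (h.col i) (h.col j) (h.col k)).symm

variable [DecidableEq S]

theorem tri_single (φ : S → S → S → K) (i j k : S) :
    tri φ (Pi.single i 1) (Pi.single j 1) (Pi.single k 1) = φ i j k := by
  rw [tri, Finset.sum_eq_single (i, j, k)]
  · simp
  · rintro ⟨a, b, c⟩ _ hne
    by_cases h1 : a = i
    · by_cases h2 : b = j
      · have h3 : c ≠ k := fun h3 => hne (by rw [h1, h2, h3])
        simp [Pi.single_eq_of_ne h3]
      · simp [Pi.single_eq_of_ne h2]
    · simp [Pi.single_eq_of_ne h1]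
  · simp

theorem act_one (φ : S → S → S → K) : act (1 : Matrix S S K) φ = φ := by
  ext i j k
  rw [← tri_single φ i j k]
  change tri φ _ _ _ = _
  congr 1 <;> (ext x; simp [Matrix.col_apply, Matrix.one_apply, Pi.single_apply])

omit [Fintype S] [DecidableEq S]

/-- The trilinear forms that vanish on the relations of the degree-three part of the graph Lie
algebra. -/
def forms (G : SimpleGraph S) (K : Type*) [Field K] : Submodule K (S → S → S → K) where
  carrier := {φ | (∀ a b c, φ a b c = -φ a c b) ∧ (∀ a b c, φ a b c + φ b c a + φ c a b = 0) ∧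
    ∀ a b c, ¬ G.Adj b c → φ a b c = 0}
  zero_mem' := by simp
  add_mem' := by
    rintro φ ψ ⟨h1, h2, h3⟩ ⟨k1, k2, k3⟩
    refine ⟨fun a b c => ?_, fun a b c => ?_, fun a b c h => ?_⟩ <;> simp only [Pi.add_apply]
    · rw [h1 a b c, k1 a b c]; ring
    · linear_combination h2 a b c + k2 a b c
    · rw [h3 a b c h, k3 a b c h, add_zero]
  smul_mem' := by
    rintro x φ ⟨h1, h2, h3⟩
    refine ⟨fun a b c => ?_, fun a b c => ?_, fun a b c h => ?_⟩ <;>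
      simp only [Pi.smul_apply, smul_eq_mul]
    · rw [h1 a b c]; ring
    · linear_combination x * h2 a b c
    · rw [h3 a b c h, mul_zero]

variable {G : SimpleGraph S}

theorem map_mem_forms {L : Type*} [Field L] (f : K →+* L) {φ : S → S → S → K}
    (h : φ ∈ forms G K) : (fun a b c => f (φ a b c)) ∈ forms G L := by
  obtain ⟨h1, h2, h3⟩ := h
  refine ⟨fun a b c => ?_, fun a b c => ?_, fun a b c h => ?_⟩
  · simp only [h1 a b c, map_neg]
  · simp only [← map_add, ← map_add, h2, map_zero]
  · simp only [h3 a b c h, map_zero]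

variable [Fintype S]

theorem tri_skew {φ : S → S → S → K} (h : φ ∈ forms G K) (u v w : S → K) :
    tri φ u v w = -tri φ u w v := by
  rw [tri, tri, ← Finset.sum_neg_distrib]
  refine Fintype.sum_equiv ((Equiv.refl S).prodCongr (Equiv.prodComm S S)) _ _ ?_
  rintro ⟨a, b, c⟩
  simp only [Equiv.prodCongr_apply, Prod.map, Equiv.refl_apply, Equiv.prodComm_apply, Prod.swap]
  rw [h.1 a b c]; ring

theorem tri_jacobi {φ : S → S → S → K} (h : φ ∈ forms G K) (u v w : S → K) :
    tri φ u v w + tri φ v w u + tri φ w u v = 0 := by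
  let e : S × S × S ≃ S × S × S := (Equiv.prodComm S (S × S)).trans (Equiv.prodAssoc S S S)
  have h1 : tri φ v w u = ∑ p : S × S × S, u p.1 * v p.2.1 * w p.2.2 * φ p.2.1 p.2.2 p.1 := by
    refine (Fintype.sum_equiv e _ _ ?_).symm
    rintro ⟨a, b, c⟩
    simp only [e, Equiv.trans_apply, Equiv.prodComm_apply, Prod.swap, Equiv.prodAssoc_apply]
    ring
  have h2 : tri φ w u v = ∑ p : S × S × S, u p.1 * v p.2.1 * w p.2.2 * φ p.2.2 p.1 p.2.1 := by
    refine Fintype.sum_equiv e _ _ ?_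
    rintro ⟨a, b, c⟩
    simp only [e, Equiv.trans_apply, Equiv.prodComm_apply, Prod.swap, Equiv.prodAssoc_apply]
    ring
  rw [h1, h2, tri, ← Finset.sum_add_distrib, ← Finset.sum_add_distrib]
  refine Finset.sum_eq_zero fun p _ => ?_
  linear_combination (u p.1 * v p.2.1 * w p.2.2) * h.2.1 p.1 p.2.1 p.2.2

theorem act_mem_forms [CharZero K] {g : Matrix S S K} (hg : Respects G g) {φ : S → S → S → K}
    (h : φ ∈ forms G K) : act g φ ∈ forms G K := by
  refine ⟨fun a b c => tri_skew h _ _ _, fun a b c => tri_jacobi h _ _ _, fun i j k hjk => ?_⟩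
  have h1 : act g φ i j k = -act g φ i k j := tri_skew h _ _ _
  -- The non-edge relations make the value symmetric in the last two slots, and it is already skew.
  have h2 : act g φ i j k - act g φ i k j = 0 := by
    rw [act_apply, act_apply, ← Finset.sum_sub_distrib]
    refine Finset.sum_eq_zero ?_
    rintro ⟨a, b, c⟩ _
    by_cases hbc : G.Adj b c
    · have := hg j k b c hjk hbc
      linear_combination (g a i * φ a b c) * this
    · simp [h.2.2 a b c hbc]
  have h3 : (2 : K) * act g φ i j k = 0 := by linear_combination h1 + h2
  simpa using h3

end Forms

/-! ### Sums of powers of four -/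

/-- If `x` is the largest exponent, a sum of at most three terms lies between `4 ^ x` and `3 * 4 ^ x
< 4 ^ (x + 1)`. This is why the base is four. -/
theorem exists_mem_log_four (s : Multiset ℕ) (h0 : s ≠ 0) (h3 : s.card ≤ 3) :
    Nat.log 4 (s.map (4 ^ ·)).sum ∈ s := by
  obtain ⟨x, hx, hmax⟩ := s.exists_max_image id h0
  have h1 : 4 ^ x ≤ (s.map (4 ^ ·)).sum :=
    Multiset.le_sum_of_mem (Multiset.mem_map_of_mem (4 ^ ·) hx)
  have h2 : (s.map (4 ^ ·)).sum ≤ 3 * 4 ^ x := by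
    refine (Multiset.sum_le_card_nsmul _ (4 ^ x) ?_).trans ?_
    · intro y hy
      obtain ⟨z, hz, rfl⟩ := Multiset.mem_map.1 hy
      exact Nat.pow_le_pow_right (by norm_num) (hmax z hz)
    · rw [Multiset.card_map, smul_eq_mul]
      exact Nat.mul_le_mul_right _ h3
  have h4 : 0 < 4 ^ x := by positivity
  rwa [(Nat.log_eq_iff (m := x) (Or.inr ⟨by norm_num, by omega⟩)).2 ⟨h1, by rw [pow_succ]; omega⟩]

theorem multiset_eq_of_sum_four_pow {n : ℕ} (hn : n ≤ 3) {s t : Multiset ℕ} (hs : s.card = n)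
    (ht : t.card = n) (h : (s.map (4 ^ ·)).sum = (t.map (4 ^ ·)).sum) : s = t := by
  induction n generalizing s t with
  | zero => rw [Multiset.card_eq_zero.1 hs, Multiset.card_eq_zero.1 ht]
  | succ n ih =>
    have h1 := exists_mem_log_four s (by rintro rfl; simp at hs) (by omega)
    have h2 := exists_mem_log_four t (by rintro rfl; simp at ht) (by omega)
    rw [← h] at h2
    obtain ⟨s', hs'⟩ := Multiset.exists_cons_of_mem h1
    obtain ⟨t', ht'⟩ := Multiset.exists_cons_of_mem h2
    generalize Nat.log 4 (s.map (4 ^ ·)).sum = x at hs' ht'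
    subst hs' ht'
    simp only [Multiset.card_cons, Nat.add_right_cancel_iff, Multiset.map_cons,
      Multiset.sum_cons, Nat.add_left_cancel_iff] at hs ht h
    rw [ih (by omega) hs ht h]

/-! ### Eigenvalues of triangular matrices on trilinear forms -/

section Triangular

variable {S : Type*} {K : Type*} [Field K] (h : S → ℕ)

/-- The height of a monomial of degree three. -/
def height (i j k : S) : ℕ := 4 ^ h i + 4 ^ h j + 4 ^ h k

variable {h}

theorem multiset_eq_of_height_eq (hh : Function.Injective h) {i j k a b c : S}
    (e : height h i j k = height h a b c) : ({i, j, k} : Multiset S) = {a, b, c} := by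
  apply Multiset.map_injective hh
  apply multiset_eq_of_sum_four_pow (n := 3) le_rfl
  · simp
  · simp
  · simpa [height, add_assoc] using e

theorem mul_eq_of_multiset_eq (f : S → K) {i j k a b c : S}
    (e : ({i, j, k} : Multiset S) = {a, b, c}) : f i * f j * f k = f a * f b * f c := by
  have := congrArg (fun s : Multiset S => (s.map f).prod) e
  simpa [mul_assoc] using this

/-- The forms all of whose monomials have height less than `n`. -/
def formsBelow (h : S → ℕ) (G : SimpleGraph S) (K : Type*) [Field K] (n : ℕ) : Submodule K (S → S → S → K) where
  carrier := {φ | φ ∈ forms G K ∧ ∀ i j k, φ i j k ≠ 0 → height h i j k < n}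
  zero_mem' := ⟨Submodule.zero_mem _, by simp⟩
  add_mem' := by
    rintro φ ψ ⟨h1, h2⟩ ⟨k1, k2⟩
    refine ⟨Submodule.add_mem _ h1 k1, fun i j k h0 => ?_⟩
    by_cases h3 : φ i j k = 0
    · exact k2 i j k (by simpa [h3] using h0)
    · exact h2 i j k h3
  smul_mem' := by
    rintro c φ ⟨h1, h2⟩
    exact ⟨Submodule.smul_mem _ _ h1, fun i j k h0 => h2 i j k (right_ne_zero_of_mul h0)⟩

variable {G : SimpleGraph S}

theorem formsBelow_mono {m n : ℕ} (hmn : m ≤ n) : formsBelow h G K m ≤ formsBelow h G K n :=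
  fun _ hφ => ⟨hφ.1, fun i j k h0 => (hφ.2 i j k h0).trans_le hmn⟩

theorem mem_formsBelow_of_succ {n : ℕ} {φ : S → S → S → K} (hφ : φ ∈ formsBelow h G K (n + 1))
    (h0 : ∀ i j k, height h i j k = n → φ i j k = 0) : φ ∈ formsBelow h G K n := by
  refine ⟨hφ.1, fun i j k hn => ?_⟩
  have := hφ.2 i j k hn
  by_contra hc
  exact hn (h0 i j k (by omega))

/-- The form attached to a path `i - j - k` (where `i = k` is allowed). -/
def pathForm [DecidableEq S] (K : Type*) [Field K] (i j k : S) : S → S → S → K := fun a b c =>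
  (Pi.single i 1 : S → K) a * ((Pi.single j 1 : S → K) b * (Pi.single k 1 : S → K) c
    - (Pi.single k 1 : S → K) b * (Pi.single j 1 : S → K) c)
  + (Pi.single k 1 : S → K) a * ((Pi.single j 1 : S → K) b * (Pi.single i 1 : S → K) c
    - (Pi.single i 1 : S → K) b * (Pi.single j 1 : S → K) c)

theorem single_mul_single_eq_zero [DecidableEq S] {b c j k : S} (h : ¬ (b = j ∧ c = k)) :
    (Pi.single j 1 : S → K) b * (Pi.single k 1 : S → K) c = 0 := by
  by_cases hb : b = j
  · rw [Pi.single_eq_of_ne (fun hc => h ⟨hb, hc⟩), mul_zero]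
  · rw [Pi.single_eq_of_ne hb, zero_mul]

theorem pathForm_mem [DecidableEq S] {i j k : S} (hi : G.Adj j i) (hk : G.Adj j k) :
    pathForm K i j k ∈ forms G K := by
  refine ⟨fun a b c => ?_, fun a b c => ?_, fun a b c hbc => ?_⟩
  · simp only [pathForm]; ring
  · simp only [pathForm]; ring
  · simp only [pathForm]
    rw [single_mul_single_eq_zero (by rintro ⟨rfl, rfl⟩; exact hbc hk),
      single_mul_single_eq_zero (by rintro ⟨rfl, rfl⟩; exact hbc hk.symm),
      single_mul_single_eq_zero (by rintro ⟨rfl, rfl⟩; exact hbc hi),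
      single_mul_single_eq_zero (by rintro ⟨rfl, rfl⟩; exact hbc hi.symm)]
    ring

theorem pathForm_mem_formsBelow [DecidableEq S] {i j k : S} (hi : G.Adj j i) (hk : G.Adj j k) :
    pathForm K i j k ∈ formsBelow h G K (height h i j k + 1) := by
  refine ⟨pathForm_mem hi hk, fun a b c h0 => ?_⟩
  by_contra hc
  apply h0
  have n1 : ¬ (b = j ∧ c = k) ∨ a ≠ i := by
    by_contra! hn; obtain ⟨⟨rfl, rfl⟩, rfl⟩ := hn; simp [height] at hc
  have n2 : ¬ (b = k ∧ c = j) ∨ a ≠ i := by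
    by_contra! hn; obtain ⟨⟨rfl, rfl⟩, rfl⟩ := hn; simp only [height] at hc; omega
  have n3 : ¬ (b = j ∧ c = i) ∨ a ≠ k := by
    by_contra! hn; obtain ⟨⟨rfl, rfl⟩, rfl⟩ := hn; simp only [height] at hc; omega
  have n4 : ¬ (b = i ∧ c = j) ∨ a ≠ k := by
    by_contra! hn; obtain ⟨⟨rfl, rfl⟩, rfl⟩ := hn; simp only [height] at hc; omega
  have key : ∀ {i j k : S}, (¬ (b = j ∧ c = k) ∨ a ≠ i) → (Pi.single i 1 : S → K) a *
      ((Pi.single j 1 : S → K) b * (Pi.single k 1 : S → K) c) = 0 := by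
    rintro i j k (hn | hn)
    · rw [single_mul_single_eq_zero hn, mul_zero]
    · rw [Pi.single_eq_of_ne hn, zero_mul]
  simp only [pathForm, mul_sub, key n1, key n2, key n3, key n4]
  ring

theorem pathForm_apply_ne_zero [CharZero K] [DecidableEq S] {i j k : S} (hi : G.Adj j i)
    (hk : G.Adj j k) : pathForm K i j k i j k ≠ 0 := by
  have h1 := hi.ne
  have h2 := hk.ne
  by_cases h3 : i = k
  · subst h3
    simp [pathForm, h1]
  · simp [pathForm, h1, h2.symm, h3]

variable [Fintype S] {g : Matrix S S K}

omit [Fintype S] in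
theorem height_le_of_ne_zero (hg : ∀ a i, g a i ≠ 0 → a = i ∨ h i < h a) {i j k a b c : S}
    (h0 : g a i * g b j * g c k ≠ 0) :
    height h i j k < height h a b c ∨ (a = i ∧ b = j ∧ c = k) := by
  have key : ∀ a i, g a i ≠ 0 → a = i ∨ 4 ^ h i < 4 ^ h a := fun a i hne =>
    (hg a i hne).imp_right fun hlt => Nat.pow_lt_pow_right (by norm_num) hlt
  have h1 := key a i (left_ne_zero_of_mul (left_ne_zero_of_mul h0))
  have h2 := key b j (right_ne_zero_of_mul (left_ne_zero_of_mul h0))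
  have h3 := key c k (right_ne_zero_of_mul h0)
  unfold height
  rcases h1 with rfl | h1 <;> rcases h2 with rfl | h2 <;> rcases h3 with rfl | h3 <;>
    first | (right; exact ⟨rfl, rfl, rfl⟩) | (left; omega)

/-- Apart from the diagonal term, a triangular `g` contributes to `(i, j, k)` only values of `φ` at
larger height, and these vanish by assumption. -/
theorem act_apply_of_height (hg : ∀ a i, g a i ≠ 0 → a = i ∨ h i < h a) {φ : S → S → S → K}
    {i j k : S} (hφ : φ ∈ formsBelow h G K (height h i j k + 1)) :
    act g φ i j k = g i i * g j j * g k k * φ i j k := by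
  rw [act_apply, Finset.sum_eq_single (i, j, k)]
  · rintro ⟨a, b, c⟩ _ hne
    by_contra h0
    replace h0 : g a i * g b j * g c k * φ a b c ≠ 0 := h0
    have h1 : height h a b c < height h i j k + 1 := hφ.2 a b c (right_ne_zero_of_mul h0)
    rcases height_le_of_ne_zero hg (left_ne_zero_of_mul h0) with h2 | ⟨rfl, rfl, rfl⟩
    · omega
    · exact hne rfl
  · simp

theorem act_mem_formsBelow [CharZero K] (hr : Respects G g)
    (hg : ∀ a i, g a i ≠ 0 → a = i ∨ h i < h a) {n : ℕ} {φ : S → S → S → K}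
    (hφ : φ ∈ formsBelow h G K n) : act g φ ∈ formsBelow h G K n := by
  refine ⟨act_mem_forms hr hφ.1, fun i j k h0 => ?_⟩
  by_contra hc
  apply h0
  rw [act_apply_of_height hg (formsBelow_mono (by omega) hφ)]
  have : φ i j k = 0 := by
    by_contra h1
    exact hc (hφ.2 i j k h1)
  rw [this, mul_zero]

/-- All monomials of one height have the same vertex multiset, hence the same product of diagonal
entries. So the pull-back is scalar on each layer of the height filtration. -/
theorem act_sub_mem_formsBelow [CharZero K] (hh : Function.Injective h) (hr : Respects G g)
    (hg : ∀ a i, g a i ≠ 0 → a = i ∨ h i < h a) {i j k : S} {φ : S → S → S → K}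
    (hφ : φ ∈ formsBelow h G K (height h i j k + 1)) :
    act g φ - (g i i * g j j * g k k) • φ ∈ formsBelow h G K (height h i j k) := by
  apply mem_formsBelow_of_succ
  · exact Submodule.sub_mem _ (act_mem_formsBelow hr hg hφ) (Submodule.smul_mem _ _ hφ)
  · intro a b c e
    rw [← e] at hφ
    simp only [Pi.sub_apply, Pi.smul_apply, smul_eq_mul, act_apply_of_height hg hφ]
    rw [mul_eq_of_multiset_eq (fun i => g i i) (multiset_eq_of_height_eq hh e), sub_self]

/-- An endomorphism mapping a subspace into a smaller one has a kernel. -/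
theorem exists_ker_of_lt {V : Type*} [AddCommGroup V] [Module K V] [Module.Finite K V]
    {f : V →ₗ[K] V} {N N' : Submodule K V} (hN : N' ≤ N) (h : ∀ v ∈ N, f v ∈ N')
    {v : V} (hv : v ∈ N) (hv' : v ∉ N') : ∃ w ∈ N, w ≠ 0 ∧ f w = 0 := by
  by_contra hc
  push Not at hc
  let F : N →ₗ[K] N := f.restrict (fun v hv => hN (h v hv))
  have hF : Function.Injective F := by
    rw [← LinearMap.ker_eq_bot, LinearMap.ker_eq_bot']
    intro w hw
    by_contra h0
    exact hc w w.2 (fun h1 => h0 (Subtype.ext h1)) (congrArg Subtype.val hw)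
  obtain ⟨w, hw⟩ := LinearMap.surjective_of_injective hF ⟨v, hv⟩
  have : f w = v := congrArg Subtype.val hw
  exact hv' (this ▸ h w w.2)

omit [Fintype S] in
-- Nonvanishing gives the edge `jk`; if `k` and `i` are not adjacent, Jacobi forces the edge `ij`.
theorem exists_path_of_apply_ne_zero {φ : S → S → S → K} (hφ : φ ∈ forms G K) {i j k : S}
    (h0 : φ i j k ≠ 0) : ∃ a b c, ({a, b, c} : Multiset S) = {i, j, k} ∧ G.Adj b a ∧ G.Adj b c := by
  have hjk : G.Adj j k := by
    by_contra hc
    exact h0 (hφ.2.2 i j k hc)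
  by_cases h1 : G.Adj k i
  · refine ⟨i, k, j, ?_, h1, hjk.symm⟩
    rw [Multiset.insert_eq_cons, Multiset.insert_eq_cons, Multiset.pair_comm]; rfl
  · have h2 := hφ.2.1 i j k
    rw [hφ.2.2 j k i h1, add_zero] at h2
    have h3 : φ k i j ≠ 0 := by
      intro h3
      rw [h3, add_zero] at h2
      exact h0 h2
    have hij : G.Adj i j := by
      by_contra hc
      exact h3 (hφ.2.2 k i j hc)
    exact ⟨i, j, k, rfl, hij.symm, hjk⟩

/-- The functional `ε` first becomes nonzero at a single layer of the height filtration, and the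
scalar of that layer is `lam`. Restricting to `ker ε` removes only one dimension, from this critical
layer. Layers of other paths therefore survive, and so does the critical one if it belongs to a
triangle, which carries two independent path forms. -/
theorem exists_path_eigenvalue [CharZero K] (hh : Function.Injective h) (hr : Respects G g)
    (hg : ∀ a i, g a i ≠ 0 → a = i ∨ h i < h a) {ε : (S → S → S → K) →ₗ[K] K} {lam : K}
    (hε : ∀ φ ∈ forms G K, ε (act g φ) = lam * ε φ) (hε0 : ∃ φ ∈ forms G K, ε φ ≠ 0) :
    ∃ i j k, G.Adj j i ∧ G.Adj j k ∧ lam = g i i * g j j * g k k ∧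
      ∀ a b c, G.Adj b a → G.Adj b c → (({a, b, c} : Multiset S) ≠ {i, j, k} ∨ G.Adj a c) →
        ∃ φ ∈ forms G K, φ ≠ 0 ∧ ε φ = 0 ∧ act g φ = (g a a * g b b * g c c) • φ := by
  classical
  have hex : ∃ n, ∃ φ ∈ formsBelow h G K n, ε φ ≠ 0 := by
    obtain ⟨φ, hφ, h0⟩ := hε0
    refine ⟨(∑ p : S × S × S, height h p.1 p.2.1 p.2.2) + 1, φ, ⟨hφ, fun i j k _ => ?_⟩, h0⟩
    have := Finset.single_le_sum (f := fun p : S × S × S => height h p.1 p.2.1 p.2.2)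
      (fun _ _ => Nat.zero_le _) (Finset.mem_univ (i, j, k))
    exact Nat.lt_succ_of_le this
  obtain ⟨φ, hφ, hφ0⟩ := Nat.find_spec hex
  have hmin : ∀ m < Nat.find hex, ∀ ψ ∈ formsBelow h G K m, ε ψ = 0 := by
    intro m hm ψ hψ
    by_contra h0
    exact Nat.find_min hex hm ⟨ψ, hψ, h0⟩
  generalize Nat.find hex = n at hφ hmin
  obtain _ | n := n
  · exfalso
    apply hφ0
    have : φ = 0 := by
      ext i j k
      by_contra h0
      exact absurd (hφ.2 i j k h0) (by omega)
    rw [this, map_zero]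
  have htop : ∃ i j k, height h i j k = n ∧ φ i j k ≠ 0 := by
    by_contra hc
    push Not at hc
    exact hφ0 (hmin n (by omega) φ (mem_formsBelow_of_succ hφ hc))
  obtain ⟨i, j, k, hn, hne⟩ := htop
  obtain ⟨i', j', k', hm, hi, hk⟩ := exists_path_of_apply_ne_zero hφ.1 hne
  have hlam : lam = g i i * g j j * g k k := by
    subst hn
    -- By minimality `ε` kills the lower layers, so the layer scalar equals `lam`.
    have := hmin _ (by omega) _ (act_sub_mem_formsBelow hh hr hg hφ)
    rw [map_sub, map_smul, hε φ hφ.1, smul_eq_mul, ← sub_mul] at this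
    exact sub_eq_zero.1 ((mul_eq_zero.1 this).resolve_right hφ0)
  refine ⟨i', j', k', hi, hk, ?_, ?_⟩
  · rw [hlam]
    exact (mul_eq_of_multiset_eq (fun i => g i i) hm).symm
  intro a b c hba hbc hd
  set μ := g a a * g b b * g c c with hμ
  have hψ := pathForm_mem_formsBelow (K := K) (h := h) hba hbc
  have hψ0 := pathForm_apply_ne_zero (K := K) hba hbc
  have hsuff : ∃ ψ ∈ formsBelow h G K (height h a b c + 1), ε ψ = 0 ∧
      ψ ∉ formsBelow h G K (height h a b c) := by
    -- Below the critical height `ε` already vanishes on the path form. At it, a triangle supplies a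
    -- second path form and a combination lies in `ker ε`. Above it, subtracting a multiple of `φ`
    -- corrects `ε` without changing the top layer.
    rcases lt_trichotomy (height h a b c) n with hlt | heq | hgt
    · refine ⟨_, hψ, hmin _ (by omega) _ hψ, fun hc => ?_⟩
      exact absurd (hc.2 a b c hψ0) (lt_irrefl _)
    · rw [← hn] at heq
      have hms := multiset_eq_of_height_eq hh heq
      have hac : G.Adj a c := hd.resolve_left (by rw [hm]; simpa using hms)
      have hψ' := pathForm_mem_formsBelow (K := K) (h := h) (i := b) (j := a) (k := c) hba.symm hac
      rw [show height h b a c = height h a b c by simp only [height]; omega] at hψ'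
      have n1 := hba.ne
      have n2 := hbc.ne
      have n3 := hac.ne
      by_cases h1 : ε (pathForm K a b c) = 0
      · exact ⟨_, hψ, h1, fun hc => absurd (hc.2 a b c hψ0) (lt_irrefl _)⟩
      · refine ⟨ε (pathForm K b a c) • pathForm K a b c - ε (pathForm K a b c) • pathForm K b a c,
          Submodule.sub_mem _ (Submodule.smul_mem _ _ hψ) (Submodule.smul_mem _ _ hψ'), ?_, ?_⟩
        · simp only [map_sub, map_smul, smul_eq_mul]; ring
        · intro hc
          -- The monomial `(b, a, c)` occurs in the second path form but not in the first, so it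
          -- detects the nonzero coefficient `ε (pathForm K a b c)`.
          have := hc.2 b a c (by
            simp [pathForm, n1, n1.symm, n2, n2.symm, n3, n3.symm]
            exact h1)
          simp only [height] at this
          omega
    · have hφ' : φ ∈ formsBelow h G K (height h a b c) := formsBelow_mono (by omega) hφ
      refine ⟨pathForm K a b c - (ε (pathForm K a b c) / ε φ) • φ, Submodule.sub_mem _ hψ
        (Submodule.smul_mem _ _ (formsBelow_mono (by omega) hφ')), ?_, ?_⟩
      · simp [hφ0]
      · intro hc
        have := Submodule.add_mem _ hc (Submodule.smul_mem _ (ε (pathForm K a b c) / ε φ) hφ')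
        rw [sub_add_cancel] at this
        exact absurd (this.2 a b c hψ0) (lt_irrefl _)
  obtain ⟨ψ, hψ1, hψε, hψ2⟩ := hsuff
  -- Subtracting `μ` maps one step of the filtration of `ker ε` into a strictly smaller one. The
  -- resulting kernel contains a genuine eigenform, not just an eigenvector in a layer.
  obtain ⟨w, hw, hw0, hw1⟩ := exists_ker_of_lt
    (f := act g - μ • (LinearMap.id : (S → S → S → K) →ₗ[K] _))
    (N := formsBelow h G K (height h a b c + 1) ⊓ LinearMap.ker ε)
    (N' := formsBelow h G K (height h a b c) ⊓ LinearMap.ker ε)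
    (inf_le_inf_right _ (formsBelow_mono (by omega))) (by
      rintro v ⟨hv1, hv2⟩
      refine ⟨act_sub_mem_formsBelow hh hr hg hv1, ?_⟩
      have hv2 : ε v = 0 := hv2
      change ε (act g v - μ • v) = 0
      rw [map_sub, hε v hv1.1, map_smul, hv2]; simp) (v := ψ)
    ⟨hψ1, hψε⟩ (fun hc => hψ2 hc.1)
  refine ⟨w, hw.1.1, hw0, hw.2, ?_⟩
  exact sub_eq_zero.1 hw1

end Triangular

/-! ### Triangularization -/

section Triangularization

open Polynomial

/-- An eigenvector of the transpose has an invariant hyperplane as its kernel. A vector outside it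
is prepended to a triangular basis of the hyperplane. -/
theorem exists_triangular_basis {K : Type*} [Field K] [IsAlgClosed K] (n : ℕ) {V : Type*}
    [AddCommGroup V] [Module K V] [Module.Finite K V] (hn : Module.finrank K V = n)
    (f : V →ₗ[K] V) :
    ∃ b : Module.Basis (Fin n) K V, ∀ i, f (b i) ∈ Submodule.span K (b '' {a | i ≤ a}) := by
  induction n generalizing V with
  | zero =>
    exact ⟨Module.finBasisOfFinrankEq K V hn, fun i => i.elim0⟩
  | succ n ih =>
    have : Nontrivial V := Module.nontrivial_of_finrank_pos (R := K) (by omega)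
    obtain ⟨μ, hμ⟩ := Module.End.exists_eigenvalue (K := K) (Module.Dual.transpose (R := K) f)
    obtain ⟨c, hc⟩ := hμ.exists_hasEigenvector
    have hc0 : c ≠ 0 := hc.2
    have hcf : ∀ v, c (f v) = μ * c v := fun v => by
      exact congrArg (fun d : Module.Dual K V => d v) hc.apply_eq_smul
    let N := LinearMap.ker c
    have hN : ∀ v ∈ N, f v ∈ N := by
      intro v hv
      have hv : c v = 0 := hv
      change c (f v) = 0
      rw [hcf, hv, mul_zero]
    have hfr : Module.finrank K N = n := by
      have := Module.Dual.finrank_ker_add_one_of_ne_zero hc0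
      have h2 : Module.finrank K N + 1 = Module.finrank K V := this
      omega
    obtain ⟨b, hb⟩ := ih hfr (f.restrict hN)
    obtain ⟨y, hy⟩ : ∃ y, c y = 1 := by
      obtain ⟨y, hy⟩ : ∃ y, c y ≠ 0 := by
        by_contra! hall
        exact hc0 (LinearMap.ext hall)
      exact ⟨(c y)⁻¹ • y, by simp [hy]⟩
    refine ⟨Module.Basis.mkFinCons y b ?_ ?_, ?_⟩
    · intro t x hx h
      have hx : c x = 0 := hx
      have := congrArg c h
      simpa [hx, hy] using this
    · intro z
      refine ⟨-c z, ?_⟩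
      change c _ = 0
      simp [hy]
    · intro i
      set B := Module.Basis.mkFinCons (N := N) y b _ _ with hB
      have hBc : (B : Fin (n + 1) → V) = Fin.cons y ((↑) ∘ b) :=
        Module.Basis.coe_mkFinCons _ _ _ _
      refine Fin.cases ?_ (fun i => ?_) i
      · have : {a : Fin (n + 1) | 0 ≤ a} = Set.univ := Set.eq_univ_of_forall fun a => Fin.zero_le a
        rw [this, Set.image_univ, B.span_eq]
        trivial
      · have h1 : B i.succ = (b i : V) := by rw [hBc]; simp
        rw [h1]
        have h2 : f (b i) = N.subtype (f.restrict hN (b i)) := rfl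
        rw [h2]
        have h3 := Submodule.mem_map_of_mem (f := N.subtype) (hb i)
        rw [Submodule.map_span] at h3
        refine Submodule.span_mono ?_ h3
        rintro _ ⟨_, ⟨a, ha, rfl⟩, rfl⟩
        refine ⟨a.succ, Fin.succ_le_succ_iff.2 ha, ?_⟩
        rw [hBc]; simp

theorem charpoly_of_triangular {n K : Type*} [Fintype n] [DecidableEq n] [CommRing K]
    {M : Matrix n n K} {h : n → ℕ} (hh : Function.Injective h)
    (hM : ∀ a i, M a i ≠ 0 → a = i ∨ h i < h a) :
    M.charpoly = ∏ i, (X - C (M i i)) := by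
  rw [← Matrix.charpoly_transpose]
  let _ : LinearOrder n := LinearOrder.lift' h hh
  rw [Matrix.charpoly_of_isUpperTriangular]
  · rfl
  · intro i a hai
    by_contra h0
    have hai : h a < h i := hai
    rcases hM a i h0 with rfl | h1
    · exact lt_irrefl _ hai
    · exact lt_asymm hai h1

theorem exists_triangular_matrix {n K : Type*} [Fintype n] [DecidableEq n] [Field K]
    [IsAlgClosed K] (D : Matrix n n K) :
    ∃ (P Q D' : Matrix n n K) (r : n → ℕ), P * Q = 1 ∧ Q * P = 1 ∧ D * P = P * D' ∧
      (∀ a i, D' a i ≠ 0 → a = i ∨ r i < r a) ∧ D.charpoly = ∏ i, (X - C (D' i i)) := by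
  obtain ⟨b, hb⟩ := exists_triangular_basis (Fintype.card n) (V := n → K) (by simp)
    (Matrix.toLin' D)
  let e := Fintype.equivFin n
  let B : Module.Basis n K (n → K) := b.reindex e.symm
  let r : n → ℕ := fun i => e i
  have hr : Function.Injective r := fun i j hij => e.injective (Fin.ext hij)
  have htri : ∀ a i, LinearMap.toMatrix B B (Matrix.toLin' D) a i ≠ 0 → a = i ∨ r i < r a := by
    intro a i h0
    rw [LinearMap.toMatrix_apply] at h0
    have h1 : (B.repr (Matrix.toLin' D (B i))) a = b.repr (Matrix.toLin' D (b (e i))) (e a) := by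
      simp [B]
    rw [h1] at h0
    have h2 := (b.mem_span_image.1 (hb (e i))) (Finsupp.mem_support_iff.2 h0)
    by_cases hai : a = i
    · exact Or.inl hai
    · right
      have h3 : r i ≤ r a := h2
      exact lt_of_le_of_ne h3 (fun h => hai (hr h.symm))
  refine ⟨(Pi.basisFun K n).toMatrix B, B.toMatrix (Pi.basisFun K n),
    LinearMap.toMatrix B B (Matrix.toLin' D), r, Module.Basis.toMatrix_mul_toMatrix_flip _ _,
    Module.Basis.toMatrix_mul_toMatrix_flip _ _, ?_, htri, ?_⟩
  · rw [basis_toMatrix_mul_linearMap_toMatrix, ← linearMap_toMatrix_mul_basis_toMatrix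
      (b := B) (b' := Pi.basisFun K n)]
    congr 1
    rw [← Matrix.toLin_eq_toLin', LinearMap.toMatrix_toLin]
  · rw [← charpoly_of_triangular hr htri, LinearMap.charpoly_toMatrix,
      Matrix.charpoly_toLin']

theorem exists_perm_of_multiset_eq {n α : Type*} [Fintype n] {f g : n → α}
    (h : Finset.univ.val.map f = Finset.univ.val.map g) : ∃ π : Equiv.Perm n, ∀ i, g (π i) = f i := by
  classical
  have hc : ∀ z, Nonempty ({i // f i = z} ≃ {i // g i = z}) := by
    intro z
    have h1 := congrArg (Multiset.count z) h
    rw [Multiset.count_map, Multiset.count_map] at h1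
    refine ⟨Fintype.equivOfCardEq ?_⟩
    rw [Fintype.card_subtype, Fintype.card_subtype]
    simpa [Finset.card_def, Finset.filter_val, eq_comm] using h1
  let e := fun z => (hc z).some
  refine ⟨(Equiv.sigmaFiberEquiv f).symm.trans
    ((Equiv.sigmaCongrRight e).trans (Equiv.sigmaFiberEquiv g)), fun i => ?_⟩
  exact (e (f i) ⟨i, rfl⟩).2

/-- If the monic polynomial with roots `l i` has rational coefficients, then field automorphisms
permute the `l i`. -/
theorem exists_perm_of_charpoly {n F K : Type*} [Fintype n] [Field F] [Field K] [Algebra F K]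
    {p : F[X]} {l : n → K} (hp : p.map (algebraMap F K) = ∏ i, (X - C (l i)))
    (σ : K ≃ₐ[F] K) : ∃ π : Equiv.Perm n, ∀ i, l (π i) = σ (l i) := by
  apply exists_perm_of_multiset_eq
  have h1 : (p.map (algebraMap F K)).map (σ : K →+* K) = p.map (algebraMap F K) := by
    rw [Polynomial.map_map]
    congr 1
    ext x
    simp
  have h2 : ∏ i, (X - C (σ (l i))) = ∏ i, (X - C (l i)) := by
    rw [← hp, ← h1, hp, Polynomial.map_prod]
    simp
  have h3 := congrArg Polynomial.roots h2
  have h4 : ∀ m : n → K, (∏ i, (X - C (m i))).roots = Finset.univ.val.map m := by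
    intro m
    have : ∏ i, (X - C (m i)) = (Finset.univ.val.map m |>.map (fun a => X - C a)).prod := by
      rw [Multiset.map_map]; rfl
    rw [this, Polynomial.roots_multiset_prod_X_sub_C]
  rwa [h4, h4] at h3

end Triangularization

/-! ### Block-diagonal matrices along the fibres of a map -/

section Blocks

open Polynomial

variable {S C K : Type*} [Fintype S] [DecidableEq C] [Field K] (κ : S → C)

/-- The block-diagonal matrix with the given diagonal blocks, indexed by the fibres of `κ`. -/
def fiberDiagonal (f : ∀ c, Matrix {i // κ i = c} {i // κ i = c} K) : Matrix S S K := fun a i =>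
  if h : κ a = κ i then f (κ i) ⟨a, h⟩ ⟨i, rfl⟩ else 0

variable {κ}

omit [Fintype S] in
theorem fiberDiagonal_apply_of_eq (f : ∀ c, Matrix {i // κ i = c} {i // κ i = c} K) {c : C}
    {a i : S} (ha : κ a = c) (hi : κ i = c) : fiberDiagonal κ f a i = f c ⟨a, ha⟩ ⟨i, hi⟩ := by
  subst hi
  simp [fiberDiagonal, ha]

omit [Fintype S] in
theorem fiberDiagonal_apply_of_ne (f : ∀ c, Matrix {i // κ i = c} {i // κ i = c} K)
    {a i : S} (h : κ a ≠ κ i) : fiberDiagonal κ f a i = 0 := by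
  simp [fiberDiagonal, h]

theorem fiberDiagonal_mul (f g : ∀ c, Matrix {i // κ i = c} {i // κ i = c} K) :
    fiberDiagonal κ f * fiberDiagonal κ g = fiberDiagonal κ (fun c => f c * g c) := by
  classical
  ext a i
  rw [Matrix.mul_apply]
  by_cases h : κ a = κ i
  · rw [fiberDiagonal_apply_of_eq _ h rfl, Matrix.mul_apply,
      ← Finset.sum_filter_add_sum_filter_not Finset.univ (fun b => κ b = κ i),
      Finset.sum_subtype (p := fun b => κ b = κ i) _ (by simp),
      Finset.sum_eq_zero (s := Finset.univ.filter fun b => ¬ κ b = κ i), add_zero]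
    · refine Finset.sum_congr rfl fun b _ => ?_
      rw [fiberDiagonal_apply_of_eq f h b.2, fiberDiagonal_apply_of_eq g b.2 rfl]
    · intro b hb
      rw [fiberDiagonal_apply_of_ne g (by simpa using hb), mul_zero]
  · rw [fiberDiagonal_apply_of_ne _ h]
    refine Finset.sum_eq_zero fun b _ => ?_
    by_cases hb : κ a = κ b
    · rw [fiberDiagonal_apply_of_ne g (fun hc => h (hb.trans hc)), mul_zero]
    · rw [fiberDiagonal_apply_of_ne f hb, zero_mul]

omit [Fintype S] in
theorem fiberDiagonal_one [DecidableEq S] :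
    fiberDiagonal κ (fun _ => (1 : Matrix _ _ K)) = 1 := by
  ext a i
  by_cases h : κ a = κ i
  · rw [fiberDiagonal_apply_of_eq _ h rfl, Matrix.one_apply, Matrix.one_apply]
    simp
  · rw [fiberDiagonal_apply_of_ne _ h, Matrix.one_apply_ne (fun hc => h (congrArg κ hc))]

end Blocks

/-! ### Triangular form compatible with domination and Galois action -/

section Structure

variable {S : Type*} [Fintype S] [DecidableEq S] {G : SimpleGraph S} {K : Type*} [Field K]
  [IsAlgClosed K] [Algebra ℚ K]

-- The lexicographic order by decreasing `u`, increasing `v` and an arbitrary numbering, written in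
-- mixed radix. The last digit gives injectivity.
omit [DecidableEq S] in
theorem exists_injective_height (u v : S → ℕ) :
    ∃ h : S → ℕ, Function.Injective h ∧ ∀ i j, (u j < u i ∨ u i = u j ∧ v i < v j) → h i < h j := by
  let e := Fintype.equivFin S
  let n := Fintype.card S
  let R := (∑ i, v i) + 1
  let U := ∑ i, u i
  have hv : ∀ i, v i < R := fun i =>
    Nat.lt_succ_of_le (Finset.single_le_sum (f := v) (fun _ _ => Nat.zero_le _) (Finset.mem_univ i))
  have hu : ∀ i, u i ≤ U := fun i =>
    Finset.single_le_sum (f := u) (fun _ _ => Nat.zero_le _) (Finset.mem_univ i)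
  have key : ∀ {x y a b m : ℕ}, x < y → a < m → x * m + a < y * m + b := by
    intro x y a b m hxy ha
    have : (x + 1) * m ≤ y * m := Nat.mul_le_mul_right m hxy
    rw [Nat.succ_mul] at this
    omega
  refine ⟨fun i => ((U - u i) * R + v i) * n + e i, ?_, ?_⟩
  · intro i j hij
    have := congrArg (· % n) hij
    simp only [Nat.mul_add_mod_self_right] at this
    rw [Nat.mod_eq_of_lt (e i).2, Nat.mod_eq_of_lt (e j).2] at this
    exact e.injective (Fin.ext this)
  · intro i j hij
    apply key _ (e i).2
    rcases hij with h | ⟨h1, h2⟩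
    · apply key _ (hv i)
      have := hu i
      omega
    · rw [h1]; omega

/-- Only the diagonal blocks of `A` on classes of mutual domination are triangularized, so the
conjugating matrices are block diagonal and supported on domination. The rest of the matrix goes
strictly between classes, where the degree changes strictly; `h` therefore orders by decreasing
degree first and by the order inside the block second. Each block has a rational characteristic
polynomial, so Galois permutes its diagonal entries within the class. Members of a class dominate
each other, so these permutations preserve edges. -/
theorem exists_triangular_form {A : Matrix S S ℚ} (hA : ∀ β γ, A β γ ≠ 0 → Dom G β γ) :
    ∃ (P Q A' : Matrix S S K) (h : S → ℕ), P * Q = 1 ∧ A.map (algebraMap ℚ K) * P = P * A' ∧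
      (∀ β γ, P β γ ≠ 0 → Dom G β γ) ∧ (∀ β γ, Q β γ ≠ 0 → Dom G β γ) ∧
      (∀ β γ, A' β γ ≠ 0 → Dom G β γ) ∧
      Function.Injective h ∧ (∀ a i, A' a i ≠ 0 → a = i ∨ h i < h a) ∧
      ∀ σ : K ≃ₐ[ℚ] K, ∃ π : Equiv.Perm S, (∀ i j, G.Adj i j → G.Adj (π i) (π j)) ∧
        ∀ i, A' (π i) (π i) = σ (A' i i) := by
  classical
  -- Two vertices have the same label exactly when each dominates the other.
  let κ : S → Set S := fun i => {j | Dom G j i}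
  have hκ : ∀ {i j}, κ i = κ j → Dom G i j := fun {i j} h => by
    have : i ∈ κ i := Dom.refl i
    rwa [h] at this
  have hκ' : ∀ {i j}, Dom G i j → Dom G j i → κ i = κ j := fun {i j} h1 h2 =>
    Set.ext fun x => ⟨fun hx => Dom.trans hx h1, fun hx => Dom.trans hx h2⟩
  let blk : ∀ c, Matrix {i // κ i = c} {i // κ i = c} ℚ := fun c => A.submatrix (↑) (↑)
  choose P Q D r hPQ hQP hDP hD hchar using fun c =>
    exists_triangular_matrix ((blk c).map (algebraMap ℚ K))
  let P' := fiberDiagonal κ P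
  let Q' := fiberDiagonal κ Q
  let D' := fiberDiagonal κ D
  let A₀ := fiberDiagonal κ (fun c => (blk c).map (algebraMap ℚ K))
  let AK := A.map (algebraMap ℚ K)
  have hPQ' : P' * Q' = 1 := by
    rw [fiberDiagonal_mul]; simp only [hPQ]; exact fiberDiagonal_one
  have hQP' : Q' * P' = 1 := mul_eq_one_comm.1 hPQ'
  have hAD : A₀ * P' = P' * D' := by
    rw [fiberDiagonal_mul, fiberDiagonal_mul]; simp only [hDP]
  have hne : ∀ (f : ∀ c, Matrix {i // κ i = c} {i // κ i = c} K) {a i : S},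
      fiberDiagonal κ f a i ≠ 0 → κ a = κ i := by
    intro f a i h0
    by_contra hc
    exact h0 (fiberDiagonal_apply_of_ne f hc)
  have hA₀ : ∀ a i (h : κ a = κ i), A₀ a i = algebraMap ℚ K (A a i) := fun a i h =>
    fiberDiagonal_apply_of_eq (fun c => (blk c).map (algebraMap ℚ K)) h rfl
  have hA₀' : ∀ a i (h : κ a ≠ κ i), A₀ a i = 0 := fun a i h =>
    fiberDiagonal_apply_of_ne (fun c => (blk c).map (algebraMap ℚ K)) h
  have hD' : ∀ a i (h : κ a = κ i), D' a i = D (κ i) ⟨a, h⟩ ⟨i, rfl⟩ := fun a i h =>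
    fiberDiagonal_apply_of_eq D h rfl
  have hN : ∀ a i, (AK - A₀) a i ≠ 0 → Dom G a i ∧ κ a ≠ κ i := by
    intro a i h0
    have hai : κ a ≠ κ i := by
      intro hc
      apply h0
      rw [Matrix.sub_apply, hA₀ a i hc]
      simp [AK]
    refine ⟨hA a i fun h => h0 ?_, hai⟩
    rw [Matrix.sub_apply, hA₀' a i hai]
    simp [AK, h]
  let M := Q' * (AK - A₀) * P'
  have hM : ∀ a i, M a i ≠ 0 → Dom G a i ∧ κ a ≠ κ i := by
    intro a i h0
    obtain ⟨γ, _, h1⟩ := Finset.exists_ne_zero_of_sum_ne_zero h0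
    obtain ⟨β, _, h2⟩ := Finset.exists_ne_zero_of_sum_ne_zero (left_ne_zero_of_mul h1)
    have e1 := hne _ (left_ne_zero_of_mul h2)
    have e2 := hne _ (right_ne_zero_of_mul h1)
    obtain ⟨e3, e4⟩ := hN β γ (right_ne_zero_of_mul h2)
    exact ⟨(hκ e1).trans (e3.trans (hκ e2)), by rwa [e1, ← e2]⟩
  have hA' : Q' * AK * P' = D' + M := by
    have : AK = A₀ + (AK - A₀) := by abel
    calc Q' * AK * P' = Q' * (A₀ + (AK - A₀)) * P' := by rw [← this]
      _ = Q' * (A₀ * P') + M := by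
        simp only [M, Matrix.mul_add, Matrix.add_mul, Matrix.mul_assoc]
      _ = D' + M := by rw [hAD, ← Matrix.mul_assoc, hQP', Matrix.one_mul]
  have hentry : ∀ a i, (D' + M) a i ≠ 0 →
      (∃ h : κ a = κ i, D (κ i) ⟨a, h⟩ ⟨i, rfl⟩ ≠ 0) ∨ (Dom G a i ∧ κ a ≠ κ i) := by
    intro a i h0
    by_cases h : M a i = 0
    · left
      rw [Matrix.add_apply, h, add_zero] at h0
      have h1 := hne _ h0
      refine ⟨h1, ?_⟩
      rwa [hD' a i h1] at h0
    · exact Or.inr (hM a i h)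
  have hdiag : ∀ i, (D' + M) i i = D (κ i) ⟨i, rfl⟩ ⟨i, rfl⟩ := by
    intro i
    have : M i i = 0 := by
      by_contra h
      exact (hM i i h).2 rfl
    rw [Matrix.add_apply, this, add_zero, hD' i i rfl]
  obtain ⟨h, hinj, hlt⟩ := exists_injective_height (fun i => G.degree i)
    (fun i => r (κ i) ⟨i, rfl⟩)
  refine ⟨P', Q', D' + M, h, hPQ', ?_, fun β γ h0 => hκ (hne _ h0),
    fun β γ h0 => hκ (hne _ h0), ?_, hinj, ?_, ?_⟩
  · rw [← hA', ← Matrix.mul_assoc, ← Matrix.mul_assoc, hPQ', Matrix.one_mul]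
  · intro β γ h0
    rcases hentry β γ h0 with ⟨h1, -⟩ | ⟨h1, -⟩
    · exact hκ h1
    · exact h1
  · intro a i h0
    rcases hentry a i h0 with ⟨h1, h2⟩ | ⟨h1, h2⟩
    · rcases hD _ _ _ h2 with h3 | h3
      · exact Or.inl (congrArg Subtype.val h3)
      · right
        apply hlt
        right
        refine ⟨le_antisymm (hκ h1.symm).degree_le (hκ h1).degree_le, ?_⟩
        have h4 : ∀ c (hc : c = κ i) (hac : κ a = c), r c ⟨a, hac⟩ = r (κ i) ⟨a, h1⟩ := by
          rintro c rfl _; rfl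
        rwa [h4 (κ a) h1 rfl]
    · right
      apply hlt
      left
      refine lt_of_le_of_ne h1.degree_le fun hd => h2 (hκ' h1 (h1.symm_of_degree_eq hd))
  · intro σ
    have hp : ∀ c, ∃ π : Equiv.Perm {i // κ i = c}, ∀ i, D c (π i) (π i) = σ (D c i i) := by
      intro c
      refine exists_perm_of_charpoly (l := fun i => D c i i) (p := (blk c).charpoly) ?_ σ
      rw [← hchar, Matrix.charpoly_map]
    choose π hπ using hp
    let π' : Equiv.Perm S := (Equiv.sigmaFiberEquiv κ).symm.trans
      ((Equiv.sigmaCongrRight π).trans (Equiv.sigmaFiberEquiv κ))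
    have hπ' : ∀ i, π' i = (π (κ i) ⟨i, rfl⟩ : S) := fun i => rfl
    have hκπ : ∀ i, κ (π' i) = κ i := fun i => (π (κ i) ⟨i, rfl⟩).2
    refine ⟨π', fun i j hij => ?_, fun i => ?_⟩
    · refine (Dom.adj hij (hκ (hκπ i).symm) (hκ (hκπ j).symm)).resolve_left fun he => ?_
      exact hij.ne (π'.injective he)
    · rw [hdiag, hdiag, ← hπ]
      have : ∀ c (hc : κ (π' i) = c) , D (κ (π' i)) ⟨π' i, rfl⟩ ⟨π' i, rfl⟩ = D c ⟨π' i, hc⟩ ⟨π' i, hc⟩ := by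
        rintro c rfl; rfl
      exact this _ (hκπ i)

end Structure

/-! ### Lie algebras attached to forms -/

/-- The homomorphism induced on a quotient Lie algebra. -/
def quotientLift {L L' : Type*} [LieRing L] [LieAlgebra ℚ L] [LieRing L'] [LieAlgebra ℚ L']
    (I : LieIdeal ℚ L) (f : L →ₗ⁅ℚ⁆ L') (h : ∀ x ∈ I, f x = 0) : L ⧸ I →ₗ⁅ℚ⁆ L' where
  toLinearMap := Submodule.liftQ I.toSubmodule (f : L →ₗ[ℚ] L') h
  map_lie' := by
    intro x y
    induction x using Submodule.Quotient.induction_on with | _ x => ?_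
    induction y using Submodule.Quotient.induction_on with | _ y => ?_
    exact LieHom.map_lie f x y

section FormLie

variable {S : Type*} [Fintype S] {G : SimpleGraph S} {K : Type*} [Field K]

variable (G) in
open Classical in
/-- The wedge of two vectors, restricted to the edges. -/
def wedge (u v : S → K) : S → S → K := fun β γ => if G.Adj β γ then u β * v γ - u γ * v β else 0

/-- The pairing of a vector and a function on edges given by a form. -/
def pair (φ : S → S → S → K) (u : S → K) (b : S → S → K) : K :=
  ∑ p : S × S × S, u p.1 * b p.2.1 p.2.2 * φ p.1 p.2.1 p.2.2

/-- The factor `2` arises because `wedge` records each edge in both orientations. -/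
theorem pair_wedge {φ : S → S → S → K} (h : φ ∈ forms G K) (u v w : S → K) :
    pair φ u (wedge G v w) = 2 * tri φ u v w := by
  have : (2 : K) * tri φ u v w = tri φ u v w - tri φ u w v := by
    rw [tri_skew h u w v]; ring
  rw [this, pair, tri, tri, ← Finset.sum_sub_distrib]
  refine Finset.sum_congr rfl fun p _ => ?_
  by_cases hp : G.Adj p.2.1 p.2.2
  · simp only [wedge, if_pos hp]; ring
  · rw [h.2.2 _ _ _ hp]; ring

theorem pair_add_left (φ : S → S → S → K) (u v : S → K) (b : S → S → K) :
    pair φ (u + v) b = pair φ u b + pair φ v b := by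
  simp [pair, add_mul, Finset.sum_add_distrib]

theorem pair_add_right (φ : S → S → S → K) (u : S → K) (b c : S → S → K) :
    pair φ u (b + c) = pair φ u b + pair φ u c := by
  simp [pair, add_mul, mul_add, Finset.sum_add_distrib]

theorem pair_smul_left (φ : S → S → S → K) (c : K) (u : S → K) (b : S → S → K) :
    pair φ (c • u) b = c * pair φ u b := by
  simp only [pair, Finset.mul_sum, Pi.smul_apply, smul_eq_mul]
  exact Finset.sum_congr rfl fun p _ => by ring

theorem pair_smul_right (φ : S → S → S → K) (c : K) (u : S → K) (b : S → S → K) :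
    pair φ u (c • b) = c * pair φ u b := by
  simp only [pair, Finset.mul_sum, Pi.smul_apply, smul_eq_mul]
  exact Finset.sum_congr rfl fun p _ => by ring

theorem pair_zero_left (φ : S → S → S → K) (b : S → S → K) : pair φ 0 b = 0 := by simp [pair]

theorem pair_zero_right (φ : S → S → S → K) (u : S → K) : pair φ u 0 = 0 := by simp [pair]

/-- The graded Lie algebra whose degree-three part is a line, with triple brackets given by the
form `φ`. -/
def FormLie (_ : forms G K) : Type _ := (S → K) × (S → S → K) × K

namespace FormLie

variable (φ : forms G K)

instance : AddCommGroup (FormLie φ) := inferInstanceAs (AddCommGroup ((S → K) × (S → S → K) × K))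

instance [Algebra ℚ K] : Module ℚ (FormLie φ) :=
  inferInstanceAs (Module ℚ ((S → K) × (S → S → K) × K))

variable {φ}

/-- The degree-one component. -/
def one (x : FormLie φ) : S → K := x.1

/-- The degree-two component. -/
def two (x : FormLie φ) : S → S → K := x.2.1

/-- The degree-three component. -/
def three (x : FormLie φ) : K := x.2.2

/-- The element with given components. -/
def mk (u : S → K) (b : S → S → K) (t : K) : FormLie φ := (u, b, t)

theorem ext {x y : FormLie φ} (h1 : one x = one y) (h2 : two x = two y) (h3 : three x = three y) :
    x = y := Prod.ext h1 (Prod.ext h2 h3)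

@[simp] theorem one_mk (u : S → K) (b : S → S → K) (t : K) : one (mk u b t : FormLie φ) = u := rfl
@[simp] theorem two_mk (u : S → K) (b : S → S → K) (t : K) : two (mk u b t : FormLie φ) = b := rfl
@[simp] theorem three_mk (u : S → K) (b : S → S → K) (t : K) :
    three (mk u b t : FormLie φ) = t := rfl
@[simp] theorem one_add (x y : FormLie φ) : one (x + y) = one x + one y := rfl
@[simp] theorem two_add (x y : FormLie φ) : two (x + y) = two x + two y := rfl
@[simp] theorem three_add (x y : FormLie φ) : three (x + y) = three x + three y := rfl
@[simp] theorem one_zero : one (0 : FormLie φ) = 0 := rfl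
@[simp] theorem two_zero : two (0 : FormLie φ) = 0 := rfl
@[simp] theorem three_zero : three (0 : FormLie φ) = 0 := rfl

instance : Bracket (FormLie φ) (FormLie φ) :=
  ⟨fun x y => mk 0 (wedge G (one x) (one y))
    (pair φ.1 (one x) (two y) - pair φ.1 (one y) (two x))⟩

@[simp] theorem one_lie (x y : FormLie φ) : one ⁅x, y⁆ = 0 := rfl
@[simp] theorem two_lie (x y : FormLie φ) : two ⁅x, y⁆ = wedge G (one x) (one y) := rfl
@[simp] theorem three_lie (x y : FormLie φ) :
    three ⁅x, y⁆ = pair φ.1 (one x) (two y) - pair φ.1 (one y) (two x) := rfl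

omit [Fintype S] in
@[simp] theorem wedge_zero_left (u : S → K) : wedge G 0 u = 0 := by
  ext; simp [wedge]

omit [Fintype S] in
@[simp] theorem wedge_zero_right (u : S → K) : wedge G u 0 = 0 := by
  ext; simp [wedge]

instance : LieRing (FormLie φ) where
  add_lie x y z := by
    refine ext (by simp) ?_ ?_
    · ext β γ
      simp only [two_lie, two_add, one_add, wedge, Pi.add_apply]
      split_ifs <;> ring
    · simp only [three_lie, three_add, one_add, two_add, pair_add_left, pair_add_right]
      ring
  lie_add x y z := by
    refine ext (by simp) ?_ ?_
    · ext β γ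
      simp only [two_lie, two_add, one_add, wedge, Pi.add_apply]
      split_ifs <;> ring
    · simp only [three_lie, three_add, one_add, two_add, pair_add_left, pair_add_right]
      ring
  lie_self x := by
    refine ext (by simp) ?_ ?_
    · ext β γ
      simp only [two_lie, wedge, two_zero, Pi.zero_apply]
      split_ifs <;> ring
    · simp
  leibniz_lie x y z := by
    refine ext (by simp) (by simp) ?_
    simp only [three_lie, three_add, one_lie, two_lie, pair_wedge φ.2, pair_zero_left]
    have h1 := tri_jacobi φ.2 (one x) (one y) (one z)
    have h2 := tri_skew φ.2 (one y) (one x) (one z)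
    linear_combination 2 * h1 - 2 * h2

variable (φ) in
/-- The degree-one component as a rational linear map. -/
def oneₗ [Algebra ℚ K] : FormLie φ →ₗ[ℚ] (S → K) := LinearMap.fst ℚ (S → K) ((S → S → K) × K)

variable (φ) in
/-- The degree-two component as a rational linear map. -/
def twoₗ [Algebra ℚ K] : FormLie φ →ₗ[ℚ] (S → S → K) :=
  (LinearMap.fst ℚ (S → S → K) K).comp (LinearMap.snd ℚ (S → K) ((S → S → K) × K))

variable (φ) in
/-- The degree-three component as a rational linear map. -/
def threeₗ [Algebra ℚ K] : FormLie φ →ₗ[ℚ] K :=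
  (LinearMap.snd ℚ (S → S → K) K).comp (LinearMap.snd ℚ (S → K) ((S → S → K) × K))

instance [Algebra ℚ K] : LieAlgebra ℚ (FormLie φ) where
  lie_smul t x y := by
    have h1 : one (t • y) = algebraMap ℚ K t • one y := (algebraMap_smul K t (one y)).symm
    have h2 : two (t • y) = algebraMap ℚ K t • two y := (algebraMap_smul K t (two y)).symm
    have e : oneₗ φ ⁅x, y⁆ = 0 := rfl
    have h0 : one (t • ⁅x, y⁆) = 0 := (LinearMap.ker (oneₗ φ)).smul_mem t e
    refine ext h0.symm ?_ ?_
    · change wedge G (one x) (one (t • y)) = t • wedge G (one x) (one y)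
      rw [h1, ← algebraMap_smul K t (wedge G (one x) (one y))]
      ext β γ
      simp only [wedge, Pi.smul_apply, smul_eq_mul]
      split_ifs <;> ring
    · change _ = t • three ⁅x, y⁆
      rw [three_lie, three_lie, h1, h2, pair_smul_left, pair_smul_right, Algebra.smul_def]
      ring

instance : IsThreeStep (FormLie φ) where
  lie4 x y z w := by
    refine ext (by simp) (by simp) ?_
    simp [pair_zero_left, pair_zero_right]

theorem three_lie_lie (x y z : FormLie φ) :
    three ⁅x, ⁅y, z⁆⁆ = 2 * tri φ.1 (one x) (one y) (one z) := by
  simp [pair_wedge φ.2, pair_zero_left]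

variable [DecidableEq S] [Algebra ℚ K] (φ)

/-- The image of a vertex. -/
def vertex (s : S) : FormLie φ := mk (Pi.single s 1) 0 0

theorem vertex_lie_vertex {α β : S} (h : ¬ G.Adj α β) : ⁅vertex φ α, vertex φ β⁆ = 0 := by
  refine ext (by simp) ?_ (by simp [vertex, pair_zero_right])
  ext γ δ
  simp only [two_lie, vertex, one_mk, wedge, two_zero, Pi.zero_apply]
  split_ifs with h'
  · rw [single_mul_single_eq_zero (by rintro ⟨rfl, rfl⟩; exact h h'),
      single_mul_single_eq_zero (by rintro ⟨rfl, rfl⟩; exact h h'.symm), sub_zero]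
  · rfl

/-- The homomorphism from the free `3`-step nilpotent Lie algebra. -/
def freeHom : FreeThreeStep S →ₗ⁅ℚ⁆ FormLie φ :=
  quotientLift (LieModule.lowerCentralSeries ℚ (FreeLieAlgebra ℚ S) (FreeLieAlgebra ℚ S) 3)
    (FreeLieAlgebra.lift ℚ (vertex φ)) (by
      have : LieModule.lowerCentralSeries ℚ (FreeLieAlgebra ℚ S) (FreeLieAlgebra ℚ S) 3 ≤
          (FreeLieAlgebra.lift ℚ (vertex φ)).ker := by
        rw [LieModule.lowerCentralSeries_succ, LieModule.lowerCentralSeries_succ,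
          LieModule.lowerCentralSeries_succ, LieModule.lowerCentralSeries_zero,
          LieSubmodule.top_lie_le_iff_le_normalizer, LieSubmodule.top_lie_le_iff_le_normalizer,
          LieSubmodule.top_lie_le_iff_le_normalizer]
        intro w _
        simp only [LieSubmodule.mem_normalizer]
        intro x y z
        rw [LieHom.mem_ker, LieHom.map_lie, LieHom.map_lie, LieHom.map_lie, IsThreeStep.lie4]
      exact fun x hx => LieHom.mem_ker.1 (this hx))

theorem freeHom_of (s : S) : freeHom φ (FreeThreeStep.of s) = vertex φ s :=
  FreeLieAlgebra.lift_of_apply (vertex φ) s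

/-- The homomorphism from the Lie algebra of the graph. -/
def graphHom : GraphLie G →ₗ⁅ℚ⁆ FormLie φ :=
  quotientLift (nonEdgeIdeal G) (freeHom φ) (by
    have : nonEdgeIdeal G ≤ (freeHom φ).ker := by
      refine LieSubmodule.lieSpan_le.2 ?_
      rintro _ ⟨α, β, h, rfl⟩
      change _ ∈ (freeHom φ).ker
      rw [LieHom.mem_ker, LieHom.map_lie, freeHom_of, freeHom_of, vertex_lie_vertex φ h]
    exact fun x hx => LieHom.mem_ker.1 (this hx))

theorem graphHom_vertex (s : S) : graphHom φ (GraphLie.vertex G s) = vertex φ s :=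
  freeHom_of φ s

/-- The homomorphism from the quotient of the Lie algebra of the graph by `X`. -/
def quotHom {X : GraphLie G} (hX : graphHom φ X = 0) : QuotLie G X →ₗ⁅ℚ⁆ FormLie φ :=
  quotientLift _ (graphHom φ) (by
    have : (LieSubmodule.lieSpan ℚ (GraphLie G) {X} : LieIdeal ℚ (GraphLie G)) ≤
        (graphHom φ).ker := by
      refine LieSubmodule.lieSpan_le.2 ?_
      rintro _ rfl
      exact LieHom.mem_ker.2 hX
    exact fun x hx => LieHom.mem_ker.1 (this hx))

end FormLie

end FormLie

/-! ### Generation by the vertices -/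

section Generation

variable {S : Type*} {G : SimpleGraph S} {X : GraphLie G}

variable (G X) in
/-- The projection onto `ℳ`. -/
def toQuot : GraphLie G →ₗ⁅ℚ⁆ QuotLie G X where
  toFun x := LieSubmodule.Quotient.mk
    (N := (LieSubmodule.lieSpan ℚ (GraphLie G) {X} : LieIdeal ℚ (GraphLie G))) x
  map_add' _ _ := rfl
  map_smul' _ _ := rfl
  map_lie' := rfl

variable (G) in
/-- The projection from the free Lie algebra. -/
def ofFree : FreeLieAlgebra ℚ S →ₗ⁅ℚ⁆ GraphLie G where
  toFun x := LieSubmodule.Quotient.mk (N := nonEdgeIdeal G) (LieSubmodule.Quotient.mk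
    (N := LieModule.lowerCentralSeries ℚ (FreeLieAlgebra ℚ S) (FreeLieAlgebra ℚ S) 3) x)
  map_add' _ _ := rfl
  map_smul' _ _ := rfl
  map_lie' := rfl

theorem ofFree_surjective : Function.Surjective (ofFree G) := by
  intro x
  induction x using Submodule.Quotient.induction_on with | _ x => ?_
  induction x using Submodule.Quotient.induction_on with | _ x => ?_
  exact ⟨x, rfl⟩

theorem toQuot_surjective : Function.Surjective (toQuot G X) :=
  Submodule.Quotient.mk_surjective _

theorem toQuot_self : toQuot G X X = 0 :=
  (LieSubmodule.Quotient.mk_eq_zero').2 (LieSubmodule.subset_lieSpan (Set.mem_singleton X))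

variable (G X) in
/-- The element of `ℳ` given by a vertex. -/
def quotVertex (s : S) : QuotLie G X := toQuot G X (GraphLie.vertex G s)

theorem quot_subalgebra_eq_top (N : LieSubalgebra ℚ (QuotLie G X))
    (h : ∀ s, quotVertex G X s ∈ N) (x : QuotLie G X) : x ∈ N := by
  obtain ⟨y, rfl⟩ := toQuot_surjective x
  obtain ⟨z, rfl⟩ := ofFree_surjective y
  exact freeLie_subalgebra_eq_top (N.comap ((toQuot G X).comp (ofFree G))) h z

/-- Two linear maps on `ℳ` which agree on vertices and on brackets are equal. -/
theorem quot_linearMap_ext {W : Type*} [AddCommGroup W] [Module ℚ W] {f g : QuotLie G X →ₗ[ℚ] W}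
    (h1 : ∀ s, f (quotVertex G X s) = g (quotVertex G X s))
    (h2 : ∀ x y : QuotLie G X, f ⁅x, y⁆ = g ⁅x, y⁆) (x : QuotLie G X) : f x = g x := by
  let N : LieSubalgebra ℚ (QuotLie G X) :=
    { LinearMap.eqLocus f g with lie_mem' := fun {x y} _ _ => h2 x y }
  exact quot_subalgebra_eq_top N h1 x

end Generation

/-! ### Eigenvalues -/

section Eigenvalues

open Polynomial

/-- An eigenfunctional on an invariant subspace yields a root of the characteristic polynomial. -/
theorem aeval_charpoly_eq_zero {F K V : Type*} [Field F] [Field K] [Algebra F K] [AddCommGroup V]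
    [Module F V] [Module.Finite F V] {f : V →ₗ[F] V} {N : Submodule F V}
    (hN : ∀ x ∈ N, f x ∈ N) {c : V →ₗ[F] K} {μ : K} (hc : ∀ x ∈ N, c (f x) = μ * c x)
    {v : V} (hv : v ∈ N) (hcv : c v ≠ 0) : aeval μ f.charpoly = 0 := by
  -- On `N` the functional turns `p(f)` into multiplication by `p(μ)`; Cayley-Hamilton for the
  -- characteristic polynomial then gives the claim.
  have key : ∀ p : F[X], ∀ x ∈ N, aeval f p x ∈ N ∧ c (aeval f p x) = aeval μ p * c x := by
    intro p
    induction p using Polynomial.induction_on' with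
    | add p q hp hq =>
      intro x hx
      simp only [map_add, LinearMap.add_apply, add_mul]
      exact ⟨N.add_mem (hp x hx).1 (hq x hx).1, by rw [(hp x hx).2, (hq x hx).2]⟩
    | monomial n a =>
      have hpow : ∀ n, ∀ x ∈ N, (f ^ n) x ∈ N ∧ c ((f ^ n) x) = μ ^ n * c x := by
        intro n
        induction n with
        | zero => intro x hx; simp [hx]
        | succ n ih =>
          intro x hx
          rw [pow_succ', Module.End.mul_apply]
          refine ⟨hN _ (ih x hx).1, ?_⟩
          rw [hc _ (ih x hx).1, (ih x hx).2]; ring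
      intro x hx
      simp only [aeval_monomial, Module.End.mul_apply, Module.algebraMap_end_apply, map_smul]
      refine ⟨N.smul_mem _ (hpow n x hx).1, ?_⟩
      rw [(hpow n x hx).2, Algebra.smul_def, mul_assoc]
  have := (key f.charpoly v hv).2
  rw [LinearMap.aeval_self_charpoly, LinearMap.zero_apply, map_zero] at this
  exact (mul_eq_zero.1 this.symm).resolve_right hcv

/-- The spectral mapping theorem after base change to `K`. -/
theorem exists_root_charpoly_of_pow {F K V : Type*} [Field F] [Field K] [IsAlgClosed K]
    [Algebra F K] [AddCommGroup V] [Module F V] [Module.Finite F V] {f : V →ₗ[F] V} {m : ℕ}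
    (hm : 0 < m) {μ : K} (h : aeval μ (f ^ m).charpoly = 0) :
    ∃ ν : K, aeval ν f.charpoly = 0 ∧ ν ^ m = μ := by
  have key : ∀ (g : V →ₗ[F] V) (ν : K), aeval ν g.charpoly = 0 ↔
      ν ∈ spectrum K (g.baseChange K : Module.End K (K ⊗[F] V)) := by
    intro g ν
    rw [← Module.End.hasEigenvalue_iff_mem_spectrum, Module.End.hasEigenvalue_iff_isRoot_charpoly,
      LinearMap.charpoly_baseChange, Polynomial.IsRoot, Polynomial.eval_map_algebraMap]
  have hpow : (f ^ m).baseChange K = (f.baseChange K : Module.End K (K ⊗[F] V)) ^ m :=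
    by
    simp [LinearMap.baseChange_pow]
  rw [key, hpow, spectrum.map_pow_of_pos _ hm] at h
  obtain ⟨ν, hν, e⟩ := h
  exact ⟨ν, (key f ν).2 hν, e⟩

theorem rat_eq_one_or_neg_one {q r : ℚ} (hq : IsIntegral ℤ q) (hr : IsIntegral ℤ r)
    (h : q * r = 1) : q = 1 ∨ q = -1 := by
  obtain ⟨a, rfl⟩ := IsIntegrallyClosed.isIntegral_iff.1 hq
  obtain ⟨b, rfl⟩ := IsIntegrallyClosed.isIntegral_iff.1 hr
  have hab : a * b = 1 := by
    have : ((a * b : ℤ) : ℚ) = 1 := by push_cast; simpa using h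
    exact_mod_cast this
  rcases Int.isUnit_iff.1 (IsUnit.of_mul_eq_one b hab) with rfl | rfl <;> simp

/-- Units of the ring of algebraic integers. -/
def IsIntegralUnit {K : Type*} [Field K] (x : K) : Prop :=
  IsIntegral ℤ x ∧ ∃ y, IsIntegral ℤ y ∧ x * y = 1

theorem IsIntegralUnit.mul {K : Type*} [Field K] {x y : K} (hx : IsIntegralUnit x)
    (hy : IsIntegralUnit y) : IsIntegralUnit (x * y) := by
  obtain ⟨hx, x', hx', h1⟩ := hx
  obtain ⟨hy, y', hy', h2⟩ := hy
  exact ⟨hx.mul hy, x' * y', hx'.mul hy', by rw [mul_mul_mul_comm, h1, h2, one_mul]⟩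

theorem IsIntegralUnit.pow {K : Type*} [Field K] {x : K} (hx : IsIntegralUnit x) (m : ℕ) :
    IsIntegralUnit (x ^ m) := by
  obtain ⟨hx, x', hx', h1⟩ := hx
  exact ⟨hx.pow m, x' ^ m, hx'.pow m, by rw [← mul_pow, h1, one_pow]⟩

theorem IsIntegralUnit.norm_eq_one {K : Type*} [Field K] [Algebra ℚ K] {q : ℚ}
    (h : IsIntegralUnit (algebraMap ℚ K q)) (ι : K →+* ℂ) : ‖ι (algebraMap ℚ K q)‖ = 1 := by
  obtain ⟨h1, y, hy, e⟩ := h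
  have hinj := (algebraMap ℚ K).injective
  have hq : q ≠ 0 := by rintro rfl; simp at e
  have hy' : y = algebraMap ℚ K q⁻¹ := by
    rw [map_inv₀]; exact eq_inv_of_mul_eq_one_right e
  rw [hy'] at hy
  have i1 : IsIntegral ℤ q := (isIntegral_algebraMap_iff hinj).1 h1
  have i2 : IsIntegral ℤ q⁻¹ := (isIntegral_algebraMap_iff hinj).1 hy
  rcases rat_eq_one_or_neg_one i1 i2 (mul_inv_cancel₀ hq) with rfl | rfl <;> simp

end Eigenvalues

/-! ### Evaluation of forms and the matrix of an automorphism -/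

section Automorphism

variable {S : Type*} [Fintype S] {G : SimpleGraph S} {K : Type*} [Field K]
  [Algebra ℚ K] {X : GraphLie G}

theorem exists_coefficients (hX : X ∈ degreeThree G) : ∃ c : S × S × S → ℚ,
    ∑ p, c p • ⁅GraphLie.vertex G p.1, ⁅GraphLie.vertex G p.2.1, GraphLie.vertex G p.2.2⁆⁆ = X := by
  apply (Submodule.mem_span_range_iff_exists_fun ℚ).1
  refine Submodule.span_mono ?_ hX
  rintro _ ⟨α, β, γ, _, rfl⟩
  exact ⟨(α, β, γ), rfl⟩

variable (K) in
/-- The evaluation of forms at a combination of triple brackets. -/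
def evalForm (c : S × S × S → ℚ) : (S → S → S → K) →ₗ[K] K where
  toFun φ := ∑ p, algebraMap ℚ K (c p) * φ p.1 p.2.1 p.2.2
  map_add' φ ψ := by simp [mul_add, Finset.sum_add_distrib]
  map_smul' t φ := by
    simp only [Pi.smul_apply, smul_eq_mul, RingHom.id_apply, Finset.mul_sum]
    exact Finset.sum_congr rfl fun p _ => by ring

variable [DecidableEq S]

/-- Triple brackets land in the one-dimensional degree-three part, so `X` is seen only through the
value of the form on it. This decides which forms descend to `ℳ`; the `2` is that of `pair_wedge`.
-/
theorem graphHom_eq (φ : forms G K) (c : S × S × S → ℚ) :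
    FormLie.graphHom φ (∑ p, c p • ⁅GraphLie.vertex G p.1,
      ⁅GraphLie.vertex G p.2.1, GraphLie.vertex G p.2.2⁆⁆) =
    FormLie.mk 0 0 (2 * evalForm K c φ.1) := by
  have h : ∀ α β γ, FormLie.graphHom φ ⁅GraphLie.vertex G α,
      ⁅GraphLie.vertex G β, GraphLie.vertex G γ⁆⁆ = FormLie.mk 0 0 (2 * φ.1 α β γ) := by
    intro α β γ
    simp only [LieHom.map_lie, FormLie.graphHom_vertex]
    refine FormLie.ext rfl (by simp) ?_
    rw [FormLie.three_lie_lie, FormLie.three_mk]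
    simp only [FormLie.vertex, FormLie.one_mk, tri_single]
  rw [map_sum]
  simp only [map_smul, h]
  refine FormLie.ext ?_ ?_ ?_
  · have e : ∀ t : K, FormLie.oneₗ φ (FormLie.mk 0 0 t : FormLie φ) = 0 := fun _ => rfl
    exact (LinearMap.ker (FormLie.oneₗ φ)).sum_mem fun p _ =>
      (LinearMap.ker (FormLie.oneₗ φ)).smul_mem (c p) (e _)
  · have e : ∀ t : K, FormLie.twoₗ φ (FormLie.mk 0 0 t : FormLie φ) = 0 := fun _ => rfl
    exact (LinearMap.ker (FormLie.twoₗ φ)).sum_mem fun p _ =>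
      (LinearMap.ker (FormLie.twoₗ φ)).smul_mem (c p) (e _)
  · change FormLie.threeₗ φ _ = _
    rw [map_sum]
    simp only [map_smul, FormLie.three_mk, evalForm, LinearMap.coe_mk, AddHom.coe_mk,
      Finset.mul_sum]
    refine Finset.sum_congr rfl fun p _ => ?_
    rw [Algebra.smul_def]
    change _ * (2 * φ.1 _ _ _) = _
    ring

/-- The zero form kills all of `V₃`. It thus gives a homomorphism on `ℳ` that sees degrees one and
two, whatever `X` is. -/
theorem graphHom_eq_zero (hX : X ∈ degreeThree G) :
    FormLie.graphHom (0 : forms G ℚ) X = 0 := by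
  obtain ⟨c, rfl⟩ := exists_coefficients hX
  rw [graphHom_eq]
  simp
  rfl

/-- The coordinates of an element of `ℳ` modulo brackets. -/
def coord (hX : X ∈ degreeThree G) : QuotLie G X →ₗ[ℚ] (S → ℚ) :=
  (FormLie.oneₗ (0 : forms G ℚ)).comp
    (FormLie.quotHom (0 : forms G ℚ) (graphHom_eq_zero hX)).toLinearMap

variable (hX : X ∈ degreeThree G)

theorem coord_vertex (s : S) : coord hX (quotVertex G X s) = Pi.single s 1 := by
  change FormLie.one (FormLie.graphHom (0 : forms G ℚ) (GraphLie.vertex G s)) = _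
  rw [FormLie.graphHom_vertex]
  rfl

theorem coord_lie (x y : QuotLie G X) : coord hX ⁅x, y⁆ = 0 := by
  change FormLie.one (FormLie.quotHom (0 : forms G ℚ) _ _) = _
  rw [LieHom.map_lie, FormLie.one_lie]

theorem wedge_coord_eq_zero {x y : QuotLie G X} (h : ⁅x, y⁆ = 0) :
    wedge G (coord hX x) (coord hX y) = 0 := by
  have := congrArg (fun z => FormLie.two (FormLie.quotHom (0 : forms G ℚ) (graphHom_eq_zero hX) z)) h
  simp only [LieHom.map_lie, FormLie.two_lie, map_zero, FormLie.two_zero] at this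
  exact this

theorem one_quotHom {φ : forms G K} (hφ : FormLie.graphHom φ X = 0) (x : QuotLie G X) :
    FormLie.one (FormLie.quotHom φ hφ x) = fun s => algebraMap ℚ K (coord hX x s) := by
  let f : QuotLie G X →ₗ[ℚ] (S → K) :=
    (FormLie.oneₗ φ).comp (FormLie.quotHom φ hφ : QuotLie G X →ₗ[ℚ] FormLie φ)
  let g : QuotLie G X →ₗ[ℚ] (S → K) := (LinearMap.compLeft (Algebra.linearMap ℚ K) S).comp (coord hX)
  refine quot_linearMap_ext (f := f) (g := g) (fun s => ?_) (fun y z => ?_) x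
  · change FormLie.one (FormLie.graphHom φ (GraphLie.vertex G s)) = fun t => algebraMap ℚ K _
    rw [FormLie.graphHom_vertex, coord_vertex]
    ext t
    simp only [FormLie.vertex, FormLie.one_mk, Pi.single_apply]
    split_ifs <;> simp
  · change FormLie.one (FormLie.quotHom _ _ _) = fun t => algebraMap ℚ K _
    rw [LieHom.map_lie, FormLie.one_lie, coord_lie]
    ext t; simp

/-- The matrix of an endomorphism on `ℳ` modulo brackets. -/
def vertexMatrix (θ : QuotLie G X →ₗ[ℚ] QuotLie G X) : Matrix S S ℚ :=
  Matrix.of fun β α => coord hX (θ (quotVertex G X α)) β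

variable {hX} {θ : QuotLie G X →ₗ[ℚ] QuotLie G X}

theorem coord_apply (hθ : ∀ x y, θ ⁅x, y⁆ = ⁅θ x, θ y⁆) (x : QuotLie G X) :
    coord hX (θ x) = (vertexMatrix hX θ).mulVec (coord hX x) := by
  refine quot_linearMap_ext (f := (coord hX).comp θ)
    (g := (vertexMatrix hX θ).mulVecLin.comp (coord hX)) (fun s => ?_) (fun y z => ?_) x
  · simp only [LinearMap.comp_apply, Matrix.mulVecLin_apply, coord_vertex]
    ext t; simp [vertexMatrix]
  · simp only [LinearMap.comp_apply, hθ, coord_lie, map_zero]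

theorem coord_surjective : Function.Surjective (coord hX) := by
  intro v
  refine ⟨∑ s, v s • quotVertex G X s, ?_⟩
  rw [map_sum]
  ext t
  simp [coord_vertex, Pi.single_apply]

/-- Non-adjacent vertices commute in `ℳ`, hence so do their images under `θ`, and the wedge of
commuting elements vanishes over every edge. -/
theorem vertexMatrix_respects (hθ : ∀ x y, θ ⁅x, y⁆ = ⁅θ x, θ y⁆) :
    Respects G (vertexMatrix hX θ) := by
  intro α γ β δ h1 h2
  have h0 : ⁅quotVertex G X α, quotVertex G X γ⁆ = 0 := by
    have : ⁅GraphLie.vertex G α, GraphLie.vertex G γ⁆ = 0 := by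
      refine (LieSubmodule.Quotient.mk_eq_zero' (N := nonEdgeIdeal G)
        (m := ⁅FreeThreeStep.of α, FreeThreeStep.of γ⁆)).2 ?_
      exact LieSubmodule.subset_lieSpan ⟨α, γ, h1, rfl⟩
    rw [quotVertex, quotVertex, ← LieHom.map_lie, this, map_zero]
  have h3 : ⁅θ (quotVertex G X α), θ (quotVertex G X γ)⁆ = 0 := by rw [← hθ, h0, map_zero]
  have h4 := congrFun (congrFun (wedge_coord_eq_zero hX h3) β) δ
  simp only [wedge, if_pos h2, Pi.zero_apply] at h4
  exact sub_eq_zero.1 h4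

theorem vertexMatrix_surjective (hθ : ∀ x y, θ ⁅x, y⁆ = ⁅θ x, θ y⁆)
    (hs : Function.Surjective θ) : Function.Surjective (vertexMatrix hX θ).mulVec := by
  intro v
  obtain ⟨x, rfl⟩ := coord_surjective (hX := hX) v
  obtain ⟨y, rfl⟩ := hs x
  exact ⟨coord hX y, (coord_apply hθ y).symm⟩

theorem pow_map_lie (hθ : ∀ x y, θ ⁅x, y⁆ = ⁅θ x, θ y⁆) (m : ℕ) (x y : QuotLie G X) :
    (θ ^ m) ⁅x, y⁆ = ⁅(θ ^ m) x, (θ ^ m) y⁆ := by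
  induction m with
  | zero => simp
  | succ m ih => simp only [pow_succ', Module.End.mul_apply, ih, hθ]

theorem vertexMatrix_pow (hθ : ∀ x y, θ ⁅x, y⁆ = ⁅θ x, θ y⁆) (m : ℕ) :
    vertexMatrix hX (θ ^ m) = vertexMatrix hX θ ^ m := by
  have h : ∀ x, coord hX ((θ ^ m) x) = (vertexMatrix hX θ ^ m).mulVec (coord hX x) := by
    intro x
    induction m with
    | zero => simp
    | succ m ih =>
      rw [pow_succ', Module.End.mul_apply, coord_apply hθ, ih, pow_succ', Matrix.mulVec_mulVec]
  ext β α
  have := congrFun (h (quotVertex G X α)) β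
  rw [coord_vertex] at this
  simpa [vertexMatrix] using this

-- A left eigenvector of the vertex matrix, composed with `coord`, is an eigenfunctional of `θ`.
open Polynomial in
theorem aeval_charpoly_of_vertexMatrix (hθ : ∀ x y, θ ⁅x, y⁆ = ⁅θ x, θ y⁆) {μ : K}
    (h : aeval μ (vertexMatrix hX θ).charpoly = 0) : aeval μ θ.charpoly = 0 := by
  set A := vertexMatrix hX θ
  have h1 : (Matrix.scalar S μ - A.map (algebraMap ℚ K)).det = 0 := by
    rw [← Matrix.eval_charpoly, Matrix.charpoly_map, Polynomial.eval_map_algebraMap, h]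
  obtain ⟨v, hv0, hv⟩ := Matrix.exists_vecMul_eq_zero_iff.2 h1
  rw [Matrix.vecMul_sub, sub_eq_zero] at hv
  let c : QuotLie G X →ₗ[ℚ] K :=
    (∑ s, v s • (Algebra.linearMap ℚ K).comp (LinearMap.proj s)).comp (coord hX)
  have hc : ∀ x, c x = v ⬝ᵥ (fun s => algebraMap ℚ K (coord hX x s)) := by
    intro x
    simp [c, dotProduct]
  obtain ⟨s, hs⟩ : ∃ s, v s ≠ 0 := Function.ne_iff.1 hv0
  refine aeval_charpoly_eq_zero (N := ⊤) (fun _ _ => trivial) (c := c) (fun x _ => ?_)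
    (v := quotVertex G X s) trivial ?_
  · rw [hc, hc, coord_apply hθ]
    have : (fun s => algebraMap ℚ K (A.mulVec (coord hX x) s)) =
        (A.map (algebraMap ℚ K)).mulVec (fun s => algebraMap ℚ K (coord hX x s)) := by
      ext s; exact RingHom.map_mulVec (algebraMap ℚ K) A (coord hX x) s
    rw [this, Matrix.dotProduct_mulVec, ← hv]
    simp [Matrix.vecMul_diagonal, dotProduct, Finset.mul_sum, mul_assoc, mul_left_comm]
  · rw [hc, coord_vertex]
    simpa [dotProduct, Pi.single_apply] using hs

variable [CharZero K]

theorem three_quotHom_apply {φ : forms G K} (hφ : FormLie.graphHom φ X = 0)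
    (hθ : ∀ x y, θ ⁅x, y⁆ = ⁅θ x, θ y⁆) (x y z : QuotLie G X) :
    FormLie.three (FormLie.quotHom φ hφ (θ ⁅x, ⁅y, z⁆⁆)) =
      2 * tri (act ((vertexMatrix hX θ).map (algebraMap ℚ K)) φ.1)
        (fun s => algebraMap ℚ K (coord hX x s)) (fun s => algebraMap ℚ K (coord hX y s))
        (fun s => algebraMap ℚ K (coord hX z s)) := by
  have h : ∀ x, (fun s => algebraMap ℚ K (coord hX (θ x) s)) =
      ((vertexMatrix hX θ).map (algebraMap ℚ K)).mulVec
        (fun s => algebraMap ℚ K (coord hX x s)) := by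
    intro x
    ext s
    rw [coord_apply hθ]
    exact RingHom.map_mulVec (algebraMap ℚ K) _ (coord hX x) s
  rw [hθ, hθ, LieHom.map_lie, LieHom.map_lie, FormLie.three_lie_lie, one_quotHom hX,
    one_quotHom hX, one_quotHom hX, h, h, h, tri_act]

theorem three_quotHom {φ : forms G K} (hφ : FormLie.graphHom φ X = 0) (x y z : QuotLie G X) :
    FormLie.three (FormLie.quotHom φ hφ ⁅x, ⁅y, z⁆⁆) =
      2 * tri φ.1 (fun s => algebraMap ℚ K (coord hX x s))
        (fun s => algebraMap ℚ K (coord hX y s)) (fun s => algebraMap ℚ K (coord hX z s)) := by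
  rw [LieHom.map_lie, LieHom.map_lie, FormLie.three_lie_lie, one_quotHom hX,
    one_quotHom hX, one_quotHom hX]

theorem algebraMap_coord_vertex (s : S) :
    (fun t => algebraMap ℚ K (coord hX (quotVertex G X s) t)) = Pi.single s 1 := by
  ext t
  rw [coord_vertex]
  simp only [Pi.single_apply]
  split_ifs <;> simp

open Polynomial in
/-- An eigenform on which the evaluation at `X` vanishes gives an eigenvalue on `ℳ`. -/
theorem aeval_charpoly_of_form (hθ : ∀ x y, θ ⁅x, y⁆ = ⁅θ x, θ y⁆) {φ : forms G K}
    (hφ : FormLie.graphHom φ X = 0) (hφ0 : φ ≠ 0) {μ : K}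
    (h : act ((vertexMatrix hX θ).map (algebraMap ℚ K)) φ.1 = μ • φ.1) :
    aeval μ θ.charpoly = 0 := by
  let c : QuotLie G X →ₗ[ℚ] K :=
    (FormLie.threeₗ φ).comp (FormLie.quotHom φ hφ : QuotLie G X →ₗ[ℚ] FormLie φ)
  -- The eigenvalue identity for `c` is available only on triple brackets, so `c` is used on their
  -- invariant span.
  let N : Submodule ℚ (QuotLie G X) := Submodule.span ℚ {w | ∃ x y z : QuotLie G X, w = ⁅x, ⁅y, z⁆⁆}
  obtain ⟨i, j, k, hijk⟩ : ∃ i j k, φ.1 i j k ≠ 0 := by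
    by_contra! hc
    exact hφ0 (Subtype.ext (by ext i j k; exact hc i j k))
  refine aeval_charpoly_eq_zero (N := N) ?_ (c := c) ?_
    (v := ⁅quotVertex G X i, ⁅quotVertex G X j, quotVertex G X k⁆⁆)
    (Submodule.subset_span ⟨_, _, _, rfl⟩) ?_
  · intro x hx
    refine (Submodule.span_le (p := N.comap θ)).2 ?_ hx
    rintro _ ⟨x, y, z, rfl⟩
    change θ _ ∈ N
    rw [hθ, hθ]
    exact Submodule.subset_span ⟨_, _, _, rfl⟩
  · intro x hx
    induction hx using Submodule.span_induction with
    | zero => simp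
    | add x y _ _ hx hy => rw [map_add, map_add, map_add, hx, hy, mul_add]
    | smul t x _ hx => rw [map_smul, map_smul, map_smul, hx, mul_smul_comm]
    | mem x hx =>
      obtain ⟨x, y, z, rfl⟩ := hx
      change FormLie.three (FormLie.quotHom φ hφ _) = μ * FormLie.three (FormLie.quotHom φ hφ _)
      rw [three_quotHom_apply (hX := hX) hφ hθ, three_quotHom (hX := hX), h]
      simp only [tri, Pi.smul_apply, smul_eq_mul, Finset.mul_sum]
      exact Finset.sum_congr rfl fun p _ => by ring
  · change FormLie.three (FormLie.quotHom φ hφ _) ≠ 0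
    rw [three_quotHom (hX := hX), algebraMap_coord_vertex, algebraMap_coord_vertex,
      algebraMap_coord_vertex, tri_single]
    exact mul_ne_zero two_ne_zero hijk

theorem graphHom_eq_zero_iff {c : S × S × S → ℚ} (hc : ∑ p, c p • ⁅GraphLie.vertex G p.1,
      ⁅GraphLie.vertex G p.2.1, GraphLie.vertex G p.2.2⁆⁆ = X) (φ : forms G K) :
    FormLie.graphHom φ X = 0 ↔ evalForm K c φ.1 = 0 := by
  rw [← hc, graphHom_eq]
  constructor
  · intro h
    have : (2 : K) * evalForm K c φ.1 = 0 := congrArg FormLie.three h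
    simpa using this
  · intro h
    rw [h, mul_zero]
    rfl

/-- The kernel of the evaluation at `X` is invariant. -/
theorem evalForm_act_eq_zero (hθ : ∀ x y, θ ⁅x, y⁆ = ⁅θ x, θ y⁆) {c : S × S × S → ℚ}
    (hc : ∑ p, c p • ⁅GraphLie.vertex G p.1,
      ⁅GraphLie.vertex G p.2.1, GraphLie.vertex G p.2.2⁆⁆ = X) {φ : S → S → S → K}
    (hφ : φ ∈ forms G K) (h : evalForm K c φ = 0) :
    evalForm K c (act ((vertexMatrix hX θ).map (algebraMap ℚ K)) φ) = 0 := by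
  have hφX := (graphHom_eq_zero_iff hc ⟨φ, hφ⟩).2 h
  -- The relation `X = 0` in `ℳ`. Applying `θ` and then the homomorphism given by `φ` turns it into
  -- twice the evaluation of the pulled-back form.
  have h1 : ∑ p, c p • ⁅quotVertex G X p.1, ⁅quotVertex G X p.2.1, quotVertex G X p.2.2⁆⁆ = 0 := by
    have := congrArg (toQuot G X) hc
    rw [toQuot_self, map_sum] at this
    simp only [map_smul, LieHom.map_lie] at this
    exact this
  have h2 := congrArg (fun x => FormLie.threeₗ ⟨φ, hφ⟩ (FormLie.quotHom ⟨φ, hφ⟩ hφX (θ x))) h1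
  simp only [map_sum, map_smul, map_zero] at h2
  have h3 : (2 : K) * evalForm K c (act ((vertexMatrix hX θ).map (algebraMap ℚ K)) φ) = 0 := by
    rw [← h2]
    simp only [evalForm, LinearMap.coe_mk, AddHom.coe_mk, Finset.mul_sum]
    refine Finset.sum_congr rfl fun p _ => ?_
    change _ = c p • FormLie.three _
    rw [three_quotHom_apply (hX := hX) hφX hθ, algebraMap_coord_vertex, algebraMap_coord_vertex,
      algebraMap_coord_vertex, tri_single, Algebra.smul_def]
    ring
  simpa using h3

/-- A functional on `𝒬` that is nonzero at `X`, evaluated on triple brackets of vertices, is a form.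
-/
theorem exists_form_evalForm_ne_zero (hX0 : X ≠ 0) {c : S × S × S → ℚ}
    (hc : ∑ p, c p • ⁅GraphLie.vertex G p.1,
      ⁅GraphLie.vertex G p.2.1, GraphLie.vertex G p.2.2⁆⁆ = X) :
    ∃ φ ∈ forms G ℚ, evalForm ℚ c φ ≠ 0 := by
  obtain ⟨f, hf⟩ : ∃ f : Module.Dual ℚ (GraphLie G), f X ≠ 0 := by
    by_contra! h
    exact hX0 ((Module.forall_dual_apply_eq_zero_iff ℚ X).1 h)
  let v := GraphLie.vertex G
  refine ⟨fun α β γ => f ⁅v α, ⁅v β, v γ⁆⁆, ⟨?_, ?_, ?_⟩, ?_⟩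
  · intro α β γ
    change f _ = -f _
    rw [← lie_skew (v β), lie_neg, map_neg]
  · intro α β γ
    change f _ + f _ + f _ = 0
    rw [← map_add, ← map_add, lie_jacobi, map_zero]
  · intro α β γ h
    have : ⁅v β, v γ⁆ = 0 :=
      (LieSubmodule.Quotient.mk_eq_zero' (N := nonEdgeIdeal G)
        (m := ⁅FreeThreeStep.of β, FreeThreeStep.of γ⁆)).2
        (LieSubmodule.subset_lieSpan ⟨β, γ, h, rfl⟩)
    simp only [this, lie_zero, map_zero]
  · have : evalForm ℚ c (fun α β γ => f ⁅v α, ⁅v β, v γ⁆⁆) = f X := by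
      rw [← hc, map_sum]
      simp [evalForm, v]
    rwa [this]

end Automorphism

/-! ### Nonexistence of hyperbolic automorphisms -/

section Core

open Polynomial

/-- A graph automorphism preserving the vertices of an induced path of length two, or an edge
counted with multiplicity, fixes the centre. -/
theorem perm_center_eq {S : Type*} {G : SimpleGraph S} {π : Equiv.Perm S}
    (hπ : ∀ i j, G.Adj i j → G.Adj (π i) (π j)) {i j k : S} (hi : G.Adj j i) (hk : G.Adj j k)
    (hik : ¬ G.Adj i k) (h : ({π i, π j, π k} : Multiset S) = {i, j, k}) : π j = j := by
  classical
  have h1 : π j ∈ ({i, j, k} : Multiset S) := by rw [← h]; simp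
  have hpi := hπ _ _ hi
  have hpk := hπ _ _ hk
  by_cases hc : i = k
  · subst hc
    have h2 : π j = i ∨ π j = j := by
      simp only [Multiset.insert_eq_cons, Multiset.mem_cons, Multiset.mem_singleton] at h1
      tauto
    refine h2.resolve_left fun h3 => ?_
    -- If the centre moved to `i`, then `i` would occur once on the left but twice on the right.
    have := congrArg (Multiset.count i) h
    rw [h3] at hpi this
    simp [Multiset.insert_eq_cons, hi.ne.symm,
      hpi.ne] at this
  · have hi' : i ∈ ({π i, π j, π k} : Multiset S) := by rw [h]; simp
    have hk' : k ∈ ({π i, π j, π k} : Multiset S) := by rw [h]; simp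
    simp only [Multiset.insert_eq_cons, Multiset.mem_cons, Multiset.mem_singleton] at h1 hi' hk'
    rcases h1 with h1 | h1 | h1
    -- If the centre moved to the end `i`, the images of both ends would be adjacent to `i`. But one
    -- of them is `k`, which is not.
    · exfalso
      rw [h1] at hpi hpk hk'
      rcases hk' with h2 | h2 | h2
      · exact hik (h2 ▸ hpi)
      · exact hc h2.symm
      · exact hik (h2 ▸ hpk)
    · exact h1
    · exfalso
      rw [h1] at hpi hpk hi'
      rcases hi' with h2 | h2 | h2
      · exact hik (h2 ▸ hpi.symm)
      · exact hc h2
      · exact hik (h2 ▸ hpk.symm)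

variable {S : Type*} [Fintype S] [DecidableEq S] {G : SimpleGraph S} {X : GraphLie G}

/-- The heart of the matter, for endomorphisms triangular with respect to domination. -/
theorem false_of_hyperbolic_triangular (hX : X ∈ degreeThree G) (hX0 : X ≠ 0)
    {θ : QuotLie G X →ₗ[ℚ] QuotLie G X} (hθ : ∀ x y, θ ⁅x, y⁆ = ⁅θ x, θ y⁆)
    (hA : ∀ β γ, vertexMatrix hX θ β γ ≠ 0 → Dom G β γ) {K : Type*} [Field K] [Algebra ℚ K]
    [IsAlgClosed K] [IsGalois ℚ K] (ι : K →+* ℂ)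
    (hyp : ∀ μ : K, aeval μ θ.charpoly = 0 → ‖ι μ‖ ≠ 1)
    (hunit : ∀ μ : K, aeval μ (vertexMatrix hX θ).charpoly = 0 → IsIntegralUnit μ) : False := by
  have : CharZero K := algebraRat.charZero K
  set A := vertexMatrix hX θ with hAdef
  let AK := A.map (algebraMap ℚ K)
  have hAr : Respects G A := respects_of_dom hA
  have hAKr : Respects G AK := hAr.map (algebraMap ℚ K)
  obtain ⟨P, Q, A', h, hPQ, hAP, hP, hQ, hA', hh, htri, hgal⟩ :=
    exists_triangular_form (K := K) hA
  have hQP : Q * P = 1 := mul_eq_one_comm.1 hPQ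
  have hQA : Q * AK = A' * Q := by
    calc Q * AK = Q * (AK * P) * Q := by
          rw [Matrix.mul_assoc, Matrix.mul_assoc AK, hPQ, Matrix.mul_one]
      _ = A' * Q := by rw [hAP, ← Matrix.mul_assoc, hQP, Matrix.one_mul]
  have hPr := respects_of_dom hP
  have hQr := respects_of_dom hQ
  have hA'r := respects_of_dom hA'
  obtain ⟨c, hc⟩ := exists_coefficients hX
  obtain ⟨φq, hφq, hφq0⟩ := exists_form_evalForm_ne_zero hX0 hc
  let φ₀ : S → S → S → K := fun a b d => algebraMap ℚ K (φq a b d)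
  have hφ₀ : φ₀ ∈ forms G K := map_mem_forms (algebraMap ℚ K) hφq
  have heval : ∀ ψ : S → S → S → ℚ, evalForm K c (fun a b d => algebraMap ℚ K (ψ a b d)) =
      algebraMap ℚ K (evalForm ℚ c ψ) := by
    intro ψ
    simp [evalForm]
  have hact₀ : act AK φ₀ = fun a b d => algebraMap ℚ K (act A φq a b d) := by
    ext a b d
    simp [act_apply, AK, φ₀]
  let e₀ := evalForm ℚ c φq
  -- Computing the eigenvalue on the rational form `φq` shows that it is rational.
  let lq : ℚ := evalForm ℚ c (act A φq) / e₀
  let lam : K := algebraMap ℚ K lq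
  have he₀ : evalForm K c φ₀ = algebraMap ℚ K e₀ := heval φq
  have he₀0 : evalForm K c φ₀ ≠ 0 := by
    rw [he₀]; simpa using hφq0
  have hlam₀ : evalForm K c (act AK φ₀) = lam * evalForm K c φ₀ := by
    rw [hact₀, heval, he₀, ← map_mul, div_mul_cancel₀ _ hφq0]
  -- Every form is a multiple of `φ₀` plus a form in the invariant kernel of the evaluation.
  have hlam : ∀ φ ∈ forms G K, evalForm K c (act AK φ) = lam * evalForm K c φ := by
    intro φ hφ
    set t := evalForm K c φ / evalForm K c φ₀ with ht
    have h1 : evalForm K c (φ - t • φ₀) = 0 := by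
      rw [map_sub, map_smul, smul_eq_mul, ht, div_mul_cancel₀ _ he₀0, sub_self]
    have h2 := evalForm_act_eq_zero (hX := hX) hθ hc
      (Submodule.sub_mem _ hφ (Submodule.smul_mem _ t hφ₀)) h1
    change evalForm K c (act AK _) = 0 at h2
    rw [map_sub, map_sub, map_smul, map_smul, hlam₀, smul_eq_mul] at h2
    rw [map_sub, map_smul, smul_eq_mul] at h1
    linear_combination h2 - lam * h1
  have hcomm : ∀ φ, act AK (act Q φ) = act Q (act A' φ) := by
    intro φ
    rw [← act_mul, ← act_mul, hQA]
  obtain ⟨i, j, k, hi, hk, hl, heig⟩ := exists_path_eigenvalue (ε := evalForm K c ∘ₗ act Q)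
    (lam := lam) hh hA'r htri (by
      intro φ hφ
      simp only [LinearMap.comp_apply]
      rw [← hcomm, hlam _ (act_mem_forms hQr hφ)])
    ⟨act P φ₀, act_mem_forms hPr hφ₀, by
      rw [LinearMap.comp_apply, ← act_mul, hPQ, act_one]; exact he₀0⟩
  -- The eigenforms of `A'` are carried by `Q` to eigenforms of `AK` killed by evaluation at `X`, so
  -- their eigenvalues occur on `ℳ`.
  have heig' : ∀ a b d, G.Adj b a → G.Adj b d →
      (({a, b, d} : Multiset S) ≠ {i, j, k} ∨ G.Adj a d) →
      ‖ι (A' a a * A' b b * A' d d)‖ ≠ 1 := by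
    intro a b d hba hbd hd
    obtain ⟨φ, hφ, hφ0, hφε, hφe⟩ := heig a b d hba hbd hd
    apply hyp
    have hQφ := act_mem_forms hQr hφ
    refine aeval_charpoly_of_form (hX := hX) (φ := ⟨act Q φ, hQφ⟩) hθ
      ((graphHom_eq_zero_iff hc _).2 hφε) ?_ ?_
    · intro h0
      have h1 : act Q φ = 0 := congrArg Subtype.val h0
      have h2 := congrArg (act P) h1
      rw [← act_mul, hQP, act_one, map_zero] at h2
      exact hφ0 h2
    · change act AK (act Q φ) = _
      rw [hcomm, hφe, map_smul]
  have hroot : ∀ i, aeval (A' i i) A.charpoly = 0 := by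
    intro i
    have h1 : AK.charpoly = A'.charpoly := by
      have h2 : AK = P * (A' * Q) := by
        rw [← hQA, ← Matrix.mul_assoc, hPQ, Matrix.one_mul]
      rw [h2, Matrix.charpoly_mul_comm, Matrix.mul_assoc, hQP, Matrix.mul_one]
    rw [← Polynomial.eval_map_algebraMap, ← Matrix.charpoly_map]
    change eval _ AK.charpoly = 0
    rw [h1, charpoly_of_triangular hh htri, Polynomial.eval_prod]
    exact Finset.prod_eq_zero (Finset.mem_univ i) (by simp)
  have hlu : IsIntegralUnit lam := by
    rw [hl]
    exact ((hunit _ (hroot i)).mul (hunit _ (hroot j))).mul (hunit _ (hroot k))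
  have hl1 : ‖ι lam‖ = 1 := hlu.norm_eq_one ι
  have hik : ¬ G.Adj i k := fun hik => heig' i j k hi hk (Or.inr hik) (hl ▸ hl1)
  have hfix : ∀ σ : Gal(K/ℚ), σ (A' j j) = A' j j := by
    intro σ
    obtain ⟨π, hπ, hπσ⟩ := hgal σ
    have h1 : A' (π i) (π i) * A' (π j) (π j) * A' (π k) (π k) = lam := by
      rw [hπσ, hπσ, hπσ, ← map_mul, ← map_mul, ← hl]
      exact σ.commutes lq
    -- The image path has the same product `lam`, of modulus one. With another vertex multiset this
    -- would be an eigenvalue on `ℳ`.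
    have h2 : ({π i, π j, π k} : Multiset S) = {i, j, k} := by
      by_contra hne
      exact heig' _ _ _ (hπ _ _ hi) (hπ _ _ hk) (Or.inl hne) (h1 ▸ hl1)
    rw [← hπσ, perm_center_eq hπ hi hk hik h2]
  obtain ⟨q, hq⟩ := (InfiniteGalois.mem_range_algebraMap_iff_fixed (A' j j)).2 hfix
  refine hyp (A' j j) (aeval_charpoly_of_vertexMatrix (hX := hX) hθ (hroot j)) ?_
  have := hunit _ (hroot j)
  rw [← hq] at this ⊢
  exact this.norm_eq_one ι

/-- There is no hyperbolic surjective endomorphism of `ℳ` all of whose eigenvalues on the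
abelianization are units. -/
theorem false_of_hyperbolic (hX : X ∈ degreeThree G) (hX0 : X ≠ 0)
    {θ : QuotLie G X →ₗ[ℚ] QuotLie G X} (hθ : ∀ x y, θ ⁅x, y⁆ = ⁅θ x, θ y⁆)
    (hs : Function.Surjective θ) {K : Type*} [Field K] [Algebra ℚ K]
    [IsAlgClosed K] [IsGalois ℚ K] (ι : K →+* ℂ)
    (hyp : ∀ μ : K, aeval μ θ.charpoly = 0 → ‖ι μ‖ ≠ 1)
    (hunit : ∀ μ : K, aeval μ (vertexMatrix hX θ).charpoly = 0 → IsIntegralUnit μ) : False := by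
  set A := vertexMatrix hX θ with hA
  have hinj : Function.Injective A.mulVec :=
    LinearMap.injective_iff_surjective (f := A.mulVecLin).2 (vertexMatrix_surjective hθ hs)
  obtain ⟨m, hm, hdom⟩ := (vertexMatrix_respects (hX := hX) hθ).exists_pow_dom hinj
  refine false_of_hyperbolic_triangular hX hX0 (θ := θ ^ m) (pow_map_lie hθ m) ?_ ι ?_ ?_
  · rwa [vertexMatrix_pow hθ]
  · intro μ hμ h1
    obtain ⟨ν, hν, rfl⟩ := exists_root_charpoly_of_pow hm hμ
    refine hyp ν hν ?_
    rw [map_pow, norm_pow] at h1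
    exact (pow_eq_one_iff_of_nonneg (norm_nonneg _) hm.ne').1 h1
  · intro μ hμ
    rw [vertexMatrix_pow hθ, ← Matrix.charpoly_toLin', Matrix.toLin'_pow] at hμ
    obtain ⟨ν, hν, rfl⟩ := exists_root_charpoly_of_pow hm hμ
    rw [Matrix.charpoly_toLin'] at hν
    exact (hunit ν hν).pow m

theorem false_of_isHyperbolic (hX : X ∈ degreeThree G) (hX0 : X ≠ 0)
    {θ : QuotLie G X →ₗ[ℚ] QuotLie G X} (hθ : ∀ x y, θ ⁅x, y⁆ = ⁅θ x, θ y⁆)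
    (hs : Function.Surjective θ) (hyp : IsHyperbolic θ)
    (hunit : ∀ μ : AlgebraicClosure ℚ, aeval μ (vertexMatrix hX θ).charpoly = 0 →
      IsIntegralUnit μ) : False := by
  have : Algebra.IsAlgebraic ℚ (AlgebraicClosure ℚ) := AlgebraicClosure.isAlgebraic ℚ
  have : IsAlgClosure ℚ (AlgebraicClosure ℚ) := ⟨inferInstance, inferInstance⟩
  have : Normal ℚ (AlgebraicClosure ℚ) := IsAlgClosure.normal ℚ _
  have : IsGalois ℚ (AlgebraicClosure ℚ) := ⟨⟩
  let ι : AlgebraicClosure ℚ →ₐ[ℚ] ℂ := IsAlgClosed.lift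
  refine false_of_hyperbolic hX hX0 hθ hs (ι : AlgebraicClosure ℚ →+* ℂ) (fun μ hμ => ?_) hunit
  refine hyp (ι μ) ?_
  rw [Polynomial.aeval_algHom_apply, hμ, map_zero]

/-- Writing `p = X * q + u` with `u` a unit exhibits the inverse of `μ` as `-q(μ) * u⁻¹`, which is
integral. -/
theorem isIntegralUnit_of_root {K : Type*} [Field K] [Algebra ℚ K] {p : ℤ[X]} (hp : p.Monic)
    (h0 : IsUnit (p.coeff 0)) {μ : K} (hμ : aeval μ p = 0) : IsIntegralUnit μ := by
  refine ⟨⟨p, hp, by rwa [← aeval_def]⟩, ?_⟩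
  obtain ⟨u, hu⟩ := h0
  have h1 : p = X * p.divX + C (p.coeff 0) := (X_mul_divX_add p).symm
  rw [h1, ← hu, map_add, map_mul, aeval_X, aeval_C] at hμ
  have hi : IsIntegral ℤ μ := ⟨p, hp, by rw [← aeval_def, h1, ← hu]; simpa using hμ⟩
  have hq : IsIntegral ℤ (aeval μ p.divX) := by
    exact (Algebra.adjoin_le (S := integralClosure ℤ K) (Set.singleton_subset_iff.2 hi))
      (aeval_mem_adjoin_singleton ℤ μ)
  refine ⟨-(aeval μ p.divX) * algebraMap ℤ K ↑u⁻¹, hq.neg.mul isIntegral_algebraMap, ?_⟩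
  have h2 : algebraMap ℤ K ↑u * algebraMap ℤ K ↑u⁻¹ = 1 := by
    rw [← map_mul, Units.mul_inv, map_one]
  linear_combination (-(algebraMap ℤ K ↑u⁻¹)) * hμ + h2

theorem not_exists_hyperbolic_automorphism (hX : X ∈ degreeThree G) (hX0 : X ≠ 0) :
    ¬ ∃ θ : QuotLie G X ≃ₗ⁅ℚ⁆ QuotLie G X,
      IsHyperbolic (θ : QuotLie G X →ₗ[ℚ] QuotLie G X) ∧
      HasIntegralUnitCharpoly (θ : QuotLie G X →ₗ[ℚ] QuotLie G X) := by
  rintro ⟨θ, hyp, p, hp, hu⟩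
  have hθ : ∀ x y, (θ : QuotLie G X →ₗ[ℚ] QuotLie G X) ⁅x, y⁆ =
      ⁅(θ : QuotLie G X →ₗ[ℚ] QuotLie G X) x, (θ : QuotLie G X →ₗ[ℚ] QuotLie G X) y⁆ :=
    fun x y => LieHom.map_lie (θ : QuotLie G X →ₗ⁅ℚ⁆ QuotLie G X) x y
  refine false_of_isHyperbolic hX hX0 hθ θ.surjective hyp (fun μ hμ => ?_)
  have h1 := aeval_charpoly_of_vertexMatrix hθ hμ
  have hm : p.Monic := by
    have := LinearMap.charpoly_monic (θ : QuotLie G X →ₗ[ℚ] QuotLie G X)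
    rw [hp] at this
    exact Polynomial.monic_of_injective (RingHom.injective_int _) this
  refine isIntegralUnit_of_root hm hu ?_
  rw [hp] at h1
  have : aeval μ (p.map (algebraMap ℤ ℚ)) = 0 := h1
  rwa [Polynomial.aeval_map_algebraMap] at this

end Core

/-! ### Cocompact discrete subgroups of connected groups -/

section FiniteGeneration

open scoped Pointwise

variable {N : Type*} [Group N] [TopologicalSpace N] [IsTopologicalGroup N]

/-- The quotient map is open, so the images of finitely many relatively compact open sets cover the
compact quotient. -/
theorem exists_isOpen_mul_eq_univ [LocallyCompactSpace N] (Γ : Subgroup N)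
    [CompactSpace (Quotient (QuotientGroup.rightRel Γ))] :
    ∃ U C : Set N, IsOpen U ∧ IsCompact C ∧ U ⊆ C ∧ ∀ x, ∃ γ ∈ Γ, ∃ u ∈ U, γ * u = x := by
  have hopen : IsOpenMap (Quotient.mk (QuotientGroup.rightRel Γ)) :=
    isOpenMap_quotient_mk'_mul (Γ := Γ) (T := N)
  choose K hK hKn using fun x : N => exists_compact_mem_nhds x
  obtain ⟨t, ht⟩ := CompactSpace.elim_nhds_subcover
    (fun q : Quotient (QuotientGroup.rightRel Γ) =>
      Quotient.mk (QuotientGroup.rightRel Γ) '' interior (K q.out)) (fun q => by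
        refine (hopen _ isOpen_interior).mem_nhds ⟨q.out, ?_, Quotient.out_eq q⟩
        exact mem_interior_iff_mem_nhds.2 (hKn _))
  refine ⟨⋃ q ∈ t, interior (K q.out), ⋃ q ∈ t, K q.out,
    isOpen_biUnion fun _ _ => isOpen_interior, t.isCompact_biUnion fun _ _ => hK _,
    Set.iUnion₂_mono fun _ _ => interior_subset, fun x => ?_⟩
  have hx : Quotient.mk (QuotientGroup.rightRel Γ) x ∈ (⊤ : Set _) := trivial
  rw [← ht] at hx
  simp only [Set.mem_iUnion] at hx
  obtain ⟨q, hq, u, hu, hux⟩ := hx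
  refine ⟨x * u⁻¹, QuotientGroup.rightRel_apply.1 (Quotient.exact hux), u, ?_, by simp⟩
  simp only [Set.mem_iUnion]
  exact ⟨q, hq, hu⟩

/-- A discrete cocompact subgroup of a connected locally compact group is finitely generated. -/
theorem fg_of_cocompact [LocallyCompactSpace N] [T2Space N] [PreconnectedSpace N] (Γ : Subgroup N)
    [DiscreteTopology Γ] [CompactSpace (Quotient (QuotientGroup.rightRel Γ))] : Γ.FG := by
  obtain ⟨U, C, hU, hC, hUC, hcov⟩ := exists_isOpen_mul_eq_univ Γ
  let F : Set N := {γ | γ ∈ Γ ∧ ∃ u ∈ U, γ * u ∈ U}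
  have hF : F.Finite := by
    have h1 : (Γ : Set N) ∩ (C * C⁻¹) |>.Finite := by
      have hcl : IsClosed (Γ : Set N) := Subgroup.isClosed_of_discrete
      have hd : IsDiscrete (Γ : Set N) := ⟨inferInstance⟩
      exact ((hC.mul hC.inv).inter_left hcl).finite (hd.mono Set.inter_subset_left)
    refine h1.subset ?_
    rintro γ ⟨hγ, u, hu, hγu⟩
    exact ⟨hγ, Set.mem_mul.2 ⟨γ * u, hUC hγu, u⁻¹, Set.inv_mem_inv.2 (hUC hu), by simp⟩⟩
  have hFle : Subgroup.closure F ≤ Γ := (Subgroup.closure_le _).2 fun γ hγ => hγ.1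
  -- If the translates `γU` and `δU` meet, then `δ⁻¹γ` lies in `F`. So the translates by `closure F`
  -- and by the rest of `Γ` form disjoint open sets, and connectedness leaves only the first.
  have key : ∀ γ ∈ Γ, ∀ δ ∈ Subgroup.closure F, ∀ u ∈ U, ∀ v ∈ U, γ * u = δ * v →
      γ ∈ Subgroup.closure F := by
    intro γ hγ δ hδ u hu v hv h
    have h1 : δ⁻¹ * γ ∈ F := by
      refine ⟨Γ.mul_mem (Γ.inv_mem (hFle hδ)) hγ, u, hu, ?_⟩
      rw [mul_assoc, h, inv_mul_cancel_left]
      exact hv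
    have := (Subgroup.closure F).mul_mem hδ (Subgroup.subset_closure h1)
    rwa [mul_inv_cancel_left] at this
  let A : Set N := ⋃ γ ∈ Subgroup.closure F, γ • U
  let B : Set N := ⋃ γ ∈ (Γ : Set N) \ Subgroup.closure F, γ • U
  have hA : IsOpen A := isOpen_biUnion fun γ _ => hU.smul γ
  have hB : IsOpen B := isOpen_biUnion fun γ _ => hU.smul γ
  have hmemA : ∀ x, x ∈ A ↔ ∃ γ ∈ Subgroup.closure F, ∃ u ∈ U, γ * u = x := by
    intro x; simp [A, Set.mem_smul_set]
  have hmemB : ∀ x, x ∈ B ↔ ∃ γ ∈ Γ, γ ∉ Subgroup.closure F ∧ ∃ u ∈ U, γ * u = x := by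
    intro x
    simp only [B, Set.mem_iUnion, Set.mem_smul_set, Set.mem_sdiff, SetLike.mem_coe, smul_eq_mul,
      exists_prop, and_assoc]
  have hAB : Aᶜ = B := by
    ext x
    rw [Set.mem_compl_iff, hmemA, hmemB]
    constructor
    · intro h
      obtain ⟨γ, hγ, u, hu, rfl⟩ := hcov x
      exact ⟨γ, hγ, fun h' => h ⟨γ, h', u, hu, rfl⟩, u, hu, rfl⟩
    · rintro ⟨γ, hγ, hγ', u, hu, rfl⟩ ⟨δ, hδ, v, hv, h⟩
      exact hγ' (key γ hγ δ hδ u hu v hv h.symm)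
  have hclopen : IsClopen A := ⟨⟨hAB ▸ hB⟩, hA⟩
  obtain ⟨γ₀, hγ₀, u, hu, -⟩ := hcov 1
  have hAu : A = Set.univ := hclopen.eq_univ ⟨u, (hmemA u).2 ⟨1, Subgroup.one_mem _, u, hu, one_mul u⟩⟩
  have hΓ : Subgroup.closure F = Γ := by
    refine le_antisymm hFle fun γ hγ => ?_
    have h1 : γ * u ∈ A := hAu ▸ Set.mem_univ _
    obtain ⟨δ, hδ, v, hv, h⟩ := (hmemA _).1 h1
    exact key γ hγ δ hδ u hu v hv h.symm
  exact (Subgroup.fg_iff _).2 ⟨F, hΓ, hF⟩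

end FiniteGeneration

/-! ### The simply connected nilpotent Lie group -/

namespace NilGroup

section Topological

variable {L : Type*} [LieRing L] [LieAlgebra ℝ L]

theorem isInducing_log [TopologicalSpace L] [IsModuleTopology ℝ L] :
    Topology.IsInducing (log : NilGroup L → L) :=
  ⟨by rw [eq_moduleTopology ℝ L]; rfl⟩

/-- The logarithm as a homeomorphism. -/
def logHomeomorph [TopologicalSpace L] [IsModuleTopology ℝ L] : NilGroup L ≃ₜ L :=
  Equiv.toHomeomorphOfIsInducing ⟨log, exp, fun _ => rfl, fun _ => rfl⟩ isInducing_log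

variable [Module.Finite ℝ L] [TopologicalSpace L] [IsModuleTopology ℝ L]

theorem continuous_lie : Continuous fun p : L × L => ⁅p.1, p.2⁆ :=
  IsModuleTopology.continuous_bilinear_of_finite_left
    (LieModule.toEnd ℝ L L : L →ₗ[ℝ] L →ₗ[ℝ] L)

theorem continuous_bch : Continuous fun p : L × L => bch p.1 p.2 := by
  have : ContinuousAdd L := IsModuleTopology.toContinuousAdd ℝ L
  have h : ∀ {f g : L × L → L}, Continuous f → Continuous g → Continuous fun p => ⁅f p, g p⁆ :=
    fun hf hg => continuous_lie.comp (hf.prodMk hg)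
  have h1 := h continuous_fst (h continuous_fst continuous_snd)
  have h2 := h continuous_snd (h continuous_snd continuous_fst)
  exact ((continuous_fst.add continuous_snd).add ((h continuous_fst continuous_snd).const_smul _)).add
    ((h1.add h2).const_smul _)

theorem exists_homeomorph_pi (L : Type*) [AddCommGroup L] [Module ℝ L] [Module.Finite ℝ L]
    [TopologicalSpace L] [IsModuleTopology ℝ L] : ∃ n, Nonempty (L ≃ₜ (Fin n → ℝ)) := by
  refine ⟨Module.finrank ℝ L, ⟨?_⟩⟩
  let e : L ≃ₗ[ℝ] (Fin (Module.finrank ℝ L) → ℝ) := (Module.finBasis ℝ L).equivFun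
  have : ContinuousAdd L := IsModuleTopology.toContinuousAdd ℝ L
  have h1 : Continuous e := IsModuleTopology.continuous_of_linearMap e.toLinearMap
  have h2 : Continuous e.symm := IsModuleTopology.continuous_of_linearMap e.symm.toLinearMap
  exact
    { e.toEquiv with
      continuous_toFun := h1
      continuous_invFun := h2 }

end Topological

section Instances

variable {L : Type*} [LieRing L] [LieAlgebra ℝ L] [Module.Finite ℝ L]

theorem exists_homeomorph : ∃ n, Nonempty (NilGroup L ≃ₜ (Fin n → ℝ)) := by
  let _ : TopologicalSpace L := moduleTopology ℝ L
  have : IsModuleTopology ℝ L := ⟨rfl⟩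
  obtain ⟨n, ⟨e⟩⟩ := exists_homeomorph_pi L
  exact ⟨n, ⟨logHomeomorph.trans e⟩⟩

instance : T2Space (NilGroup L) := by
  obtain ⟨n, ⟨e⟩⟩ := exists_homeomorph (L := L)
  exact e.symm.t2Space

instance : LocallyCompactSpace (NilGroup L) := by
  obtain ⟨n, ⟨e⟩⟩ := exists_homeomorph (L := L)
  exact e.isClosedEmbedding.locallyCompactSpace

instance : PreconnectedSpace (NilGroup L) := by
  obtain ⟨n, ⟨e⟩⟩ := exists_homeomorph (L := L)
  exact ⟨by
    rw [← e.symm.surjective.range_eq]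
    exact isPreconnected_range e.symm.continuous⟩

instance [IsThreeStep L] : IsTopologicalGroup (NilGroup L) := by
  let _ : TopologicalSpace L := moduleTopology ℝ L
  have : IsModuleTopology ℝ L := ⟨rfl⟩
  have hlog : Continuous (log : NilGroup L → L) := isInducing_log.continuous
  refine { continuous_mul := ?_, continuous_inv := ?_ }
  · rw [isInducing_log.continuous_iff]
    exact continuous_bch.comp ((hlog.comp continuous_fst).prodMk (hlog.comp continuous_snd))
  · rw [isInducing_log.continuous_iff]
    exact (IsModuleTopology.continuous_neg ℝ L).comp hlog

end Instances

/-! ### Automorphisms in exponential coordinates -/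

section Differential

variable {L : Type*} [LieRing L] [LieAlgebra ℝ L]

theorem log_mul [IsThreeStep L] (a b : NilGroup L) : (a * b).log = bch a.log b.log := rfl

theorem exp_nsmul [IsThreeStep L] (x : L) (n : ℕ) : exp (n • x) = exp x ^ n := by
  induction n with
  | zero => rw [zero_smul, pow_zero]; rfl
  | succ n ih =>
    rw [pow_succ, ← ih]
    refine NilGroup.ext ?_
    simp [log_mul, bch, add_smul]

theorem log_pow [IsThreeStep L] (a : NilGroup L) (n : ℕ) : (a ^ n).log = n • a.log :=
  congrArg log (exp_nsmul a.log n).symm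

theorem isModuleTopology_of_normedSpace (E : Type*) [NormedAddCommGroup E] [NormedSpace ℝ E]
    [FiniteDimensional ℝ E] : IsModuleTopology ℝ E :=
  isModuleTopologyOfFiniteDimensional

/-- The derivative refers to the module topology alone. A norm pulled back from coordinates induces
the same topology and makes the slope characterization available. -/
theorem tendsto_of_hasDerivAt {E : Type*} [AddCommGroup E] [Module ℝ E] [Module.Finite ℝ E]
    [TopologicalSpace E] [IsModuleTopology ℝ E] {f : ℝ → E} {v : E} (hf0 : f 0 = 0)
    (h : HasDerivAt f v 0) : Filter.Tendsto (fun t : ℝ => t⁻¹ • f t) (𝓝[≠] 0) (𝓝 v) := by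
  rename_i τ hτ
  let e : E ≃ₗ[ℝ] (Fin (Module.finrank ℝ E) → ℝ) := (Module.finBasis ℝ E).equivFun
  let i1 : NormedAddCommGroup E := NormedAddCommGroup.induced E _ e e.injective
  let i2 : NormedSpace ℝ E := NormedSpace.induced ℝ E _ e
  have htop : i1.toPseudoMetricSpace.toUniformSpace.toTopologicalSpace = τ := by
    exact (@isModuleTopology_of_normedSpace E i1 i2 ‹_›).1.trans hτ.1.symm
  subst htop
  have h1 := @HasDerivAt.tendsto_slope_zero ℝ _ E i1 i2 f v 0 h
  simpa [hf0] using h1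

variable [IsThreeStep L]

/-- A continuous automorphism is linear in exponential coordinates. -/
theorem log_eq_of_isDifferential [Module.Finite ℝ L] {τ : NilGroup L →* NilGroup L} {D : L →ₗ[ℝ] L}
    (h : IsDifferential τ D) (v : L) : (τ (exp v)).log = D v := by
  let _ : TopologicalSpace L := moduleTopology ℝ L
  have : IsModuleTopology ℝ L := ⟨rfl⟩
  obtain ⟨n, ⟨e⟩⟩ := exists_homeomorph_pi L
  have : T2Space L := e.symm.t2Space
  have h0 : (τ (exp ((0 : ℝ) • v))).log = 0 := by
    rw [zero_smul]
    exact congrArg log (map_one τ)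
  have h1 := tendsto_of_hasDerivAt h0 (h v)
  have h2 : Filter.Tendsto (fun n : ℕ => ((n : ℝ) + 1)⁻¹) Filter.atTop (𝓝[≠] 0) := by
    refine tendsto_nhdsWithin_iff.2 ⟨?_, Filter.Eventually.of_forall fun n => ?_⟩
    · simpa using tendsto_one_div_add_atTop_nhds_zero_nat (𝕜 := ℝ)
    · exact inv_ne_zero (by positivity)
  have h3 := h1.comp h2
  refine tendsto_nhds_unique ?_ h3
  -- Since `exp v` is the `(n + 1)`-st power of `exp (v / (n + 1))`, the slope at `t = 1 / (n + 1)`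
  -- is constantly `log (τ (exp v))`.
  refine tendsto_const_nhds.congr fun n => ?_
  have hn : ((n : ℝ) + 1) ≠ 0 := by positivity
  have h4 : exp v = exp (((n : ℝ) + 1)⁻¹ • v) ^ (n + 1) := by
    rw [← exp_nsmul, ← Nat.cast_smul_eq_nsmul ℝ, smul_smul]
    push_cast
    rw [mul_inv_cancel₀ hn, one_smul]
  simp only [Function.comp_apply]
  rw [h4, map_pow, log_pow, inv_inv, ← Nat.cast_smul_eq_nsmul ℝ]
  push_cast
  rfl

theorem map_bch_of_isDifferential [Module.Finite ℝ L] {τ : NilGroup L →* NilGroup L}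
    {D : L →ₗ[ℝ] L} (h : IsDifferential τ D) (x y : L) : D (bch x y) = bch (D x) (D y) := by
  rw [← log_eq_of_isDifferential h, ← log_eq_of_isDifferential h x,
    ← log_eq_of_isDifferential h y, ← log_mul]
  exact congrArg log (map_mul τ (exp x) (exp y))

/-- Adding the identities for `(x, y)` and `(-x, -y)` cancels the terms of odd degree and leaves the
bracket. -/
theorem map_lie_of_map_bch {D : L →ₗ[ℝ] L} (h : ∀ x y, D (bch x y) = bch (D x) (D y)) (x y : L) :
    D ⁅x, y⁆ = ⁅D x, D y⁆ := by
  have h1 := h x y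
  have h2 := h (-x) (-y)
  simp only [bch, map_add, map_smul, map_neg, neg_lie, lie_neg, neg_neg] at h1 h2
  linear_combination (norm := module) h1 + h2

end Differential

end NilGroup

/-! ### Integrality of eigenvalues -/

section Integrality

open Polynomial

/-- An endomorphism of a real vector space mapping a finitely generated subgroup onto itself
satisfies there a monic integral equation with constant term a unit. -/
theorem exists_monic_aeval_eq_zero_of_fg {V : Type*} [AddCommGroup V] [Module ℝ V] (f : V →ₗ[ℝ] V)
    {Λ : AddSubgroup V} (hΛ : Λ.FG) (h : Λ.map (f : V →+ V) = Λ) :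
    ∃ p : ℤ[X], p.Monic ∧ IsUnit (p.coeff 0) ∧ ∀ x ∈ Λ, aeval f p x = 0 := by
  let N : Submodule ℤ V := AddSubgroup.toIntSubmodule Λ
  have hf : ∀ x ∈ N, f x ∈ N := by
    intro x hx
    change f x ∈ Λ
    rw [← h]
    exact ⟨x, hx, rfl⟩
  have : Module.Finite ℤ N :=
    Module.Finite.iff_fg.2 ((Submodule.fg_iff_addSubgroup_fg _).2 hΛ)
  have : Module.IsTorsionFree ℤ V := Module.IsTorsionFree.trans ℝ
  have : Module.IsTorsionFree ℤ N := inferInstance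
  have : Module.Free ℤ N := Module.free_of_finite_type_torsion_free'
  let g : N →ₗ[ℤ] N := (f.restrictScalars ℤ).restrict hf
  have hg : Function.Surjective g := by
    rintro ⟨x, hx⟩
    have hx' : x ∈ Λ.map (f : V →+ V) := by rw [h]; exact hx
    obtain ⟨y, hy, hyx⟩ := hx'
    exact ⟨⟨y, hy⟩, Subtype.ext hyx⟩
  -- A surjective endomorphism of a finitely generated module is injective, so the determinant is a
  -- unit. Up to sign it is the constant coefficient.
  have hgb : Function.Bijective g := ⟨OrzechProperty.injective_of_surjective_endomorphism g hg, hg⟩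
  have hdet : IsUnit (LinearMap.det g) := LinearEquiv.isUnit_det' (LinearEquiv.ofBijective g hgb)
  refine ⟨g.charpoly, g.charpoly_monic, ?_, fun x hx => ?_⟩
  · rw [LinearMap.det_eq_sign_charpoly_coeff] at hdet
    exact isUnit_of_mul_isUnit_right hdet
  · have key : ∀ (p : ℤ[X]) (y : N), ((aeval g p y : N) : V) = aeval f p (y : V) := by
      intro p
      induction p using Polynomial.induction_on' with
      | add p q hp hq => intro y; simp [hp, hq]
      | monomial n a =>
        intro y
        have : ∀ n : ℕ, (((g ^ n) y : N) : V) = (f ^ n) (y : V) := by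
          intro n
          induction n with
          | zero => rfl
          | succ n ih => rw [pow_succ', pow_succ', Module.End.mul_apply, Module.End.mul_apply, ← ih]; rfl
        simp [aeval_monomial, this, Module.End.mul_apply]
    have := key g.charpoly ⟨x, hx⟩
    rw [LinearMap.aeval_self_charpoly] at this
    exact this.symm

/-- By spectral mapping, `p(μ)` lies in the spectrum of `p(A) = 0`. -/
theorem aeval_eq_zero_of_charpoly {S K : Type*} [Fintype S] [DecidableEq S] [Field K] [Algebra ℚ K]
    {A : Matrix S S ℚ} {p : ℤ[X]} (hp : aeval A p = 0) {μ : K} (hμ : aeval μ A.charpoly = 0) :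
    aeval μ p = 0 := by
  let φ : Matrix S S ℚ →ₐ[ℤ] Matrix S S K := (algebraMap ℚ K).mapMatrix.toIntAlgHom
  have h1 : IsRoot (φ A).charpoly μ := by
    change eval μ (A.map (algebraMap ℚ K)).charpoly = 0
    rw [Matrix.charpoly_map, eval_map_algebraMap, hμ]
  have h2 := spectrum.subset_polynomial_aeval (φ A) (p.map (algebraMap ℤ K))
    ⟨μ, Matrix.mem_spectrum_of_isRoot_charpoly h1, rfl⟩
  have h3 : aeval (φ A) (p.map (algebraMap ℤ K)) = 0 := by
    rw [aeval_map_algebraMap, aeval_algHom_apply, hp, map_zero]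
  by_contra h4
  rw [h3, spectrum.mem_iff, sub_zero] at h2
  refine h2 ((IsUnit.mk0 _ ?_).map (algebraMap K (Matrix S S K)))
  simpa only [eval_map_algebraMap] using h4

end Integrality

/-! ### Anosov automorphisms of nilmanifolds -/

section Anosov

variable {S : Type*} [Fintype S] [DecidableEq S] {G : SimpleGraph S} {X : GraphLie G}

/-- The extension of scalars of the projection of `ℳ` to its abelianization. -/
def realCoord (hX : X ∈ degreeThree G) : ℝ ⊗[ℚ] QuotLie G X →ₗ[ℝ] (S → ℝ) :=
  LinearMap.liftBaseChange ℝ ((Algebra.linearMap ℚ ℝ).compLeft S ∘ₗ coord hX)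

variable {hX : X ∈ degreeThree G}

theorem realCoord_tmul (a : ℝ) (x : QuotLie G X) (s : S) :
    realCoord hX (a ⊗ₜ x) s = a * (coord hX x s : ℝ) := by
  simp [realCoord]

theorem realCoord_lie (x y : ℝ ⊗[ℚ] QuotLie G X) : realCoord hX ⁅x, y⁆ = 0 := by
  induction x using TensorProduct.induction_on with
  | zero => simp
  | add a b ha hb => rw [add_lie, map_add, ha, hb, add_zero]
  | tmul a x =>
  induction y using TensorProduct.induction_on with
  | zero => simp
  | add a b ha hb => rw [lie_add, map_add, ha, hb, add_zero]
  | tmul b y =>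
  ext s
  rw [LieAlgebra.ExtendScalars.bracket_tmul, realCoord_tmul, coord_lie]
  simp

theorem realCoord_surjective : Function.Surjective (realCoord hX) := by
  rw [← LinearMap.range_eq_top, eq_top_iff, ← (Pi.basisFun ℝ S).span_eq, Submodule.span_le]
  rintro _ ⟨s, rfl⟩
  refine ⟨1 ⊗ₜ quotVertex G X s, ?_⟩
  ext t
  rw [realCoord_tmul, coord_vertex]
  simp [Pi.single_apply, apply_ite]

/-- The projection of the Lie group to its abelianization. -/
def realCoordHom (hX : X ∈ degreeThree G) :
    NilGroup (ℝ ⊗[ℚ] QuotLie G X) →* Multiplicative (S → ℝ) where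
  toFun a := Multiplicative.ofAdd (realCoord hX a.log)
  map_one' := by
    change Multiplicative.ofAdd (realCoord hX 0) = 1
    rw [map_zero, ofAdd_zero]
  map_mul' a b := by
    rw [NilGroup.log_mul, ← ofAdd_add]
    simp [NilGroup.bch, realCoord_lie]

/-- The image of a subgroup in the abelianization. -/
def abelianImage (hX : X ∈ degreeThree G) (Γ : Subgroup (NilGroup (ℝ ⊗[ℚ] QuotLie G X))) :
    AddSubgroup (S → ℝ) :=
  Subgroup.toAddSubgroup' (Γ.map (realCoordHom hX))

theorem mem_abelianImage {Γ : Subgroup (NilGroup (ℝ ⊗[ℚ] QuotLie G X))} {v : S → ℝ} :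
    v ∈ abelianImage hX Γ ↔ ∃ γ ∈ Γ, realCoord hX γ.log = v := Iff.rfl

theorem abelianImage_fg {Γ : Subgroup (NilGroup (ℝ ⊗[ℚ] QuotLie G X))} (h : Γ.FG) :
    (abelianImage hX Γ).FG := by
  rw [abelianImage, AddSubgroup.fg_iff_mul_fg]
  exact (Subgroup.fg_iff_submonoid_fg _).2
    (((Subgroup.fg_iff_submonoid_fg _).1 h).map (realCoordHom hX))

theorem span_log_eq_top {M : Type*} [LieRing M] [LieAlgebra ℚ M] [IsThreeStep M]
    {Γ : Subgroup (NilGroup (ℝ ⊗[ℚ] M))} (h : NilGroup.CorrespondsTo Γ) :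
    Submodule.span ℝ (NilGroup.log '' (Γ : Set (NilGroup (ℝ ⊗[ℚ] M)))) = ⊤ := by
  set T := NilGroup.log '' (Γ : Set (NilGroup (ℝ ⊗[ℚ] M)))
  have h1 : Submodule.span ℚ T ≤ (Submodule.span ℝ T).restrictScalars ℚ :=
    Submodule.span_le.2 Submodule.subset_span
  rw [eq_top_iff]
  intro x _
  induction x using TensorProduct.induction_on with
  | zero => exact Submodule.zero_mem _
  | add a b ha hb => exact Submodule.add_mem _ (ha trivial) (hb trivial)
  | tmul a x =>
    have h2 : (1 : ℝ) ⊗ₜ[ℚ] x ∈ Submodule.span ℚ T := by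
      rw [h]; exact ⟨x, rfl⟩
    have h3 := Submodule.smul_mem (Submodule.span ℝ T) a (h1 h2)
    rwa [TensorProduct.smul_tmul', smul_eq_mul, mul_one] at h3

/-- An automorphism preserving a lattice corresponding to `M` is defined over `ℚ`. -/
theorem exists_rational_form {M : Type*} [LieRing M] [LieAlgebra ℚ M] [IsThreeStep M]
    {Γ : Subgroup (NilGroup (ℝ ⊗[ℚ] M))} (h : NilGroup.CorrespondsTo Γ)
    {D : ℝ ⊗[ℚ] M →ₗ[ℝ] ℝ ⊗[ℚ] M}
    (hD : D '' (NilGroup.log '' (Γ : Set (NilGroup (ℝ ⊗[ℚ] M)))) =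
      NilGroup.log '' (Γ : Set (NilGroup (ℝ ⊗[ℚ] M)))) :
    ∃ θ : M →ₗ[ℚ] M, Function.Surjective θ ∧ D = θ.baseChange ℝ := by
  let i : M →ₗ[ℚ] ℝ ⊗[ℚ] M := TensorProduct.mk ℚ ℝ M 1
  have hi : Function.Injective i :=
    Module.FaithfullyFlat.tensorProduct_mk_injective (A := ℚ) (B := ℝ) M
  -- `D` permutes `log Γ`, hence maps its rational span onto itself, and this span is the rational
  -- form.
  have hmap : (LinearMap.range i).map (D.restrictScalars ℚ) = LinearMap.range i := by
    rw [← h, Submodule.map_span]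
    exact congrArg _ hD
  let e : M ≃ₗ[ℚ] LinearMap.range i := LinearEquiv.ofInjective i hi
  have hmem : ∀ x ∈ LinearMap.range i, D.restrictScalars ℚ x ∈ LinearMap.range i := by
    intro x hx
    rw [← hmap]
    exact ⟨x, hx, rfl⟩
  let θ : M →ₗ[ℚ] M := e.symm.toLinearMap ∘ₗ (D.restrictScalars ℚ).restrict hmem ∘ₗ e.toLinearMap
  have hθ : ∀ m, i (θ m) = D (i m) := by
    intro m
    have : (e (θ m) : ℝ ⊗[ℚ] M) = D (e m) := by
      simp only [θ, LinearMap.comp_apply, LinearEquiv.coe_coe, LinearEquiv.apply_symm_apply]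
      rfl
    exact this
  refine ⟨θ, fun m => ?_, ?_⟩
  · have hm : i m ∈ (LinearMap.range i).map (D.restrictScalars ℚ) := by
      rw [hmap]; exact ⟨m, rfl⟩
    obtain ⟨_, ⟨m', rfl⟩, hm'⟩ := hm
    exact ⟨m', hi ((hθ m').trans hm')⟩
  · ext m
    exact (hθ m).symm

theorem isHyperbolic_of_baseChange {M : Type*} [AddCommGroup M] [Module ℚ M] [Module.Finite ℚ M]
    {θ : M →ₗ[ℚ] M} (h : IsHyperbolic (θ.baseChange ℝ)) : IsHyperbolic θ := by
  intro z hz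
  refine h z ?_
  rw [LinearMap.charpoly_baseChange, Polynomial.aeval_map_algebraMap, hz]

theorem map_lie_of_baseChange {M : Type*} [LieRing M] [LieAlgebra ℚ M] {θ : M →ₗ[ℚ] M}
    (h : ∀ x y, θ.baseChange ℝ ⁅x, y⁆ = ⁅θ.baseChange ℝ x, θ.baseChange ℝ y⁆) (x y : M) :
    θ ⁅x, y⁆ = ⁅θ x, θ y⁆ := by
  refine Module.FaithfullyFlat.tensorProduct_mk_injective (A := ℚ) (B := ℝ) M ?_
  have := h (1 ⊗ₜ x) (1 ⊗ₜ y)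
  simpa [LieAlgebra.ExtendScalars.bracket_tmul] using this

theorem realCoord_baseChange {θ : QuotLie G X →ₗ[ℚ] QuotLie G X}
    (hθ : ∀ x y, θ ⁅x, y⁆ = ⁅θ x, θ y⁆) (x : ℝ ⊗[ℚ] QuotLie G X) :
    realCoord hX (θ.baseChange ℝ x) =
      Matrix.toLin' ((vertexMatrix hX θ).map (algebraMap ℚ ℝ)) (realCoord hX x) := by
  induction x using TensorProduct.induction_on with
  | zero => simp
  | add a b ha hb => rw [map_add, map_add, ha, hb, map_add, map_add]
  | tmul a x =>
    ext s
    rw [LinearMap.baseChange_tmul, realCoord_tmul, coord_apply hθ, Matrix.toLin'_apply]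
    simp only [Matrix.mulVec, dotProduct, Matrix.map_apply, realCoord_tmul, Rat.cast_sum,
      Rat.cast_mul, Finset.mul_sum, eq_ratCast]
    exact Finset.sum_congr rfl fun t _ => by ring

/-- The subgroup `abelianImage hX Γ` of `ℝ^S` is finitely generated, spanning and mapped onto itself
by `A`. This makes the eigenvalues of `A` units without its discreteness and without a lattice in
all of `ℳ`. -/
theorem not_admitsAnosovAutomorphism (hX : X ∈ degreeThree G) (hX0 : X ≠ 0)
    {Γ : Subgroup (NilGroup (ℝ ⊗[ℚ] QuotLie G X))} (hΓ : NilGroup.IsLattice Γ)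
    (hc : NilGroup.CorrespondsTo Γ) : ¬ NilGroup.AdmitsAnosovAutomorphism Γ := by
  rintro ⟨τ, hτ, D, hD, hyp⟩
  obtain ⟨hd, hcpt⟩ := hΓ
  have hfg : Γ.FG := fg_of_cocompact Γ
  let τ' : NilGroup (ℝ ⊗[ℚ] QuotLie G X) →* NilGroup (ℝ ⊗[ℚ] QuotLie G X) := τ
  have hlog : ∀ v, (τ' (NilGroup.exp v)).log = D v := NilGroup.log_eq_of_isDifferential (τ := τ') hD
  have hlie := NilGroup.map_lie_of_map_bch (NilGroup.map_bch_of_isDifferential (τ := τ') hD)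
  have himage : D '' (NilGroup.log '' (Γ : Set (NilGroup (ℝ ⊗[ℚ] QuotLie G X)))) =
      NilGroup.log '' (Γ : Set (NilGroup (ℝ ⊗[ℚ] QuotLie G X))) := by
    have h1 : (Γ : Set (NilGroup (ℝ ⊗[ℚ] QuotLie G X))) = τ' '' Γ := by
      rw [← Subgroup.coe_map]; exact congrArg _ hτ.symm
    conv_rhs => rw [h1]
    rw [Set.image_image, Set.image_image]
    exact Set.image_congr fun γ _ => (hlog γ.log).symm
  obtain ⟨θ, hs, rfl⟩ := exists_rational_form hc himage
  have hθ := map_lie_of_baseChange hlie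
  refine false_of_isHyperbolic hX hX0 hθ hs (isHyperbolic_of_baseChange hyp) fun μ hμ => ?_
  set A := vertexMatrix hX θ
  let f := Matrix.toLin' (A.map (algebraMap ℚ ℝ))
  have hmap : (abelianImage hX Γ).map (f : (S → ℝ) →+ (S → ℝ)) = abelianImage hX Γ := by
    ext v
    rw [AddSubgroup.mem_map]
    constructor
    · rintro ⟨_, ⟨γ, hγ, rfl⟩, rfl⟩
      obtain ⟨δ, hδ, h1⟩ := himage.subset ⟨_, ⟨γ, hγ, rfl⟩, rfl⟩
      refine mem_abelianImage.2 ⟨δ, hδ, ?_⟩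
      rw [h1]
      exact realCoord_baseChange hθ _
    · rintro ⟨γ, hγ, rfl⟩
      obtain ⟨_, ⟨δ, hδ, rfl⟩, h1⟩ := himage.superset ⟨γ, hγ, rfl⟩
      refine ⟨_, mem_abelianImage.2 ⟨δ, hδ, rfl⟩, ?_⟩
      refine (realCoord_baseChange hθ _).symm.trans ?_
      rw [h1]
      rfl
  obtain ⟨p, hp, hp0, hpf⟩ := exists_monic_aeval_eq_zero_of_fg f (abelianImage_fg hfg) hmap
  refine isIntegralUnit_of_root hp hp0 (aeval_eq_zero_of_charpoly (A := A) ?_ hμ)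
  -- The image of `Γ` spans `ℝ^S`, so the equation satisfied on it holds everywhere.
  have hf0 : Polynomial.aeval f p = 0 := by
    have h1 : Submodule.span ℝ (realCoord hX '' (NilGroup.log ''
        (Γ : Set (NilGroup (ℝ ⊗[ℚ] QuotLie G X))))) = ⊤ := by
      rw [← Submodule.map_span, span_log_eq_top hc, Submodule.map_top, LinearMap.range_eq_top]
      exact realCoord_surjective
    refine LinearMap.ext_on h1 ?_
    rintro _ ⟨_, ⟨γ, hγ, rfl⟩, rfl⟩
    exact hpf _ (mem_abelianImage.2 ⟨γ, hγ, rfl⟩)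
  let φ : Matrix S S ℚ →ₐ[ℤ] Module.End ℝ (S → ℝ) :=
    ((Matrix.toLinAlgEquiv' : Matrix S S ℝ ≃ₐ[ℝ] _).toRingEquiv.toRingHom.comp
      (algebraMap ℚ ℝ).mapMatrix).toIntAlgHom
  have hφ : Function.Injective φ :=
    (Matrix.toLinAlgEquiv' : Matrix S S ℝ ≃ₐ[ℝ] _).injective.comp
      (Matrix.map_injective (algebraMap ℚ ℝ).injective)
  refine hφ ?_
  rw [← Polynomial.aeval_algHom_apply, map_zero]
  exact hf0

end Anosov

end GraphNil

end

theorem mainTheorem3 {S : Type*} [Finite S] (G : SimpleGraph S) (X : GraphNil.GraphLie G)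
    (hX : X ∈ GraphNil.degreeThree G) (hX0 : X ≠ 0) :
    (¬ ∃ θ : GraphNil.QuotLie G X ≃ₗ⁅ℚ⁆ GraphNil.QuotLie G X,
      GraphNil.IsHyperbolic (θ : GraphNil.QuotLie G X →ₗ[ℚ] GraphNil.QuotLie G X) ∧
      GraphNil.HasIntegralUnitCharpoly
        (θ : GraphNil.QuotLie G X →ₗ[ℚ] GraphNil.QuotLie G X)) ∧
    ∀ Γ : Subgroup (GraphNil.NilGroup (ℝ ⊗[ℚ] GraphNil.QuotLie G X)),
      GraphNil.NilGroup.IsLattice Γ → GraphNil.NilGroup.CorrespondsTo Γ →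
        ¬ GraphNil.NilGroup.AdmitsAnosovAutomorphism Γ := by
  classical
  have := Fintype.ofFinite S
  exact ⟨GraphNil.not_exists_hyperbolic_automorphism hX hX0,
    fun _ hΓ hc => GraphNil.not_admitsAnosovAutomorphism hX hX0 hΓ hc⟩
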